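/- Let $M$ be a smooth connected (second countable, Hausdorff) manifold of dimension $n$ with a Riemannian metric $g\in C^{0,1}_{\mathrm{loc}}\cap W^{2,2}_{\mathrm{loc}}$, meaning that in every smooth chart the components $g_{ij}$ are locally Lipschitz and have weak derivatives up to order $2$ in $L^2_{\mathrm{loc}}$. Let $d$ be the Riemannian distance and $\mathrm{Vol}$ the Riemannian volume measure of $g$. Suppose that $(M,d)$ is complete and that $(M,d,\mathrm{Vol})$ is an $\mathsf{RCD}(K,\infty)$ space for some $K\in\mathbb R$. Let $W^{1,2}(M)$ be the set of $f\in W^{1,2}_{\mathrm{loc}}(M)$ with $\int_M (f^2+|df|_g^2)\,d\mathrm{Vol}<\infty$. With $d$, $\nabla$ and $\Delta=\mathrm{div}\,\nabla$ acting on functions in the sense of distributions, put $$\mathrm{Test}(M)=\{f\in C^{0,1}(M)\cap L^\infty(M)\cap W^{1,2}(M):\ \Delta f\in L^\infty(M)\cap W^{1,2}(M)\},$$ $$\mathrm{TestF}(M)=\Big\{\sum_{i=1}^k f_i\,dh_i\in L^2(T^*M):\ k\in\mathbb N,\ f_i,h_i\in\mathrm{Test}(M)\Big\},$$ $$\mathrm{TestV}(M)=\Big\{\sum_{i=1}^k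 f_i\,\nabla h_i\in L^2(TM):\ k\in\mathbb N,\ f_i,h_i\in\mathrm{Test}(M)\Big\},$$ where $C^{0,1}(M)$ is the set of functions that are Lipschitz with respect to $d$. Then $$C^\infty_c(M)\subseteq \mathrm{Test}(M),\qquad C^\infty_c(T^*M)\subseteq \mathrm{TestF}(M).$$ If moreover $g\in C^{1,1}_{\mathrm{loc}}\cap W^{3,2}_{\mathrm{loc}}$ (in every smooth chart the $g_{ij}$ are $C^1$ with locally Lipschitz first derivatives and have weak derivatives up to order $3$ in $L^2_{\mathrm{loc}}$), then $$C^\infty_c(TM)\subseteq \mathrm{TestV}(M).$$ -/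

import Mathlib

open Set Filter Topology MeasureTheory Manifold Bundle
open scoped ENNReal NNReal ContDiff

noncomputable section

/-! ### Weak derivatives and local Sobolev spaces on open subsets of `ℝⁿ` -/

namespace EuclSobolev

/-- On the open set `Ω`, the locally integrable function `h` is the weak `i`-th partial derivative
of the locally integrable function `f`. -/
def HasWeakPartialDeriv {n : ℕ} (Ω : Set (EuclideanSpace ℝ (Fin n))) (i : Fin n)
    (f h : EuclideanSpace ℝ (Fin n) → ℝ) : Prop :=
  LocallyIntegrableOn f Ω ∧ LocallyIntegrableOn h Ω ∧
    ∀ η : EuclideanSpace ℝ (Fin n) → ℝ, ContDiff ℝ ∞ η → HasCompactSupport η → tsupport η ⊆ Ω →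
      ∫ y, f y * fderiv ℝ η y (EuclideanSpace.single i 1) = - ∫ y, h y * η y

/-- `f ∈ L²_loc(Ω)`. -/
def MemL2Loc {n : ℕ} (Ω : Set (EuclideanSpace ℝ (Fin n)))
    (f : EuclideanSpace ℝ (Fin n) → ℝ) : Prop :=
  ∀ C ⊆ Ω, IsCompact C → MemLp f 2 (volume.restrict C)

/-- `f ∈ W^{k,2}_loc(Ω)`: all weak partial derivatives of order at most `k` exist and are in
`L²_loc(Ω)`. -/
def MemWLoc {n : ℕ} (Ω : Set (EuclideanSpace ℝ (Fin n))) :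
    ℕ → (EuclideanSpace ℝ (Fin n) → ℝ) → Prop
  | 0, f => MemL2Loc Ω f
  | k + 1, f => MemL2Loc Ω f ∧
      ∀ i, ∃ h, HasWeakPartialDeriv Ω i f h ∧ MemWLoc Ω k h

end EuclSobolev

/-! ### The `RCD(K,∞)` condition for metric measure spaces -/

namespace MetricMeasure

section

variable {X : Type*} [MetricSpace X] [MeasurableSpace X]

/-- The squared `L²`-Kantorovich–Wasserstein distance. -/
def wassersteinSq (μ ν : Measure X) : ℝ≥0∞ :=
  ⨅ (q : Measure (X × X)) (_ : q.map Prod.fst = μ ∧ q.map Prod.snd = ν),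
    ∫⁻ z, edist z.1 z.2 ^ 2 ∂q

/-- The `L²`-Kantorovich–Wasserstein distance `W₂`. -/
def wasserstein (μ ν : Measure X) : ℝ≥0∞ := wassersteinSq μ ν ^ (1 / 2 : ℝ)

/-- Borel probability measures with finite second moment. -/
def P2 (X : Type*) [MetricSpace X] [MeasurableSpace X] : Set (Measure X) :=
  {μ | IsProbabilityMeasure μ ∧ ∀ x₀ : X, ∫⁻ x, edist x x₀ ^ 2 ∂μ < ⊤}

/-- The measures `μ = ρ m` in `P2` with finite entropy, i.e. with `ρ log ρ ∈ L¹(m)`, which is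
equivalent to `log ρ ∈ L¹(μ)`. -/
def entropyDomain (m : Measure X) : Set (Measure X) :=
  {μ | μ ∈ P2 X ∧ μ ≪ m ∧ Integrable (llr μ m) μ}

/-- The relative entropy `∫ ρ log ρ dm = ∫ log ρ dμ` of `μ = ρ m`, for `μ` in the domain. -/
def entropy (m μ : Measure X) : ℝ := ∫ x, llr μ m x ∂μ

/-- Constant speed `W₂`-geodesics, parametrised on `[0,1]`. -/
def IsWassersteinGeodesic (γ : ℝ → Measure X) : Prop :=
  ∀ s ∈ Icc (0 : ℝ) 1, ∀ t ∈ Icc (0 : ℝ) 1,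
    wasserstein (γ s) (γ t) = ENNReal.ofReal |s - t| * wasserstein (γ 0) (γ 1)

/-- The curvature-dimension condition `CD(K,∞)`: any two measures of finite entropy are joined by a
`W₂`-geodesic along which the entropy is `K`-convex. -/
def IsCD (K : ℝ) (m : Measure X) : Prop :=
  ∀ μ ∈ entropyDomain m, ∀ ν ∈ entropyDomain m,
    ∃ γ : ℝ → Measure X, γ 0 = μ ∧ γ 1 = ν ∧ IsWassersteinGeodesic γ ∧
      ∀ t ∈ Icc (0 : ℝ) 1, γ t ∈ entropyDomain m ∧
        entropy m (γ t) ≤ (1 - t) * entropy m μ + t * entropy m ν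
          - K / 2 * t * (1 - t) * (wassersteinSq μ ν).toReal

/-- The local Lipschitz constant (slope) of `f`; it is `0` at isolated points. -/
def localLip (f : X → ℝ) (x : X) : ℝ≥0∞ :=
  limsup (fun y => edist (f y) (f x) / edist y x) (𝓝[≠] x)

/-- The Cheeger energy: the `L²`-lower semicontinuous relaxation of `f ↦ ½ ∫ lip(f)² dm`, defined
on Lipschitz functions in `L²`. -/
def cheegerEnergy (m : Measure X) (f : X → ℝ) : ℝ≥0∞ :=
  ⨅ (u : ℕ → X → ℝ)
    (_ : (∀ k, (∃ C, LipschitzWith C (u k)) ∧ MemLp (u k) 2 m) ∧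
      Tendsto (fun k => eLpNorm (u k - f) 2 m) atTop (𝓝 0)),
    liminf (fun k => 2⁻¹ * ∫⁻ x, localLip (u k) x ^ 2 ∂m) atTop

/-- The Cheeger energy is a quadratic form, i.e. the Sobolev space `W^{1,2}` is Hilbert. -/
def IsInfinitesimallyHilbertian (m : Measure X) : Prop :=
  ∀ f g : X → ℝ, MemLp f 2 m → MemLp g 2 m →
    cheegerEnergy m (f + g) + cheegerEnergy m (f - g)
      = 2 * cheegerEnergy m f + 2 * cheegerEnergy m g

/-- `(X,d,m)` is an `RCD(K,∞)` space. -/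
structure IsRCD (K : ℝ) (m : Measure X) : Prop where
  complete : CompleteSpace X
  separable : SecondCountableTopology X
  borel : BorelSpace X
  finite_on_balls : ∀ (x : X) (r : ℝ), m (Metric.ball x r) < ⊤
  cd : IsCD K m
  hilbertian : IsInfinitesimallyHilbertian m

end

end MetricMeasure

/-! ### Riemannian manifolds with a metric of low regularity -/

namespace LowReg

open EuclSobolev

section Charts

variable (n : ℕ) {M : Type*} [TopologicalSpace M] [ChartedSpace (EuclideanSpace ℝ (Fin n)) M]

/-- The smooth charts of `M` (all charts of the maximal smooth atlas). -/
def charts (M : Type*) [TopologicalSpace M] [ChartedSpace (EuclideanSpace ℝ (Fin n)) M] :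
    Set (OpenPartialHomeomorph M (EuclideanSpace ℝ (Fin n))) :=
  IsManifold.maximalAtlas (𝓡 n) ∞ M

/-- The coordinate vector field `∂ᵢ` of the chart `φ`, at the point with coordinates `y`. -/
def coordVec (φ : OpenPartialHomeomorph M (EuclideanSpace ℝ (Fin n))) (i : Fin n)
    (y : EuclideanSpace ℝ (Fin n)) : TangentSpace (𝓡 n) (φ.symm y) :=
  mfderiv (𝓡 n) (𝓡 n) φ.symm y (EuclideanSpace.single i (1 : ℝ) : EuclideanSpace ℝ (Fin n))

/-- A function on `M` is in `W^{k,2}_loc(M)` if it is so in all smooth charts. -/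
def MemWLocM (k : ℕ) (f : M → ℝ) : Prop :=
  ∀ φ ∈ charts n M, MemWLoc φ.target k (fun y => f (φ.symm y))

/-- The 1-form `α` is the weak differential `df`: in all smooth charts its components are the weak
partial derivatives of `f`. -/
def HasWeakDifferential (f : M → ℝ) (α : ∀ x : M, TangentSpace (𝓡 n) x →L[ℝ] ℝ) : Prop :=
  ∀ φ ∈ charts n M, ∀ i : Fin n,
    HasWeakPartialDeriv φ.target i (fun y => f (φ.symm y))
      (fun y => α (φ.symm y) (coordVec n φ i y))

/-- `f ∈ C^∞_c(M)`. -/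
def IsSmoothCompactFun (f : M → ℝ) : Prop :=
  ContMDiff (𝓡 n) 𝓘(ℝ, ℝ) ∞ f ∧ HasCompactSupport f

variable [IsManifold (𝓡 n) ∞ M]

/-- `α ∈ C^∞_c(T*M)`. -/
def IsSmoothCompactForm (α : ∀ x : M, TangentSpace (𝓡 n) x →L[ℝ] ℝ) : Prop :=
  ContMDiff (𝓡 n) ((𝓡 n).prod 𝓘(ℝ, EuclideanSpace ℝ (Fin n) →L[ℝ] ℝ)) ∞
      (fun x => TotalSpace.mk' (EuclideanSpace ℝ (Fin n) →L[ℝ] ℝ)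
        (E := fun x : M => TangentSpace (𝓡 n) x →L[ℝ] Bundle.Trivial M ℝ x) x (α x)) ∧
    IsCompact (closure {x | α x ≠ 0})

/-- `V ∈ C^∞_c(TM)`. -/
def IsSmoothCompactField (V : ∀ x : M, TangentSpace (𝓡 n) x) : Prop :=
  ContMDiff (𝓡 n) (𝓡 n).tangent ∞ (fun x => (⟨x, V x⟩ : TangentBundle (𝓡 n) M)) ∧
    IsCompact (closure {x | V x ≠ 0})

end Charts

section Metric

variable (n : ℕ) {M : Type*} [TopologicalSpace M] [ChartedSpace (EuclideanSpace ℝ (Fin n)) M]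
  [RiemannianBundle (fun x : M => TangentSpace (𝓡 n) x)]

/-- The components `g_{ij}` of the metric in the chart `φ`. -/
def metricCoeff (φ : OpenPartialHomeomorph M (EuclideanSpace ℝ (Fin n))) (i j : Fin n)
    (y : EuclideanSpace ℝ (Fin n)) : ℝ :=
  inner ℝ (coordVec n φ i y) (coordVec n φ j y)

/-- `g ∈ C^{0,1}_loc`. -/
def IsMetricC01 (M : Type*) [TopologicalSpace M] [ChartedSpace (EuclideanSpace ℝ (Fin n)) M]
    [RiemannianBundle (fun x : M => TangentSpace (𝓡 n) x)] : Prop :=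
  ∀ φ ∈ charts n M, ∀ i j, LocallyLipschitzOn φ.target (metricCoeff n φ i j)

/-- `g ∈ C^{1,1}_loc`. -/
def IsMetricC11 (M : Type*) [TopologicalSpace M] [ChartedSpace (EuclideanSpace ℝ (Fin n)) M]
    [RiemannianBundle (fun x : M => TangentSpace (𝓡 n) x)] : Prop :=
  ∀ φ ∈ charts n M, ∀ i j, ContDiffOn ℝ 1 (metricCoeff n φ i j) φ.target ∧
    LocallyLipschitzOn φ.target (fderiv ℝ (metricCoeff n φ i j))

/-- `g ∈ W^{k,2}_loc`. -/
def IsMetricW (M : Type*) [TopologicalSpace M] [ChartedSpace (EuclideanSpace ℝ (Fin n)) M]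
    [RiemannianBundle (fun x : M => TangentSpace (𝓡 n) x)] (k : ℕ) : Prop :=
  ∀ φ ∈ charts n M, ∀ i j, MemWLoc φ.target k (metricCoeff n φ i j)

/-- The vector field `V` is the weak gradient `∇f`, i.e. `⟨V, ·⟩` is the weak differential. -/
def HasWeakGradient (f : M → ℝ) (V : ∀ x : M, TangentSpace (𝓡 n) x) : Prop :=
  HasWeakDifferential n f (fun x => innerSL ℝ (V x))

variable [MeasurableSpace M]

/-- The measure `√(det g) dx` of the chart `φ`, as a measure on `M` carried by the domain
of `φ`. -/
def chartVolume (φ : OpenPartialHomeomorph M (EuclideanSpace ℝ (Fin n))) : Measure M :=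
  ((volume.restrict φ.target).withDensity
    (fun y => ENNReal.ofReal (Real.sqrt (Matrix.det (Matrix.of fun i j => metricCoeff n φ i j y))))
    ).map φ.symm

/-- The Riemannian volume measure `Vol`. The measures of any two charts agree on the
intersection of their domains, and `Vol` is the measure that restricts to them; being carried
by the chart domains, they have it as their supremum. -/
def vol (M : Type*) [TopologicalSpace M] [ChartedSpace (EuclideanSpace ℝ (Fin n)) M]
    [RiemannianBundle (fun x : M => TangentSpace (𝓡 n) x)] [MeasurableSpace M] : Measure M :=
  ⨆ φ ∈ charts n M, chartVolume n φ

/-- `f ∈ W^{1,2}(M)`: `f ∈ W^{1,2}_loc(M)` and `∫ (f² + |df|²) dVol < ∞`. -/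
def MemW12 (f : M → ℝ) : Prop :=
  MemWLocM n 1 f ∧ ∃ α : ∀ x : M, TangentSpace (𝓡 n) x →L[ℝ] ℝ, HasWeakDifferential n f α ∧
    ∫⁻ x, (‖f x‖ₑ ^ 2 + ‖α x‖ₑ ^ 2) ∂(vol n M) < ⊤

/-- `h = Δf = div ∇f` in the sense of distributions:
`∫ h η dVol = - ∫ g(∇f, ∇η) dVol` for all `η ∈ C^∞_c(M)`. -/
def HasWeakLaplacian (f h : M → ℝ) : Prop :=
  LocallyIntegrable h (vol n M) ∧
    ∃ V : ∀ x : M, TangentSpace (𝓡 n) x, HasWeakGradient n f V ∧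
      ∀ η : M → ℝ, IsSmoothCompactFun n η →
        ∫ x, h x * η x ∂(vol n M) = - ∫ x, (mfderiv (𝓡 n) 𝓘(ℝ, ℝ) η x (V x) : ℝ) ∂(vol n M)

end Metric

section Test

variable (n : ℕ) (M : Type*) [MetricSpace M] [ChartedSpace (EuclideanSpace ℝ (Fin n)) M]
  [RiemannianBundle (fun x : M => TangentSpace (𝓡 n) x)] [MeasurableSpace M]

/-- Test functions: `f ∈ C^{0,1}(M) ∩ L^∞(M) ∩ W^{1,2}(M)` with
`Δf ∈ L^∞(M) ∩ W^{1,2}(M)`. -/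
def Test : Set (M → ℝ) :=
  {f | (∃ C, LipschitzWith C f) ∧ MemLp f ⊤ (vol n M) ∧ MemW12 n f ∧
    ∃ h : M → ℝ, HasWeakLaplacian n f h ∧ MemLp h ⊤ (vol n M) ∧ MemW12 n h}

/-- Test 1-forms: the square integrable finite sums `∑ fᵢ dhᵢ` (equality almost everywhere) with
test functions `fᵢ, hᵢ`. -/
def TestF : Set (∀ x : M, TangentSpace (𝓡 n) x →L[ℝ] ℝ) :=
  {α | ∫⁻ x, ‖α x‖ₑ ^ 2 ∂(vol n M) < ⊤ ∧
    ∃ (k : ℕ) (f h : Fin k → M → ℝ) (θ : Fin k → ∀ x : M, TangentSpace (𝓡 n) x →L[ℝ] ℝ),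
      (∀ i, f i ∈ Test n M ∧ h i ∈ Test n M ∧ HasWeakDifferential n (h i) (θ i)) ∧
      ∀ᵐ x ∂(vol n M), α x = ∑ i, f i x • θ i x}

/-- Test vector fields: the square integrable finite sums `∑ fᵢ ∇hᵢ` (equality almost everywhere)
with test functions `fᵢ, hᵢ`. -/
def TestV : Set (∀ x : M, TangentSpace (𝓡 n) x) :=
  {V | ∫⁻ x, ‖V x‖ₑ ^ 2 ∂(vol n M) < ⊤ ∧
    ∃ (k : ℕ) (f h : Fin k → M → ℝ) (W : Fin k → ∀ x : M, TangentSpace (𝓡 n) x),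
      (∀ i, f i ∈ Test n M ∧ h i ∈ Test n M ∧ HasWeakGradient n (h i) (W i)) ∧
      ∀ᵐ x ∂(vol n M), V x = ∑ i, f i x • W i x}

end Test

end LowReg

end

noncomputable section

set_option linter.unusedSectionVars false

/-! ### Locally Lipschitz functions -/

section LocallyLipschitz

variable {E F G : Type*} [NormedAddCommGroup E] [NormedSpace ℝ E] [NormedAddCommGroup F]
  [NormedSpace ℝ F] [NormedAddCommGroup G] [NormedSpace ℝ G] {Ω : Set E}

/-! The statement is local. A partition of unity near the compact support writes a function as a
finite sum of functions carried by single charts, and for `F` in a chart `ΔF = (√det g)⁻¹ ∑ ∂ᵢ(aⁱʲ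
∂ⱼF)` with `aⁱʲ = √(det g) gⁱʲ`. The `aⁱʲ` are smooth functions of the `g_{kl}` on positive definite
matrices, hence locally Lipschitz. So the flux `aⁱʲ ∂ⱼF` is Lipschitz near the support and `ΔF` is
bounded.

That `ΔF` is in `W^{1,2}` rests on one algebraic fact, `MemWLoc.lipschitz_mul`: a locally Lipschitz
function times a `W^{1,2}_loc` function is again in `W^{1,2}_loc`. Through the chain rule
(`memWLoc_pd_comp`) it gives `∂ₖaⁱʲ ∈ W^{1,2}_loc`, and then it applies to each term of `∂ᵢaⁱʲ ∂ⱼF +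
aⁱʲ ∂ᵢ∂ⱼF` (`IsChartTest.memWLoc_chartLaplacian`). All this asks of `F` is that `∂F` be locally
Lipschitz and `∂²F` be in `W^{1,2}_loc`; this is the class `IsChartTest`.

A form is `∑ ρ_c α(∂ᵢ) dxⁱ`, where the coordinates `xⁱ` may be cut off away from the support
(`isTestSum_of_forall_chart`), so its coefficients are smooth. A vector field `V` is treated through
the form `⟨V, ·⟩`. Its coefficients `ρ Vʲ g_{ij}` are only as regular as `g`, and for `g ∈ C^{1,1} ∩
W^{3,2}` they still belong to `IsChartTest` (`isChartTest_mul`). Raising the index again turns `∑ f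
dh` into `∑ f ∇h`.

The rest passes from one chart to the manifold. Weak derivatives transform under transition maps
(`OpenPartialHomeomorph.hasWeakPartialDeriv_comp`, by the Piola identity) and extend by zero
(`HasWeakPartialDeriv.extend`). The volume restricts to `√(det g) dx` (`vol_restrict_source`), so
integration by parts in the chart yields the distributional Laplacian
(`IsChartTest.hasIntegrableLaplacian`). A bound on `|df|` gives a Lipschitz bound for the distance
(`lipschitzWith_of_norm_dform_le`). Summation takes place in `IsStrongTest`, which carries the
integrability that addition needs. -/

theorem LocallyLipschitzOn.contDiffAt_comp {u : E → F} {Φ : F → G}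
    (hu : LocallyLipschitzOn Ω u) (hΦ : ∀ y ∈ Ω, ContDiffAt ℝ 1 Φ (u y)) :
    LocallyLipschitzOn Ω (fun y => Φ (u y)) := by
  intro y hy
  obtain ⟨K, t, ht, hK⟩ := hu hy
  obtain ⟨L, s, hs, hL⟩ := (hΦ y hy).exists_lipschitzOnWith
  refine ⟨L * K, t ∩ u ⁻¹' s, inter_mem ht ((hu.continuousOn y hy) hs), ?_⟩
  exact hL.comp (hK.mono inter_subset_left) fun z hz => hz.2

theorem ContDiffOn.locallyLipschitzOn_of_isOpen {u : E → F} (hΩ : IsOpen Ω)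
    (hu : ContDiffOn ℝ 1 u Ω) : LocallyLipschitzOn Ω u := by
  intro y hy
  obtain ⟨K, t, ht, h⟩ := ((hu y hy).contDiffAt (hΩ.mem_nhds hy)).exists_lipschitzOnWith
  exact ⟨K, t, mem_nhdsWithin_of_mem_nhds ht, h⟩

theorem LocallyLipschitzOn.prodMk {u : E → F} {v : E → G} (hu : LocallyLipschitzOn Ω u)
    (hv : LocallyLipschitzOn Ω v) : LocallyLipschitzOn Ω (fun y => (u y, v y)) := by
  intro y hy
  obtain ⟨K, t, ht, hK⟩ := hu hy
  obtain ⟨L, s, hs, hL⟩ := hv hy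
  exact ⟨max K L, t ∩ s, inter_mem ht hs,
    (hK.mono inter_subset_left).prodMk (hL.mono inter_subset_right)⟩

theorem LocallyLipschitzOn.real_mul {u v : E → ℝ} (hu : LocallyLipschitzOn Ω u)
    (hv : LocallyLipschitzOn Ω v) : LocallyLipschitzOn Ω (fun y => u y * v y) :=
  (hu.prodMk hv).contDiffAt_comp (Φ := fun p : ℝ × ℝ => p.1 * p.2)
    fun _ _ => contDiffAt_fst.mul contDiffAt_snd

theorem locallyLipschitzOn_const (c : F) : LocallyLipschitzOn Ω (fun _ : E => c) :=
  (LocallyLipschitz.const c).locallyLipschitzOn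

theorem LocallyLipschitzOn.real_add {u v : E → F} (hu : LocallyLipschitzOn Ω u)
    (hv : LocallyLipschitzOn Ω v) : LocallyLipschitzOn Ω (fun y => u y + v y) := hu.add hv

theorem LocallyLipschitzOn.real_sum {ι : Type*} {s : Finset ι} {u : ι → E → F}
    (hu : ∀ i ∈ s, LocallyLipschitzOn Ω (u i)) :
    LocallyLipschitzOn Ω (fun y => ∑ i ∈ s, u i y) := by
  classical
  induction s using Finset.induction_on with
  | empty => simpa using locallyLipschitzOn_const (0 : F)
  | insert a s ha ih =>
    simp only [Finset.sum_insert ha]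
    exact (hu a (Finset.mem_insert_self _ _)).real_add
      (ih fun i hi => hu i (Finset.mem_insert_of_mem hi))

theorem LocallyLipschitzOn.pi {ι : Type*} [Fintype ι] {u : ι → E → ℝ}
    (hu : ∀ i, LocallyLipschitzOn Ω (u i)) :
    LocallyLipschitzOn Ω (fun y i => u i y) := by
  intro y hy
  choose K t ht hK using fun i => hu i hy
  refine ⟨∑ i, K i, ⋂ i, t i, (Filter.iInter_mem).2 ht, ?_⟩
  intro a ha b hb
  rw [edist_pi_le_iff]
  intro i
  refine (hK i (mem_iInter.1 ha i) (mem_iInter.1 hb i)).trans ?_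
  gcongr
  exact Finset.single_le_sum (f := K) (fun _ _ => zero_le) (Finset.mem_univ i)

theorem LocallyLipschitzOn.congr_eqOn {u v : E → F} (hu : LocallyLipschitzOn Ω u)
    (h : EqOn u v Ω) : LocallyLipschitzOn Ω v := by
  intro y hy
  obtain ⟨K, t, ht, hK⟩ := hu hy
  refine ⟨K, t ∩ Ω, inter_mem ht self_mem_nhdsWithin, fun a ha b hb => ?_⟩
  rw [← h ha.2, ← h hb.2]
  exact hK ha.1 hb.1

/-- A locally Lipschitz function is Lipschitz on a compact neighbourhood of `K` inside `Ω`, and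
extends from there to the whole space. Agreement near `K`, not only on `K`, makes the derivatives
agree on `K` too, so that theorems on globally Lipschitz functions become available. -/
theorem LocallyLipschitzOn.exists_lipschitzWith [FiniteDimensional ℝ E] {u : E → ℝ}
    (hΩ : IsOpen Ω) (hu : LocallyLipschitzOn Ω u) {K : Set E} (hK : IsCompact K) (hKΩ : K ⊆ Ω) :
    ∃ (v : E → ℝ) (C : ℝ≥0), LipschitzWith C v ∧ ∀ᶠ y in 𝓝ˢ K, v y = u y := by
  have : ProperSpace E := FiniteDimensional.proper_real E
  obtain ⟨L, hL, hKL, hLΩ⟩ := exists_compact_between hK hΩ hKΩ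
  obtain ⟨C, hC⟩ := LocallyLipschitzOn.exists_lipschitzOnWith_of_compact hL (hu.mono hLΩ)
  obtain ⟨v, hv, hvu⟩ := hC.extend_real
  refine ⟨v, C, hv, ?_⟩
  filter_upwards [isOpen_interior.mem_nhdsSet.2 hKL] with y hy
  exact (hvu (interior_subset hy)).symm

/-- Rademacher's theorem holds on a neighbourhood of each point, and a set that is locally null is
null. -/
theorem LocallyLipschitzOn.ae_differentiableAt_of_isOpen [FiniteDimensional ℝ E]
    [FiniteDimensional ℝ F]
    [MeasurableSpace E] [BorelSpace E] {μ : Measure E} [μ.IsAddHaarMeasure] {u : E → F}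
    (hΩ : IsOpen Ω) (hu : LocallyLipschitzOn Ω u) :
    ∀ᵐ y ∂μ, y ∈ Ω → DifferentiableAt ℝ u y := by
  have : ProperSpace E := FiniteDimensional.proper_real E
  rw [ae_iff]
  refine measure_null_of_locally_null _ fun y hy => ?_
  have hyΩ : y ∈ Ω := by
    by_contra h
    exact hy fun h' => (h h').elim
  obtain ⟨K, t, ht, hK⟩ := hu hyΩ
  rw [hΩ.nhdsWithin_eq hyΩ] at ht
  refine ⟨_, inter_mem self_mem_nhdsWithin
    (mem_nhdsWithin_of_mem_nhds (interior_mem_nhds.2 ht)), ?_⟩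
  have h := (hK.mono interior_subset).ae_differentiableWithinAt_of_mem (μ := μ)
  refine measure_mono_null ?_ (ae_iff.1 h)
  intro z hz h'
  exact hz.1 fun _ => (h' hz.2).differentiableAt (isOpen_interior.mem_nhds hz.2)

theorem LipschitzWith.mul_of_hasCompactSupport {v η : E → ℝ} {C D : ℝ≥0}
    (hv : LipschitzWith C v) (hη : LipschitzWith D η) (hc : HasCompactSupport η) :
    ∃ C', LipschitzWith C' (fun y => v y * η y) := by
  obtain ⟨M, hM⟩ := hc.exists_bound_of_continuous hη.continuous
  obtain ⟨N, hN⟩ := hc.isCompact.exists_bound_of_continuousOn hv.continuous.continuousOn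
  have hM0 : 0 ≤ M := (norm_nonneg _).trans (hM 0)
  -- The factor `v` may be unbounded, so the difference is split with `v` evaluated at the point of
  -- the support of `η`. The case where only `x` lies in the support follows by symmetry.
  have key : ∀ x y, y ∈ tsupport η →
      dist (v x * η x) (v y * η y) ≤
        (Real.toNNReal N * D + C * Real.toNNReal M : ℝ≥0) * dist x y := by
    intro x y hy
    have h1 : dist (v x) (v y) ≤ C * dist x y := hv.dist_le_mul x y
    have h2 : dist (η x) (η y) ≤ D * dist x y := hη.dist_le_mul x y
    rw [Real.dist_eq] at h1 h2 ⊢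
    have h3 : v x * η x - v y * η y = v y * (η x - η y) + (v x - v y) * η x := by ring
    rw [h3]
    refine (abs_add_le _ _).trans ?_
    rw [abs_mul, abs_mul]
    push_cast
    have e1 : |v y| ≤ (Real.toNNReal N : ℝ) := (hN y hy).trans (Real.le_coe_toNNReal N)
    have e2 : |η x| ≤ (Real.toNNReal M : ℝ) := (hM x).trans (Real.le_coe_toNNReal M)
    calc |v y| * |η x - η y| + |v x - v y| * |η x|
        ≤ (Real.toNNReal N : ℝ) * (D * dist x y) + (C * dist x y) * (Real.toNNReal M : ℝ) := by
          gcongr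
      _ = _ := by ring
  refine ⟨Real.toNNReal N * D + C * Real.toNNReal M, LipschitzWith.of_dist_le_mul fun x y => ?_⟩
  by_cases hy : y ∈ tsupport η
  · exact key x y hy
  by_cases hx : x ∈ tsupport η
  · rw [dist_comm, dist_comm x y]
    exact key y x hx
  · simp only [image_eq_zero_of_notMem_tsupport hx, image_eq_zero_of_notMem_tsupport hy,
      mul_zero, dist_self]
    positivity

end LocallyLipschitz

/-! ### Weak derivatives -/

namespace EuclSobolev

variable {n : ℕ} {Ω : Set (EuclideanSpace ℝ (Fin n))} {i : Fin n}

/-- The `i`-th partial derivative. -/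
def pd (i : Fin n) (u : EuclideanSpace ℝ (Fin n) → ℝ) (y : EuclideanSpace ℝ (Fin n)) : ℝ :=
  fderiv ℝ u y (EuclideanSpace.single i 1)

theorem measurable_pd (i : Fin n) (u : EuclideanSpace ℝ (Fin n) → ℝ) : Measurable (pd i u) :=
  measurable_fderiv_apply_const ℝ u _

theorem pd_congr {u v : EuclideanSpace ℝ (Fin n) → ℝ} {y : EuclideanSpace ℝ (Fin n)}
    (h : u =ᶠ[𝓝 y] v) : pd i u y = pd i v y := by
  rw [pd, pd, h.fderiv_eq]

theorem norm_pd_le {u : EuclideanSpace ℝ (Fin n) → ℝ} {C : ℝ≥0} (hu : LipschitzWith C u)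
    (y : EuclideanSpace ℝ (Fin n)) : ‖pd i u y‖ ≤ C := by
  refine ((fderiv ℝ u y).le_opNorm _).trans ?_
  simpa using norm_fderiv_le_of_lipschitz ℝ hu (x₀ := y)

theorem pd_eq_zero_of_notMem {u : EuclideanSpace ℝ (Fin n) → ℝ} {y : EuclideanSpace ℝ (Fin n)}
    (h : y ∉ tsupport u) : pd i u y = 0 := by
  rw [pd_congr (notMem_tsupport_iff_eventuallyEq.1 h)]
  simp [pd]

theorem pd_mul {u v : EuclideanSpace ℝ (Fin n) → ℝ} {y : EuclideanSpace ℝ (Fin n)}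
    (hu : DifferentiableAt ℝ u y) (hv : DifferentiableAt ℝ v y) :
    pd i (fun y => u y * v y) y = pd i u y * v y + u y * pd i v y := by
  simp only [pd]
  rw [show (fun y => u y * v y) = u * v from rfl, fderiv_mul hu hv]
  simp
  ring

theorem pd_add {u v : EuclideanSpace ℝ (Fin n) → ℝ} {y : EuclideanSpace ℝ (Fin n)}
    (hu : DifferentiableAt ℝ u y) (hv : DifferentiableAt ℝ v y) :
    pd i (fun y => u y + v y) y = pd i u y + pd i v y := by
  simp only [pd]
  rw [show (fun y => u y + v y) = u + v from rfl, fderiv_add hu hv]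
  simp

theorem pd_sum {ι : Type*} {s : Finset ι} {u : ι → EuclideanSpace ℝ (Fin n) → ℝ}
    {y : EuclideanSpace ℝ (Fin n)} (hu : ∀ k ∈ s, DifferentiableAt ℝ (u k) y) :
    pd i (fun y => ∑ k ∈ s, u k y) y = ∑ k ∈ s, pd i (u k) y := by
  simp only [pd]
  rw [fderiv_fun_sum hu]
  simp

theorem integrable_mul_of_locallyIntegrableOn {f b : EuclideanSpace ℝ (Fin n) → ℝ}
    (hf : LocallyIntegrableOn f Ω) (hb : AEStronglyMeasurable b) {C : ℝ}
    (hC : ∀ y, ‖b y‖ ≤ C) {K : Set (EuclideanSpace ℝ (Fin n))} (hK : IsCompact K) (hKΩ : K ⊆ Ω)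
    (h0 : ∀ y ∉ K, b y = 0) : Integrable (fun y => f y * b y) := by
  have h1 : IntegrableOn (fun y => f y * b y) K :=
    (hf.integrableOn_compact_subset hKΩ hK).mul_bdd (c := C) hb.restrict (ae_of_all _ hC)
  refine (integrableOn_iff_integrable_of_support_subset ?_).1 h1
  intro y hy
  by_contra h
  exact hy (by simp [h0 y h])

theorem integrable_mul_of_continuous {f b : EuclideanSpace ℝ (Fin n) → ℝ}
    (hf : LocallyIntegrableOn f Ω) (hb : Continuous b) (hc : HasCompactSupport b)
    (hs : tsupport b ⊆ Ω) : Integrable (fun y => f y * b y) := by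
  obtain ⟨C, hC⟩ := hc.exists_bound_of_continuous hb
  exact integrable_mul_of_locallyIntegrableOn hf hb.aestronglyMeasurable hC hc.isCompact hs
    fun y hy => image_eq_zero_of_notMem_tsupport hy

theorem integrable_mul_pd {f b : EuclideanSpace ℝ (Fin n) → ℝ}
    (hf : LocallyIntegrableOn f Ω) {C : ℝ≥0} (hb : LipschitzWith C b) (hc : HasCompactSupport b)
    (hs : tsupport b ⊆ Ω) : Integrable (fun y => f y * pd i b y) :=
  integrable_mul_of_locallyIntegrableOn hf (measurable_pd i b).aestronglyMeasurable
    (norm_pd_le hb) hc.isCompact hs fun _ hy => pd_eq_zero_of_notMem hy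

theorem _root_.LipschitzWith.integral_mul_pd {u η : EuclideanSpace ℝ (Fin n) → ℝ} {C D : ℝ≥0}
    (hu : LipschitzWith C u) (hη : LipschitzWith D η) (hc : HasCompactSupport η) :
    ∫ y, u y * pd i η y = - ∫ y, pd i u y * η y := by
  have h := hu.integral_lineDeriv_mul_eq (μ := volume) hη hc (EuclideanSpace.single i (1 : ℝ))
  have h1 : ∫ y, pd i u y * η y = ∫ y, lineDeriv ℝ u y (EuclideanSpace.single i (1 : ℝ)) * η y := by
    refine integral_congr_ae ?_
    filter_upwards [hu.ae_differentiableAt (μ := volume)] with y hy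
    simp only [pd, hy.lineDeriv_eq_fderiv]
  have h2 : ∫ y, u y * pd i η y =
      - ∫ y, lineDeriv ℝ η y (-EuclideanSpace.single i (1 : ℝ)) * u y := by
    rw [← integral_neg]
    refine integral_congr_ae ?_
    filter_upwards [hη.ae_differentiableAt (μ := volume)] with y hy
    simp only [pd, hy.lineDeriv_eq_fderiv, map_neg]
    ring
  rw [h1, h2, h]

theorem _root_.LocallyLipschitzOn.exists_bound_pd {u : EuclideanSpace ℝ (Fin n) → ℝ}
    (hΩ : IsOpen Ω) (hu : LocallyLipschitzOn Ω u) {K : Set (EuclideanSpace ℝ (Fin n))}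
    (hK : IsCompact K) (hKΩ : K ⊆ Ω) (i : Fin n) : ∃ C, ∀ y ∈ K, ‖pd i u y‖ ≤ C := by
  obtain ⟨v, C, hv, hvu⟩ := hu.exists_lipschitzWith hΩ hK hKΩ
  refine ⟨C, fun y hy => ?_⟩
  rw [← pd_congr (eventually_nhdsSet_iff_forall.1 hvu y hy)]
  exact norm_pd_le hv y

theorem memL2Loc_of_bound {w : EuclideanSpace ℝ (Fin n) → ℝ}
    (hm : ∀ K ⊆ Ω, IsCompact K → AEStronglyMeasurable w (volume.restrict K))
    (hb : ∀ K ⊆ Ω, IsCompact K → ∃ C, ∀ y ∈ K, ‖w y‖ ≤ C) : MemL2Loc Ω w := by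
  intro K hKΩ hK
  obtain ⟨C, hC⟩ := hb K hKΩ hK
  have : IsFiniteMeasure (volume.restrict K) := ⟨by simpa using hK.measure_lt_top⟩
  exact MemLp.of_bound (hm K hKΩ hK) C ((ae_restrict_iff' hK.measurableSet).2 (ae_of_all _ hC))

theorem MemL2Loc.locallyIntegrableOn (hΩ : IsOpen Ω) {w : EuclideanSpace ℝ (Fin n) → ℝ}
    (hw : MemL2Loc Ω w) : LocallyIntegrableOn w Ω := by
  rw [locallyIntegrableOn_iff hΩ.isLocallyClosed]
  intro K hKΩ hK
  have : IsFiniteMeasure (volume.restrict K) := ⟨by simpa using hK.measure_lt_top⟩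
  exact (hw K hKΩ hK).integrable one_le_two

theorem _root_.LocallyLipschitzOn.memL2Loc {u : EuclideanSpace ℝ (Fin n) → ℝ}
    (hu : LocallyLipschitzOn Ω u) : MemL2Loc Ω u :=
  memL2Loc_of_bound
    (fun _ hKΩ hK => (hu.continuousOn.mono hKΩ).aestronglyMeasurable hK.measurableSet)
    (fun _ hKΩ hK => hK.exists_bound_of_continuousOn (hu.continuousOn.mono hKΩ))

theorem _root_.LocallyLipschitzOn.memL2Loc_pd {u : EuclideanSpace ℝ (Fin n) → ℝ}
    (hΩ : IsOpen Ω) (hu : LocallyLipschitzOn Ω u) (i : Fin n) : MemL2Loc Ω (pd i u) :=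
  memL2Loc_of_bound (fun _ _ _ => (measurable_pd i u).aestronglyMeasurable)
    (fun _ hKΩ hK => hu.exists_bound_pd hΩ hK hKΩ i)

/-- Only the values of `u` near the support of the test function matter. There `u` coincides with a
globally Lipschitz function, for which integration by parts holds with the almost everywhere
derivative. -/
theorem _root_.LocallyLipschitzOn.hasWeakPartialDeriv {u : EuclideanSpace ℝ (Fin n) → ℝ}
    (hΩ : IsOpen Ω) (hu : LocallyLipschitzOn Ω u) (i : Fin n) :
    HasWeakPartialDeriv Ω i u (pd i u) := by
  refine ⟨hu.memL2Loc.locallyIntegrableOn hΩ, (hu.memL2Loc_pd hΩ i).locallyIntegrableOn hΩ, ?_⟩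
  intro η hη hc hs
  obtain ⟨v, C, hv, hvu⟩ := hu.exists_lipschitzWith hΩ hc.isCompact hs
  obtain ⟨D, hD⟩ := hη.lipschitzWith_of_hasCompactSupport hc (by simp)
  have h := hv.integral_mul_pd (i := i) hD hc
  have hv' : ∀ y ∈ tsupport η, v =ᶠ[𝓝 y] u := eventually_nhdsSet_iff_forall.1 hvu
  have h1 : ∫ y, u y * pd i η y = ∫ y, v y * pd i η y := by
    congr 1
    ext y
    by_cases hy : y ∈ tsupport η
    · rw [(hv' y hy).eq_of_nhds]
    · rw [pd_eq_zero_of_notMem hy, mul_zero, mul_zero]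
  have h2 : ∫ y, pd i u y * η y = ∫ y, pd i v y * η y := by
    congr 1
    ext y
    by_cases hy : y ∈ tsupport η
    · rw [pd_congr (hv' y hy)]
    · rw [image_eq_zero_of_notMem_tsupport hy, mul_zero, mul_zero]
  change ∫ y, u y * pd i η y = _
  rw [h1, h2, h]

theorem HasWeakPartialDeriv.ae_eq (hΩ : IsOpen Ω) {f h h' : EuclideanSpace ℝ (Fin n) → ℝ}
    (hf : HasWeakPartialDeriv Ω i f h) (hf' : HasWeakPartialDeriv Ω i f h') :
    ∀ᵐ y, y ∈ Ω → h y = h' y := by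
  have := hΩ.ae_eq_zero_of_integral_contDiff_smul_eq_zero (hf.2.1.sub hf'.2.1) ?_
  · filter_upwards [this] with y hy hyΩ
    exact sub_eq_zero.1 (hy hyΩ)
  · intro η hη hc hs
    have h1 := hf.2.2 η hη hc hs
    rw [hf'.2.2 η hη hc hs, neg_inj] at h1
    simp only [Pi.sub_apply, smul_eq_mul, mul_sub]
    simp only [mul_comm (η _)]
    rw [integral_sub (integrable_mul_of_continuous hf.2.1 hη.continuous hc hs)
      (integrable_mul_of_continuous hf'.2.1 hη.continuous hc hs), h1, sub_self]

theorem memL2Loc_congr {f g : EuclideanSpace ℝ (Fin n) → ℝ} (hf : MemL2Loc Ω f)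
    (h : ∀ᵐ y, y ∈ Ω → f y = g y) : MemL2Loc Ω g := by
  intro K hKΩ hK
  refine (hf K hKΩ hK).ae_eq ?_
  rw [Filter.EventuallyEq, ae_restrict_iff' hK.measurableSet]
  filter_upwards [h] with y hy hyK using hy (hKΩ hyK)

theorem locallyIntegrableOn_congr (hΩ : IsOpen Ω) {f g : EuclideanSpace ℝ (Fin n) → ℝ}
    (hf : LocallyIntegrableOn f Ω)
    (h : ∀ᵐ y, y ∈ Ω → f y = g y) : LocallyIntegrableOn g Ω := by
  rw [locallyIntegrableOn_iff hΩ.isLocallyClosed] at hf ⊢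
  intro K hKΩ hK
  refine (hf K hKΩ hK).congr ?_
  rw [Filter.EventuallyEq, ae_restrict_iff' hK.measurableSet]
  filter_upwards [h] with y hy hyK using hy (hKΩ hyK)

theorem HasWeakPartialDeriv.congr (hΩ : IsOpen Ω) {f f' h h' : EuclideanSpace ℝ (Fin n) → ℝ}
    (hf : HasWeakPartialDeriv Ω i f h) (h1 : ∀ᵐ y, y ∈ Ω → f y = f' y)
    (h2 : ∀ᵐ y, y ∈ Ω → h y = h' y) : HasWeakPartialDeriv Ω i f' h' := by
  refine ⟨locallyIntegrableOn_congr hΩ hf.1 h1, locallyIntegrableOn_congr hΩ hf.2.1 h2, ?_⟩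
  intro η hη hc hs
  have e1 : ∫ y, f' y * fderiv ℝ η y (EuclideanSpace.single i 1) =
      ∫ y, f y * fderiv ℝ η y (EuclideanSpace.single i 1) := by
    refine integral_congr_ae ?_
    filter_upwards [h1] with y hy
    by_cases hyη : y ∈ tsupport η
    · simp only [hy (hs hyη)]
    · have : fderiv ℝ η y (EuclideanSpace.single i 1) = 0 := pd_eq_zero_of_notMem (i := i) hyη
      simp only [this, mul_zero]
  have e2 : ∫ y, h' y * η y = ∫ y, h y * η y := by
    refine integral_congr_ae ?_
    filter_upwards [h2] with y hy
    by_cases hyη : y ∈ tsupport η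
    · simp only [hy (hs hyη)]
    · simp only [image_eq_zero_of_notMem_tsupport hyη, mul_zero]
  rw [e1, e2, hf.2.2 η hη hc hs]

theorem MemWLoc.congr (hΩ : IsOpen Ω) {k : ℕ} {f g : EuclideanSpace ℝ (Fin n) → ℝ}
    (hf : MemWLoc Ω k f) (h : ∀ᵐ y, y ∈ Ω → f y = g y) : MemWLoc Ω k g := by
  cases k with
  | zero => exact memL2Loc_congr hf h
  | succ k =>
    refine ⟨memL2Loc_congr hf.1 h, fun i => ?_⟩
    obtain ⟨w, hw, hk⟩ := hf.2 i
    exact ⟨w, hw.congr hΩ h (ae_of_all _ fun _ _ => rfl), hk⟩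

theorem MemWLoc.memL2Loc {k : ℕ} {f : EuclideanSpace ℝ (Fin n) → ℝ}
    (hf : MemWLoc Ω k f) : MemL2Loc Ω f := by
  cases k with
  | zero => exact hf
  | succ k => exact hf.1

/-- Weak derivatives are unique almost everywhere, so for a locally Lipschitz function the
unspecified weak derivative in `MemWLoc` may be replaced by the concrete `pd i f`. -/
theorem MemWLoc.pd (hΩ : IsOpen Ω) {k : ℕ} {f : EuclideanSpace ℝ (Fin n) → ℝ}
    (hf : MemWLoc Ω (k + 1) f) (hL : LocallyLipschitzOn Ω f) (i : Fin n) :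
    MemWLoc Ω k (pd i f) := by
  obtain ⟨w, hw, hk⟩ := hf.2 i
  exact hk.congr hΩ (hw.ae_eq hΩ (hL.hasWeakPartialDeriv hΩ i))

theorem _root_.LocallyLipschitzOn.memWLoc_one (hΩ : IsOpen Ω) {f : EuclideanSpace ℝ (Fin n) → ℝ}
    (hf : LocallyLipschitzOn Ω f) : MemWLoc Ω 1 f :=
  ⟨hf.memL2Loc, fun i => ⟨_, hf.hasWeakPartialDeriv hΩ i, hf.memL2Loc_pd hΩ i⟩⟩

theorem HasWeakPartialDeriv.add {f g h h' : EuclideanSpace ℝ (Fin n) → ℝ}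
    (hf : HasWeakPartialDeriv Ω i f h) (hg : HasWeakPartialDeriv Ω i g h') :
    HasWeakPartialDeriv Ω i (fun y => f y + g y) (fun y => h y + h' y) := by
  refine ⟨hf.1.add hg.1, hf.2.1.add hg.2.1, fun η hη hc hs => ?_⟩
  obtain ⟨D, hD⟩ := hη.lipschitzWith_of_hasCompactSupport hc (by simp)
  have h1 : ∫ y, f y * pd i η y = _ := hf.2.2 η hη hc hs
  have h2 : ∫ y, g y * pd i η y = _ := hg.2.2 η hη hc hs
  change ∫ y, (f y + g y) * pd i η y = _
  simp only [add_mul]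
  rw [integral_add (integrable_mul_pd hf.1 hD hc hs) (integrable_mul_pd hg.1 hD hc hs),
    integral_add (integrable_mul_of_continuous hf.2.1 hη.continuous hc hs)
      (integrable_mul_of_continuous hg.2.1 hη.continuous hc hs), h1, h2, neg_add]

theorem hasWeakPartialDeriv_zero : HasWeakPartialDeriv Ω i (fun _ => 0) (fun _ => 0) :=
  ⟨locallyIntegrableOn_zero, locallyIntegrableOn_zero, by simp⟩

theorem MemL2Loc.add {f g : EuclideanSpace ℝ (Fin n) → ℝ} (hf : MemL2Loc Ω f)
    (hg : MemL2Loc Ω g) : MemL2Loc Ω (fun y => f y + g y) :=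
  fun K hKΩ hK => (hf K hKΩ hK).add (hg K hKΩ hK)

theorem MemWLoc.add {k : ℕ} {f g : EuclideanSpace ℝ (Fin n) → ℝ} (hf : MemWLoc Ω k f)
    (hg : MemWLoc Ω k g) : MemWLoc Ω k (fun y => f y + g y) := by
  induction k generalizing f g with
  | zero => exact MemL2Loc.add hf hg
  | succ k ih =>
    refine ⟨hf.1.add hg.1, fun i => ?_⟩
    obtain ⟨w, hw, hk⟩ := hf.2 i
    obtain ⟨w', hw', hk'⟩ := hg.2 i
    exact ⟨_, hw.add hw', ih hk hk'⟩

theorem memWLoc_zero {k : ℕ} : MemWLoc Ω k (fun _ => 0) := by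
  induction k with
  | zero => exact fun K _ _ => MemLp.zero
  | succ k ih => exact ⟨fun K _ _ => MemLp.zero, fun i => ⟨_, hasWeakPartialDeriv_zero, ih⟩⟩

theorem MemWLoc.sum {k : ℕ} {ι : Type*} {s : Finset ι}
    {f : ι → EuclideanSpace ℝ (Fin n) → ℝ} (hf : ∀ j ∈ s, MemWLoc Ω k (f j)) :
    MemWLoc Ω k (fun y => ∑ j ∈ s, f j y) := by
  classical
  induction s using Finset.induction_on with
  | empty => simpa using memWLoc_zero
  | insert a s ha ih =>
    simp only [Finset.sum_insert ha]
    exact (hf a (Finset.mem_insert_self _ _)).add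
      (ih fun i hi => hf i (Finset.mem_insert_of_mem hi))

end EuclSobolev

/-! ### Mollified test functions and the product rule with a Lipschitz factor. -/

namespace EuclSobolev

variable {n : ℕ} {Ω : Set (EuclideanSpace ℝ (Fin n))} {i : Fin n}

theorem tendsto_integral_mul {f : EuclideanSpace ℝ (Fin n) → ℝ} (hf : LocallyIntegrableOn f Ω)
    {b : ℕ → EuclideanSpace ℝ (Fin n) → ℝ} {b' : EuclideanSpace ℝ (Fin n) → ℝ}
    (hb : ∀ k, AEStronglyMeasurable (b k)) {C : ℝ} (hC : ∀ k y, ‖b k y‖ ≤ C)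
    {K : Set (EuclideanSpace ℝ (Fin n))} (hK : IsCompact K) (hKΩ : K ⊆ Ω)
    (h0 : ∀ k, ∀ y ∉ K, b k y = 0) (hlim : ∀ᵐ y, Tendsto (fun k => b k y) atTop (𝓝 (b' y))) :
    Tendsto (fun k => ∫ y, f y * b k y) atTop (𝓝 (∫ y, f y * b' y)) := by
  refine tendsto_integral_of_dominated_convergence (K.indicator fun y => ‖f y‖ * C) ?_ ?_ ?_ ?_
  · exact fun k =>
      (integrable_mul_of_locallyIntegrableOn hf (hb k) (hC k) hK hKΩ (h0 k)).aestronglyMeasurable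
  · exact (integrable_indicator_iff hK.measurableSet).2
      ((hf.integrableOn_compact_subset hKΩ hK).norm.mul_const C)
  · refine fun k => ae_of_all _ fun y => ?_
    by_cases hy : y ∈ K
    · rw [indicator_of_mem hy, norm_mul]
      exact mul_le_mul_of_nonneg_left (hC k y) (norm_nonneg _)
    · rw [indicator_of_notMem hy, h0 k y hy, mul_zero, norm_zero]
  · filter_upwards [hlim] with y hy using hy.const_mul _

/-- Differentiating the convolution puts the derivative on the smooth factor; integration by parts
for Lipschitz functions moves it onto `η`. In this form the Lipschitz constant of `η` bounds the
derivative of every mollification. -/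
theorem pd_convolution {φ η : EuclideanSpace ℝ (Fin n) → ℝ} {C : ℝ≥0}
    (hφ : ContDiff ℝ ∞ φ) (hc : HasCompactSupport φ) (hη : LipschitzWith C η)
    (x : EuclideanSpace ℝ (Fin n)) :
    pd i (MeasureTheory.convolution φ η (ContinuousLinearMap.lsmul ℝ ℝ) volume) x =
      MeasureTheory.convolution φ (pd i η) (ContinuousLinearMap.lsmul ℝ ℝ) volume x := by
  have h1 := hc.hasFDerivAt_convolution_right (ContinuousLinearMap.lsmul ℝ ℝ) (μ := volume)
    hη.continuous.locallyIntegrable (hφ.of_le (by simp)) x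
  have h2 : MeasureTheory.convolution φ η (ContinuousLinearMap.lsmul ℝ ℝ) volume =
      MeasureTheory.convolution η φ (ContinuousLinearMap.lsmul ℝ ℝ) volume := by
    ext x
    rw [convolution_eq_swap, convolution_def]
    simp [mul_comm]
  rw [h2, pd, h1.fderiv, convolution_precompR_apply _ hη.continuous.locallyIntegrable
    (hc.fderiv ℝ) (hφ.continuous_fderiv (by simp)), convolution_def, convolution_eq_swap]
  obtain ⟨D, hD⟩ := hφ.lipschitzWith_of_hasCompactSupport hc (by simp)
  have hD' : LipschitzWith D fun t => φ (x - t) := by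
    have := hD.comp ((LipschitzWith.const x).sub (LipschitzWith.id (α := EuclideanSpace ℝ (Fin n))))
    simpa using! this
  have hc' : HasCompactSupport fun t => φ (x - t) :=
    hc.comp_homeomorph (Homeomorph.subLeft x)
  have h3 := hη.integral_mul_pd (i := i) hD' hc'
  have h4 : ∀ t, pd i (fun t => φ (x - t)) t = - pd i φ (x - t) := by
    intro t
    have hd : DifferentiableAt ℝ φ (x - t) := (hφ.differentiable (by simp)).differentiableAt
    have h5 : HasFDerivAt (fun t => x - t)
        (-ContinuousLinearMap.id ℝ (EuclideanSpace ℝ (Fin n))) t := by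
      simpa using! (hasFDerivAt_id t).const_sub x
    have h6 := (hd.hasFDerivAt.comp t h5).fderiv
    rw [pd, show (fun t => φ (x - t)) = φ ∘ fun t => x - t from rfl, h6]
    simp [pd]
  simp only [h4, mul_neg, integral_neg, neg_inj] at h3
  simp only [ContinuousLinearMap.lsmul_apply, smul_eq_mul]
  simp only [mul_comm (φ _)]
  exact h3

theorem norm_convolution_normed_le (φ : ContDiffBump (0 : EuclideanSpace ℝ (Fin n)))
    {w : EuclideanSpace ℝ (Fin n) → ℝ} {C : ℝ} (hC : ∀ y, ‖w y‖ ≤ C)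
    (x : EuclideanSpace ℝ (Fin n)) :
    ‖MeasureTheory.convolution (φ.normed volume) w (ContinuousLinearMap.lsmul ℝ ℝ) volume x‖
      ≤ C := by
  rw [convolution_def]
  have h1 : Integrable fun t => φ.normed volume t * C := φ.integrable_normed.mul_const C
  refine (norm_integral_le_of_norm_le h1 (ae_of_all _ fun t => ?_)).trans ?_
  · rw [ContinuousLinearMap.lsmul_apply, norm_smul, Real.norm_of_nonneg (φ.nonneg_normed t)]
    exact mul_le_mul_of_nonneg_left (hC _) (φ.nonneg_normed t)
  · rw [integral_mul_const, φ.integral_normed, one_mul]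

/-- Lipschitz functions are admissible in the definition of a weak derivative. Mollifications of `η`
are supported in a fixed compact subset of `Ω`, they and their derivatives are uniformly bounded,
and the derivatives converge almost everywhere, so dominated convergence applies on both sides. -/
theorem HasWeakPartialDeriv.integral_mul_pd (hΩ : IsOpen Ω) {f h η : EuclideanSpace ℝ (Fin n) → ℝ}
    (hf : HasWeakPartialDeriv Ω i f h) {C : ℝ≥0} (hη : LipschitzWith C η)
    (hc : HasCompactSupport η) (hs : tsupport η ⊆ Ω) :
    ∫ y, f y * pd i η y = - ∫ y, h y * η y := by
  obtain ⟨δ, hδ, hδΩ⟩ := hc.isCompact.exists_cthickening_subset_open hΩ hs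
  have hδk : ∀ k : ℕ, 0 < δ / (k + 1) := fun k => by positivity
  -- The outer radius is at most `δ`, which keeps the supports in the closed `δ`-thickening. The
  -- outer radius is twice the inner one, and this bounded ratio (`K := 2` below) is what the almost
  -- everywhere convergence requires.
  let φ : ℕ → ContDiffBump (0 : EuclideanSpace ℝ (Fin n)) := fun k =>
    ⟨δ / (k + 1) / 2, δ / (k + 1), half_pos (hδk k), half_lt_self (hδk k)⟩
  set K := Metric.cthickening δ (tsupport η) with hKdef
  have hK : IsCompact K := hc.isCompact.cthickening
  let conv : ℕ → (EuclideanSpace ℝ (Fin n) → ℝ) → EuclideanSpace ℝ (Fin n) → ℝ := fun k w =>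
    MeasureTheory.convolution ((φ k).normed volume) w (ContinuousLinearMap.lsmul ℝ ℝ) volume
  have hsm : ∀ k, ContDiff ℝ ∞ (conv k η) := fun k =>
    (φ k).hasCompactSupport_normed.contDiff_convolution_left _ (φ k).contDiff_normed
      hη.continuous.locallyIntegrable
  have hsupp : ∀ k, tsupport (conv k η) ⊆ K := by
    intro k
    refine closure_minimal ?_ Metric.isClosed_cthickening
    refine (support_convolution_subset _).trans ?_
    rintro _ ⟨a, ha, b, hb, rfl⟩
    rw [(φ k).support_normed_eq, mem_ball_zero_iff] at ha
    refine Metric.mem_cthickening_of_dist_le _ b _ _ (subset_tsupport _ hb) ?_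
    rw [dist_eq_norm]
    simp only [add_sub_cancel_right]
    refine ha.le.trans (div_le_self hδ.le ?_)
    simp
  have hcs : ∀ k, HasCompactSupport (conv k η) := fun k =>
    hK.of_isClosed_subset (isClosed_tsupport _) (hsupp k)
  have hrout : Tendsto (fun k => (φ k).rOut) atTop (𝓝 0) :=
    by simpa [φ, div_eq_mul_inv] using
      (tendsto_one_div_add_atTop_nhds_zero_nat (𝕜 := ℝ)).const_mul δ
  have hweak : ∀ k, ∫ y, f y * pd i (conv k η) y = - ∫ y, h y * conv k η y := fun k =>
    hf.2.2 _ (hsm k) (hcs k) ((hsupp k).trans hδΩ)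
  obtain ⟨M, hM⟩ := hc.exists_bound_of_continuous hη.continuous
  have lim1 : Tendsto (fun k => ∫ y, h y * conv k η y) atTop (𝓝 (∫ y, h y * η y)) := by
    refine tendsto_integral_mul hf.2.1 (fun k => (hsm k).continuous.aestronglyMeasurable)
      (C := M) (fun k y => norm_convolution_normed_le (φ k) hM y) hK hδΩ
      (fun k y hy => image_eq_zero_of_notMem_tsupport fun h' => hy (hsupp k h')) ?_
    exact ae_of_all _ fun y =>
      ContDiffBump.convolution_tendsto_right_of_continuous hrout hη.continuous y
  have lim2 : Tendsto (fun k => ∫ y, f y * pd i (conv k η) y) atTop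
      (𝓝 (∫ y, f y * pd i η y)) := by
    have hbound : ∀ k y, ‖pd i (conv k η) y‖ ≤ C := by
      intro k y
      rw [pd_convolution (φ k).contDiff_normed (φ k).hasCompactSupport_normed hη]
      exact norm_convolution_normed_le (φ k) (norm_pd_le hη) y
    refine tendsto_integral_mul hf.1 (fun k => (measurable_pd i _).aestronglyMeasurable)
      hbound hK hδΩ
      (fun k y hy => pd_eq_zero_of_notMem fun h' => hy (hsupp k h')) ?_
    have hli : LocallyIntegrable (pd i η) := by
      have : MemLp (pd i η) ⊤ volume :=
        memLp_top_of_bound (measurable_pd i η).aestronglyMeasurable C (ae_of_all _ (norm_pd_le hη))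
      exact this.locallyIntegrable le_top
    have := ContDiffBump.ae_convolution_tendsto_right_of_locallyIntegrable (μ := volume)
      (φ := φ) (K := 2) hrout (Eventually.of_forall fun k => by simp only [φ]; linarith) hli
    filter_upwards [this] with y hy
    refine hy.congr fun k => ?_
    rw [pd_convolution (φ k).contDiff_normed (φ k).hasCompactSupport_normed hη]
  refine tendsto_nhds_unique lim2 ?_
  simp only [hweak]
  exact lim1.neg

theorem _root_.LocallyLipschitzOn.exists_lipschitzWith_mul (hΩ : IsOpen Ω)
    {a η : EuclideanSpace ℝ (Fin n) → ℝ}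
    (ha : LocallyLipschitzOn Ω a) {C : ℝ≥0} (hη : LipschitzWith C η) (hc : HasCompactSupport η)
    (hs : tsupport η ⊆ Ω) : ∃ D, LipschitzWith D fun y => a y * η y := by
  obtain ⟨v, D, hv, hva⟩ := ha.exists_lipschitzWith hΩ hc.isCompact hs
  obtain ⟨D', hD'⟩ := hv.mul_of_hasCompactSupport hη hc
  refine ⟨D', ?_⟩
  suffices h : (fun y => a y * η y) = fun y => v y * η y by rwa [h]
  ext y
  by_cases hy : y ∈ tsupport η
  · rw [((eventually_nhdsSet_iff_forall.1 hva) y hy).self_of_nhds]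
  · rw [image_eq_zero_of_notMem_tsupport hy, mul_zero, mul_zero]

/-- Test the weak derivative of `f` with `a η`. This function is only Lipschitz, which is why test
functions had to be extended beyond smooth ones. -/
theorem HasWeakPartialDeriv.mul (hΩ : IsOpen Ω) {a f h : EuclideanSpace ℝ (Fin n) → ℝ}
    (ha : LocallyLipschitzOn Ω a) (hf : HasWeakPartialDeriv Ω i f h) :
    HasWeakPartialDeriv Ω i (fun y => a y * f y) (fun y => pd i a y * f y + a y * h y) := by
  have hint : ∀ {u b : EuclideanSpace ℝ (Fin n) → ℝ}, LocallyIntegrableOn u Ω →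
      (∀ K ⊆ Ω, IsCompact K → AEStronglyMeasurable b (volume.restrict K)) →
      (∀ K ⊆ Ω, IsCompact K → ∃ C, ∀ y ∈ K, ‖b y‖ ≤ C) →
      LocallyIntegrableOn (fun y => b y * u y) Ω := by
    intro u b hu hm hb
    rw [locallyIntegrableOn_iff hΩ.isLocallyClosed]
    intro K hKΩ hK
    obtain ⟨C, hC⟩ := hb K hKΩ hK
    exact (hu.integrableOn_compact_subset hKΩ hK).bdd_mul (c := C) (hm K hKΩ hK)
      ((ae_restrict_iff' hK.measurableSet).2 (ae_of_all _ hC))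
  have hint1 : ∀ {u : EuclideanSpace ℝ (Fin n) → ℝ}, LocallyIntegrableOn u Ω →
      LocallyIntegrableOn (fun y => a y * u y) Ω := fun hu => hint hu
    (fun K hKΩ hK => (ha.continuousOn.mono hKΩ).aestronglyMeasurable hK.measurableSet)
    (fun K hKΩ hK => hK.exists_bound_of_continuousOn (ha.continuousOn.mono hKΩ))
  have hint2 : LocallyIntegrableOn (fun y => pd i a y * f y) Ω := hint hf.1
    (fun K hKΩ hK => (measurable_pd i a).aestronglyMeasurable)
    (fun K hKΩ hK => ha.exists_bound_pd hΩ hK hKΩ i)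
  refine ⟨hint1 hf.1, hint2.add (hint1 hf.2.1), fun η hη hc hs => ?_⟩
  obtain ⟨D, hD⟩ := hη.lipschitzWith_of_hasCompactSupport hc (by simp)
  obtain ⟨D', hD'⟩ := ha.exists_lipschitzWith_mul hΩ hD hc hs
  have hs' : tsupport (fun y => a y * η y) ⊆ Ω :=
    (tsupport_mul_subset_right (f := a) (g := η)).trans hs
  have key := hf.integral_mul_pd hΩ hD' hc.mul_left hs'
  have e1 : ∫ y, f y * pd i (fun y => a y * η y) y =
      ∫ y, (a y * f y * pd i η y + pd i a y * f y * η y) := by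
    refine integral_congr_ae ?_
    filter_upwards [ha.ae_differentiableAt_of_isOpen (μ := volume) hΩ] with y hy
    by_cases hyη : y ∈ tsupport η
    · rw [pd_mul (hy (hs hyη)) (hη.differentiable (by simp)).differentiableAt]
      ring
    · have : y ∉ tsupport (fun y => a y * η y) := fun h' =>
        hyη (tsupport_mul_subset_right (f := a) (g := η) h')
      rw [pd_eq_zero_of_notMem this, pd_eq_zero_of_notMem hyη,
        image_eq_zero_of_notMem_tsupport hyη]
      ring
  have e2 : ∫ y, (pd i a y * f y + a y * h y) * η y =
      (∫ y, pd i a y * f y * η y) + ∫ y, a y * h y * η y := by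
    simp only [add_mul]
    exact integral_add (integrable_mul_of_continuous hint2 hη.continuous hc hs)
      (integrable_mul_of_continuous (hint1 hf.2.1) hη.continuous hc hs)
  rw [e1, integral_add (integrable_mul_pd (hint1 hf.1) hD hc hs)
    (integrable_mul_of_continuous hint2 hη.continuous hc hs)] at key
  change ∫ y, a y * f y * pd i η y = _
  rw [e2]
  have e3 : ∫ y, h y * (a y * η y) = ∫ y, a y * h y * η y := by
    congr 1; ext y; ring
  rw [e3] at key
  linarith

theorem MemL2Loc.bdd_mul {b u : EuclideanSpace ℝ (Fin n) → ℝ} (hu : MemL2Loc Ω u)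
    (hm : ∀ K ⊆ Ω, IsCompact K → AEStronglyMeasurable b (volume.restrict K))
    (hb : ∀ K ⊆ Ω, IsCompact K → ∃ C, ∀ y ∈ K, ‖b y‖ ≤ C) :
    MemL2Loc Ω (fun y => b y * u y) := by
  intro K hKΩ hK
  obtain ⟨C, hC⟩ := hb K hKΩ hK
  refine MemLp.of_le_mul (c := C) (hu K hKΩ hK)
    ((hm K hKΩ hK).mul (hu K hKΩ hK).aestronglyMeasurable) ?_
  refine (ae_restrict_iff' hK.measurableSet).2 (ae_of_all _ fun y hy => ?_)
  rw [norm_mul]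
  exact mul_le_mul_of_nonneg_right (hC y hy) (norm_nonneg _)

theorem MemL2Loc.lipschitz_mul {a u : EuclideanSpace ℝ (Fin n) → ℝ}
    (ha : LocallyLipschitzOn Ω a) (hu : MemL2Loc Ω u) : MemL2Loc Ω (fun y => a y * u y) :=
  hu.bdd_mul
    (fun _ hKΩ hK => (ha.continuousOn.mono hKΩ).aestronglyMeasurable hK.measurableSet)
    (fun _ hKΩ hK => hK.exists_bound_of_continuousOn (ha.continuousOn.mono hKΩ))

theorem MemL2Loc.pd_mul (hΩ : IsOpen Ω) {a u : EuclideanSpace ℝ (Fin n) → ℝ}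
    (ha : LocallyLipschitzOn Ω a) (hu : MemL2Loc Ω u) (i : Fin n) :
    MemL2Loc Ω (fun y => pd i a y * u y) :=
  hu.bdd_mul (fun _ _ _ => (measurable_pd i a).aestronglyMeasurable)
    (fun _ hKΩ hK => ha.exists_bound_pd hΩ hK hKΩ i)

/-- In `∂a · u + a · ∂u` both `a` and `∂a` are bounded on compact sets, while `u` and `∂u` are in
`L²_loc`. -/
theorem MemWLoc.lipschitz_mul (hΩ : IsOpen Ω) {a u : EuclideanSpace ℝ (Fin n) → ℝ}
    (ha : LocallyLipschitzOn Ω a) (hu : MemWLoc Ω 1 u) : MemWLoc Ω 1 (fun y => a y * u y) := by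
  refine ⟨hu.memL2Loc.lipschitz_mul ha, fun i => ?_⟩
  obtain ⟨w, hw, hk⟩ := hu.2 i
  exact ⟨_, hw.mul hΩ ha, MemL2Loc.add (hu.memL2Loc.pd_mul hΩ ha i) (MemL2Loc.lipschitz_mul ha hk)⟩

end EuclSobolev

/-! ### Change of variables -/

section ChangeOfVariables

open EuclSobolev

variable {n : ℕ}

theorem EuclideanSpace.clm_det_eq (A : EuclideanSpace ℝ (Fin n) →L[ℝ] EuclideanSpace ℝ (Fin n)) :
    A.det = Matrix.det (Matrix.of fun i j => A (EuclideanSpace.single j 1) i) := by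
  rw [ContinuousLinearMap.det, ← LinearMap.det_toMatrix (EuclideanSpace.basisFun (Fin n) ℝ).toBasis]
  rfl

theorem EuclideanSpace.eq_sum_single (v : EuclideanSpace ℝ (Fin n)) :
    v = ∑ j, v j • EuclideanSpace.single j (1 : ℝ) := by
  ext k
  simp [Finset.sum_apply, Pi.single_apply]

theorem ContDiffOn.matrix_det {E : Type*} [NormedAddCommGroup E] [NormedSpace ℝ E] {Ω : Set E}
    {k : WithTop ℕ∞} {A : E → Matrix (Fin n) (Fin n) ℝ}
    (hA : ∀ i j, ContDiffOn ℝ k (fun y => A y i j) Ω) :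
    ContDiffOn ℝ k (fun y => (A y).det) Ω := by
  simp only [Matrix.det_apply]
  exact ContDiffOn.sum fun σ _ => (contDiffOn_prod fun i _ => hA _ _).const_smul _

theorem ContDiffOn.contDiff_of_forall_notMem_eq_zero {E F : Type*} [NormedAddCommGroup E]
    [NormedSpace ℝ E] [NormedAddCommGroup F] [NormedSpace ℝ F] {Ω K : Set E} {k : WithTop ℕ∞}
    {G : E → F} (hG : ContDiffOn ℝ k G Ω) (hΩ : IsOpen Ω) (hK : IsClosed K) (hKΩ : K ⊆ Ω)
    (h0 : ∀ y ∉ K, G y = 0) : ContDiff ℝ k G := by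
  rw [contDiff_iff_contDiffAt]
  intro y
  by_cases hy : y ∈ K
  · exact (hG y (hKΩ hy)).contDiffAt (hΩ.mem_nhds (hKΩ hy))
  · refine (contDiffAt_const (c := (0 : F))).congr_of_eventuallyEq ?_
    filter_upwards [hK.isOpen_compl.mem_nhds hy] with z hz using h0 z hz

theorem EuclSobolev.contDiffOn_pd {Ω : Set (EuclideanSpace ℝ (Fin n))} (hΩ : IsOpen Ω)
    {u : EuclideanSpace ℝ (Fin n) → ℝ} (hu : ContDiffOn ℝ ∞ u Ω) (i : Fin n) :
    ContDiffOn ℝ ∞ (pd i u) Ω :=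
  (hu.fderiv_of_isOpen hΩ (m := ∞) (by simp)).clm_apply contDiffOn_const

theorem EuclSobolev.pd_comp {τ : EuclideanSpace ℝ (Fin n) → EuclideanSpace ℝ (Fin n)}
    {v : EuclideanSpace ℝ (Fin n) → ℝ} {z : EuclideanSpace ℝ (Fin n)}
    (hv : DifferentiableAt ℝ v (τ z)) (hτ : DifferentiableAt ℝ τ z) (i : Fin n) :
    pd i (fun z => v (τ z)) z = ∑ j, pd j v (τ z) * pd i (fun z => τ z j) z := by
  have h1 : ∀ j, pd i (fun z => τ z j) z = (fderiv ℝ τ z (EuclideanSpace.single i 1)) j := by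
    intro j
    have := ((EuclideanSpace.proj j : EuclideanSpace ℝ (Fin n) →L[ℝ] ℝ).hasFDerivAt.comp z
      hτ.hasFDerivAt).fderiv
    rw [pd, show (fun z => τ z j) =
      (EuclideanSpace.proj j : EuclideanSpace ℝ (Fin n) →L[ℝ] ℝ) ∘ τ from rfl, this]
    simp
  simp only [h1]
  rw [pd, show (fun z => v (τ z)) = v ∘ τ from rfl, fderiv_comp z hv hτ]
  rw [ContinuousLinearMap.comp_apply,
    EuclideanSpace.eq_sum_single (fderiv ℝ τ z (EuclideanSpace.single i 1)), map_sum]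
  simp [pd, mul_comm, Finset.sum_apply, Pi.single_apply]

namespace OpenPartialHomeomorph

variable (τ : OpenPartialHomeomorph (EuclideanSpace ℝ (Fin n)) (EuclideanSpace ℝ (Fin n)))

/-- The Jacobian determinant of the inverse. -/
def jac (y : EuclideanSpace ℝ (Fin n)) : ℝ := |(fderiv ℝ τ.symm y).det|

variable {τ} (h1 : ContDiffOn ℝ ∞ τ τ.source) (h2 : ContDiffOn ℝ ∞ τ.symm τ.target)

include h2 in
theorem differentiableAt_symm_of_contDiffOn {y : EuclideanSpace ℝ (Fin n)} (hy : y ∈ τ.target) :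
    DifferentiableAt ℝ τ.symm y :=
  ((h2 y hy).contDiffAt (τ.open_target.mem_nhds hy)).differentiableAt (by simp)

include h1 in
theorem differentiableAt_of_contDiffOn {z : EuclideanSpace ℝ (Fin n)} (hz : z ∈ τ.source) :
    DifferentiableAt ℝ τ z :=
  ((h1 z hz).contDiffAt (τ.open_source.mem_nhds hz)).differentiableAt (by simp)

include h1 h2 in
theorem fderiv_comp_fderiv_symm {y : EuclideanSpace ℝ (Fin n)} (hy : y ∈ τ.target) :
    (fderiv ℝ τ (τ.symm y)).comp (fderiv ℝ τ.symm y) = ContinuousLinearMap.id ℝ _ := by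
  rw [← fderiv_comp y (differentiableAt_of_contDiffOn h1 (τ.map_target hy))
    (differentiableAt_symm_of_contDiffOn h2 hy), ← fderiv_id (x := y)]
  refine Filter.EventuallyEq.fderiv_eq ?_
  filter_upwards [τ.open_target.mem_nhds hy] with z hz using τ.right_inv hz

include h1 h2 in
theorem det_fderiv_symm_ne_zero {y : EuclideanSpace ℝ (Fin n)} (hy : y ∈ τ.target) :
    (fderiv ℝ τ.symm y).det ≠ 0 := by
  intro h
  have h3 := congrArg (fun A => ((A : EuclideanSpace ℝ (Fin n) →L[ℝ]
    EuclideanSpace ℝ (Fin n)) : EuclideanSpace ℝ (Fin n) →ₗ[ℝ] EuclideanSpace ℝ (Fin n)).det)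
    (fderiv_comp_fderiv_symm h1 h2 hy)
  have h4 : (fderiv ℝ τ (τ.symm y)).toLinearMap.det * (fderiv ℝ τ.symm y).toLinearMap.det = 1 := by
    rw [← LinearMap.det_comp]
    exact h3.trans LinearMap.det_id
  rw [show (fderiv ℝ τ.symm y).toLinearMap.det = 0 from h, mul_zero] at h4
  exact zero_ne_one h4

include h1 h2 in
theorem contDiffOn_jac : ContDiffOn ℝ ∞ τ.jac τ.target := by
  have : ContDiffOn ℝ ∞ (fun y => (fderiv ℝ τ.symm y).det) τ.target := by
    simp only [EuclideanSpace.clm_det_eq]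
    refine ContDiffOn.matrix_det fun i j => ?_
    have h3 : ContDiffOn ℝ ∞ (fun y => fderiv ℝ τ.symm y (EuclideanSpace.single j 1)) τ.target :=
      (h2.fderiv_of_isOpen τ.open_target (m := ∞) (by simp)).clm_apply contDiffOn_const
    exact (EuclideanSpace.proj i : EuclideanSpace ℝ (Fin n) →L[ℝ] ℝ).contDiff.comp_contDiffOn h3
  intro y hy
  exact ContDiffWithinAt.abs (this y hy) (det_fderiv_symm_ne_zero h1 h2 hy)

include h2 in
theorem integral_eq_setIntegral_jac_mul {G : EuclideanSpace ℝ (Fin n) → ℝ}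
    (h0 : ∀ z ∉ τ.source, G z = 0) :
    ∫ z, G z = ∫ y in τ.target, τ.jac y * G (τ.symm y) := by
  have h := integral_image_eq_integral_abs_det_fderiv_smul volume
    τ.open_target.measurableSet
    (fun y hy => (differentiableAt_symm_of_contDiffOn h2 hy).hasFDerivAt.hasFDerivWithinAt)
    τ.symm.injOn G
  rw [τ.symm_image_target_eq_source] at h
  rw [← setIntegral_eq_integral_of_forall_compl_eq_zero h0, h]
  rfl

include h1 h2 in
-- The density of the image measure is the Jacobian of the inverse, which is bounded on the compact
-- set `τ '' K`. A one-sided comparison of measures suffices to pull back integrability.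
theorem map_restrict_le_smul {K : Set (EuclideanSpace ℝ (Fin n))} (hK : IsCompact K)
    (hKs : K ⊆ τ.source) : ∃ c : ℝ≥0∞, c ≠ ⊤ ∧
      (volume.restrict K).map τ ≤ c • volume.restrict (τ '' K) := by
  have hK' : IsCompact (τ '' K) := hK.image_of_continuousOn (τ.continuousOn.mono hKs)
  have hK't : τ '' K ⊆ τ.target := by
    rintro _ ⟨z, hz, rfl⟩
    exact τ.map_source (hKs hz)
  obtain ⟨c, hc⟩ := hK'.exists_bound_of_continuousOn ((contDiffOn_jac h1 h2).continuousOn.mono hK't)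
  refine ⟨ENNReal.ofReal c, ENNReal.ofReal_ne_top, Measure.le_iff.2 fun A hA => ?_⟩
  have hτ : AEMeasurable τ (volume.restrict K) :=
    (τ.continuousOn.mono hKs).aemeasurable hK.measurableSet
  rw [Measure.map_apply_of_aemeasurable hτ hA, Measure.restrict_apply' hK.measurableSet,
    Measure.smul_apply, Measure.restrict_apply hA]
  have e : τ ⁻¹' A ∩ K = τ.symm '' (A ∩ τ '' K) := by
    ext z
    constructor
    · rintro ⟨hz, hzK⟩
      exact ⟨τ z, ⟨hz, z, hzK, rfl⟩, τ.left_inv (hKs hzK)⟩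
    · rintro ⟨_, ⟨hA', w, hw, rfl⟩, rfl⟩
      rw [τ.left_inv (hKs hw)]
      exact ⟨hA', hw⟩
  rw [e]
  have hm : MeasurableSet (A ∩ τ '' K) := hA.inter hK'.measurableSet
  refine (addHaar_image_le_lintegral_abs_det_fderiv volume hm fun y hy =>
    (differentiableAt_symm_of_contDiffOn h2 (hK't hy.2)).hasFDerivAt.hasFDerivWithinAt).trans ?_
  refine (setLIntegral_mono' hm (g := fun _ => ENNReal.ofReal c) fun y hy => ?_).trans ?_
  · refine ENNReal.ofReal_le_ofReal ?_
    have := hc y hy.2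
    rwa [jac, Real.norm_eq_abs, abs_abs] at this
  · simp

include h1 h2 in
theorem memLp_comp {K : Set (EuclideanSpace ℝ (Fin n))} (hK : IsCompact K)
    (hKs : K ⊆ τ.source) {p : ℝ≥0∞} {U : EuclideanSpace ℝ (Fin n) → ℝ}
    (hU : MemLp U p (volume.restrict (τ '' K))) :
    MemLp (fun z => U (τ z)) p (volume.restrict K) := by
  obtain ⟨c, hc, hle⟩ := map_restrict_le_smul h1 h2 hK hKs
  have hτ : AEMeasurable τ (volume.restrict K) :=
    (τ.continuousOn.mono hKs).aemeasurable hK.measurableSet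
  have h := hU.of_measure_le_smul hc hle
  exact (memLp_map_measure_iff h.aestronglyMeasurable hτ).1 h

include h1 h2 in
theorem memL2Loc_comp {U : EuclideanSpace ℝ (Fin n) → ℝ} (hU : MemL2Loc τ.target U) :
    MemL2Loc τ.source (fun z => U (τ z)) := by
  intro K hKs hK
  refine memLp_comp h1 h2 hK hKs (hU _ ?_ (hK.image_of_continuousOn (τ.continuousOn.mono hKs)))
  rintro _ ⟨z, hz, rfl⟩
  exact τ.map_source (hKs hz)

include h1 h2 in
theorem locallyIntegrableOn_comp {U : EuclideanSpace ℝ (Fin n) → ℝ}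
    (hU : LocallyIntegrableOn U τ.target) :
    LocallyIntegrableOn (fun z => U (τ z)) τ.source := by
  rw [locallyIntegrableOn_iff τ.open_source.isLocallyClosed]
  intro K hKs hK
  rw [IntegrableOn, ← memLp_one_iff_integrable]
  refine memLp_comp h1 h2 hK hKs (memLp_one_iff_integrable.2
    (hU.integrableOn_compact_subset ?_ (hK.image_of_continuousOn (τ.continuousOn.mono hKs))))
  rintro _ ⟨z, hz, rfl⟩
  exact τ.map_source (hKs hz)

/-- The components of the vector field `η ∂ᵢ`, transported by `τ` as a vector density. -/
def pushDensity (τ : OpenPartialHomeomorph (EuclideanSpace ℝ (Fin n)) (EuclideanSpace ℝ (Fin n)))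
    (i : Fin n) (η : EuclideanSpace ℝ (Fin n) → ℝ) (j : Fin n) : EuclideanSpace ℝ (Fin n) → ℝ :=
  τ.target.indicator fun y => τ.jac y * (η (τ.symm y) * pd i (fun z => τ z j) (τ.symm y))

section

variable {η : EuclideanSpace ℝ (Fin n) → ℝ} (hη : ContDiff ℝ ∞ η) (hc : HasCompactSupport η)
  (hs : tsupport η ⊆ τ.source)

include hc hs in
theorem isCompact_image_tsupport : IsCompact (τ '' tsupport η) :=
  hc.isCompact.image_of_continuousOn (τ.continuousOn.mono hs)

include hs in
theorem image_tsupport_subset : τ '' tsupport η ⊆ τ.target := by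
  rintro _ ⟨z, hz, rfl⟩
  exact τ.map_source (hs hz)

theorem symm_notMem_tsupport {y : EuclideanSpace ℝ (Fin n)} (hy : y ∈ τ.target)
    (h : y ∉ τ '' tsupport η) : τ.symm y ∉ tsupport η :=
  fun h' => h ⟨_, h', τ.right_inv hy⟩

theorem pushDensity_eq_zero {i j : Fin n} {y : EuclideanSpace ℝ (Fin n)}
    (hy : y ∉ τ '' tsupport η) : τ.pushDensity i η j y = 0 := by
  by_cases h : y ∈ τ.target
  · rw [pushDensity, indicator_of_mem h,
      image_eq_zero_of_notMem_tsupport (symm_notMem_tsupport h hy)]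
    ring
  · exact indicator_of_notMem h _

include hc hs in
theorem hasCompactSupport_pushDensity (i j : Fin n) : HasCompactSupport (τ.pushDensity i η j) :=
  HasCompactSupport.intro (isCompact_image_tsupport hc hs) fun _ hy => pushDensity_eq_zero hy

include hc hs in
theorem tsupport_pushDensity_subset (i j : Fin n) :
    tsupport (τ.pushDensity i η j) ⊆ τ.target := by
  refine (closure_minimal ?_ (isCompact_image_tsupport hc hs).isClosed).trans
    (image_tsupport_subset hs)
  intro y hy
  by_contra h
  exact hy (pushDensity_eq_zero h)

include h1 h2 hη hc hs in
theorem contDiff_pushDensity (i j : Fin n) : ContDiff ℝ ∞ (τ.pushDensity i η j) := by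
  refine ContDiffOn.contDiff_of_forall_notMem_eq_zero (Ω := τ.target) ?_ τ.open_target
    (isCompact_image_tsupport hc hs).isClosed (image_tsupport_subset hs)
    fun y hy => pushDensity_eq_zero hy
  have h3 : ContDiffOn ℝ ∞ (fun z => τ z j) τ.source :=
    (EuclideanSpace.proj j : EuclideanSpace ℝ (Fin n) →L[ℝ] ℝ).contDiff.comp_contDiffOn h1
  have h4 : ContDiffOn ℝ ∞ (fun y => pd i (fun z => τ z j) (τ.symm y)) τ.target :=
    (contDiffOn_pd τ.open_source h3 i).comp h2 fun y hy => τ.map_target hy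
  have h5 : ContDiffOn ℝ ∞ (fun y => η (τ.symm y)) τ.target := hη.comp_contDiffOn h2
  exact ((contDiffOn_jac h1 h2).mul (h5.mul h4)).congr fun y hy => indicator_of_mem hy _

include h1 h2 hη hc hs in
/-- The Piola identity. -/
theorem ae_sum_pd_pushDensity (i : Fin n) : ∀ᵐ y, y ∈ τ.target →
    ∑ j, pd j (τ.pushDensity i η j) y = τ.jac y * pd i η (τ.symm y) := by
  have hB := contDiff_pushDensity h1 h2 hη hc hs i
  have hBc := hasCompactSupport_pushDensity hc hs i
  choose D hD using fun j => (hB j).lipschitzWith_of_hasCompactSupport (hBc j) (by simp)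
  have hli1 : Continuous fun y => ∑ j, pd j (τ.pushDensity i η j) y :=
    continuous_finsetSum _ fun j _ =>
      ((hB j).continuous_fderiv (by simp)).clm_apply continuous_const
  have hpη : Continuous (pd i η) := (hη.continuous_fderiv (by simp)).clm_apply continuous_const
  have hli2 : ContinuousOn (fun y => τ.jac y * pd i η (τ.symm y)) τ.target :=
    (contDiffOn_jac h1 h2).continuousOn.mul
      (hpη.comp_continuousOn τ.continuousOn_symm)
  have hli2' := hli2.locallyIntegrableOn (μ := volume) τ.open_target.measurableSet
  have hli1' := (hli1.locallyIntegrable (μ := volume)).locallyIntegrableOn τ.target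
  -- The identity is proved weakly, without differentiating a determinant. Paired with a test
  -- function `v` and moved to the source by the change of variables, it becomes `∫ (v ∘ τ) ∂ᵢη = -∫
  -- ∂ᵢ(v ∘ τ) η`.
  have key := τ.open_target.ae_eq_zero_of_integral_contDiff_smul_eq_zero (hli1'.sub hli2') ?_
  · filter_upwards [key] with y hy hyt
    exact sub_eq_zero.1 (hy hyt)
  intro v hv hvc hvs
  obtain ⟨Dv, hDv⟩ := hv.lipschitzWith_of_hasCompactSupport hvc (by simp)
  have hvτ : ContDiffOn ℝ ∞ (fun z => v (τ z)) τ.source := hv.comp_contDiffOn h1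
  have hw := ((hvτ.of_le (by simp)).locallyLipschitzOn_of_isOpen
    τ.open_source).hasWeakPartialDeriv τ.open_source i
  have e1 : ∫ y, v y * ∑ j, pd j (τ.pushDensity i η j) y =
      - ∫ y, ∑ j, pd j v y * τ.pushDensity i η j y := by
    simp only [Finset.mul_sum]
    rw [integral_finsetSum, integral_finsetSum, ← Finset.sum_neg_distrib]
    · exact Finset.sum_congr rfl fun j _ => hDv.integral_mul_pd (hD j) (hBc j)
    · exact fun j _ => integrable_mul_of_continuous (Ω := univ)
        ((((hv.continuous_fderiv (by simp)).clm_apply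
          continuous_const).locallyIntegrable).locallyIntegrableOn _)
        (hB j).continuous (hBc j) (subset_univ _)
    · exact fun j _ => integrable_mul_pd (Ω := univ)
        (hv.continuous.locallyIntegrable.locallyIntegrableOn _) (hD j) (hBc j) (subset_univ _)
  have e2 : ∫ y, ∑ j, pd j v y * τ.pushDensity i η j y =
      ∫ z, pd i (fun z => v (τ z)) z * η z := by
    rw [integral_eq_setIntegral_jac_mul (τ := τ) h2 (G := fun z => pd i (fun z => v (τ z)) z * η z),
      ← setIntegral_eq_integral_of_forall_compl_eq_zero (s := τ.target)]
    · refine setIntegral_congr_fun τ.open_target.measurableSet fun y hy => ?_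
      have hd : DifferentiableAt ℝ v (τ (τ.symm y)) :=
        (hv.differentiable (by simp)).differentiableAt
      rw [pd_comp hd (differentiableAt_of_contDiffOn h1 (τ.map_target hy)) i, τ.right_inv hy,
        Finset.sum_mul, Finset.mul_sum]
      refine Finset.sum_congr rfl fun j _ => ?_
      rw [pushDensity, indicator_of_mem hy]
      ring
    · intro y hy
      exact Finset.sum_eq_zero fun j _ => by rw [pushDensity, indicator_of_notMem hy, mul_zero]
    · intro z hz
      rw [image_eq_zero_of_notMem_tsupport fun h => hz (hs h), mul_zero]
  have e3 : ∫ z, v (τ z) * pd i η z = ∫ y, v y * (τ.jac y * pd i η (τ.symm y)) := by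
    rw [integral_eq_setIntegral_jac_mul (τ := τ) h2 (G := fun z => v (τ z) * pd i η z),
      ← setIntegral_eq_integral_of_forall_compl_eq_zero (s := τ.target)
        (f := fun y => v y * (τ.jac y * pd i η (τ.symm y)))]
    · refine setIntegral_congr_fun τ.open_target.measurableSet fun y hy => ?_
      simp only [τ.right_inv hy]
      ring
    · intro y hy
      rw [image_eq_zero_of_notMem_tsupport fun h => hy (hvs h), zero_mul]
    · intro z hz
      rw [pd_eq_zero_of_notMem fun h => hz (hs h), mul_zero]
  have e4 : ∫ z, v (τ z) * pd i η z = - ∫ z, pd i (fun z => v (τ z)) z * η z :=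
    hw.2.2 η hη hc hs
  simp only [Pi.sub_apply, smul_eq_mul, mul_sub]
  rw [integral_sub, e1, e2, ← e3, e4, sub_self]
  · have := integrable_mul_of_continuous (hli1.locallyIntegrable.locallyIntegrableOn univ)
      hv.continuous hvc (subset_univ _)
    simpa only [mul_comm] using this
  · have := integrable_mul_of_continuous hli2' hv.continuous hvc hvs
    simpa only [mul_comm] using this

end

include h1 h2 in
-- After a change of variables the Piola identity turns the transported `∂ᵢη` into the divergence of
-- the smooth compactly supported field `pushDensity`. Its components are test functions for `U`,
-- and unfolding them gives the chain rule.
theorem hasWeakPartialDeriv_comp {U : EuclideanSpace ℝ (Fin n) → ℝ}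
    {w : Fin n → EuclideanSpace ℝ (Fin n) → ℝ}
    (hU : ∀ j, HasWeakPartialDeriv τ.target j U (w j)) (hUi : LocallyIntegrableOn U τ.target)
    (i : Fin n) :
    HasWeakPartialDeriv τ.source i (fun z => U (τ z))
      (fun z => ∑ j, w j (τ z) * pd i (fun z => τ z j) z) := by
  have h3 : ∀ j, LocallyLipschitzOn τ.source (pd i (fun z => τ z j)) := fun j =>
    ((contDiffOn_pd τ.open_source ((EuclideanSpace.proj j :
      EuclideanSpace ℝ (Fin n) →L[ℝ] ℝ).contDiff.comp_contDiffOn h1) i).of_le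
      (by simp)).locallyLipschitzOn_of_isOpen τ.open_source
  refine ⟨locallyIntegrableOn_comp h1 h2 hUi, ?_, ?_⟩
  · rw [locallyIntegrableOn_iff τ.open_source.isLocallyClosed]
    intro K hKs hK
    refine integrable_finsetSum _ fun j _ => ?_
    have := locallyIntegrableOn_comp h1 h2 (hU j).2.1
    rw [locallyIntegrableOn_iff τ.open_source.isLocallyClosed] at this
    obtain ⟨C, hC⟩ := hK.exists_bound_of_continuousOn ((h3 j).continuousOn.mono hKs)
    exact (this K hKs hK).mul_bdd (c := C) (measurable_pd i _).aestronglyMeasurable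
      ((ae_restrict_iff' hK.measurableSet).2 (ae_of_all _ hC))
  intro η hη hc hs
  have hB := contDiff_pushDensity h1 h2 hη hc hs i
  have hBc := hasCompactSupport_pushDensity hc hs i
  have hBs := tsupport_pushDensity_subset hc hs i
  choose D hD using fun j => (hB j).lipschitzWith_of_hasCompactSupport (hBc j) (by simp)
  have e1 : ∫ z, U (τ z) * pd i η z = ∫ y, ∑ j, U y * pd j (τ.pushDensity i η j) y := by
    rw [integral_eq_setIntegral_jac_mul (τ := τ) h2 (G := fun z => U (τ z) * pd i η z),
      ← setIntegral_eq_integral_of_forall_compl_eq_zero (s := τ.target)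
        (f := fun y => ∑ j, U y * pd j (τ.pushDensity i η j) y)]
    · refine setIntegral_congr_ae τ.open_target.measurableSet ?_
      filter_upwards [ae_sum_pd_pushDensity h1 h2 hη hc hs i] with y hy hyt
      rw [← Finset.mul_sum, hy hyt, τ.right_inv hyt]
      ring
    · intro y hy
      exact Finset.sum_eq_zero fun j _ => by
        rw [pd_eq_zero_of_notMem fun h => hy (hBs j h), mul_zero]
    · intro z hz
      rw [pd_eq_zero_of_notMem fun h => hz (hs h), mul_zero]
  have e2 : ∫ z, (∑ j, w j (τ z) * pd i (fun z => τ z j) z) * η z =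
      ∫ y, ∑ j, w j y * τ.pushDensity i η j y := by
    rw [integral_eq_setIntegral_jac_mul (τ := τ) h2
        (G := fun z => (∑ j, w j (τ z) * pd i (fun z => τ z j) z) * η z),
      ← setIntegral_eq_integral_of_forall_compl_eq_zero (s := τ.target)
        (f := fun y => ∑ j, w j y * τ.pushDensity i η j y)]
    · refine setIntegral_congr_fun τ.open_target.measurableSet fun y hy => ?_
      simp only [τ.right_inv hy, pushDensity, indicator_of_mem hy, Finset.sum_mul, Finset.mul_sum]
      exact Finset.sum_congr rfl fun j _ => by ring
    · intro y hy
      exact Finset.sum_eq_zero fun j _ => by rw [pushDensity, indicator_of_notMem hy, mul_zero]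
    · intro z hz
      rw [image_eq_zero_of_notMem_tsupport fun h => hz (hs h), mul_zero]
  change ∫ z, U (τ z) * pd i η z = _
  rw [e1, e2, integral_finsetSum, integral_finsetSum, ← Finset.sum_neg_distrib]
  · exact Finset.sum_congr rfl fun j _ => (hU j).2.2 _ (hB j) (hBc j) (hBs j)
  · exact fun j _ => integrable_mul_of_continuous (hU j).2.1 (hB j).continuous (hBc j) (hBs j)
  · exact fun j _ => integrable_mul_pd hUi (hD j) (hBc j) (hBs j)

end OpenPartialHomeomorph

end ChangeOfVariables

/-! ### Charts -/

namespace LowReg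

open EuclSobolev

section Charts

variable {n : ℕ} {M : Type*} [TopologicalSpace M] [ChartedSpace (EuclideanSpace ℝ (Fin n)) M]

/-- The coordinate vector field, with values in the model space. -/
def coordVecE (φ : OpenPartialHomeomorph M (EuclideanSpace ℝ (Fin n))) (i : Fin n)
    (y : EuclideanSpace ℝ (Fin n)) : EuclideanSpace ℝ (Fin n) := coordVec n φ i y

/-- The derivative of a chart, with values in the model space. -/
def chartDeriv (φ : OpenPartialHomeomorph M (EuclideanSpace ℝ (Fin n))) (x : M) :
    EuclideanSpace ℝ (Fin n) →L[ℝ] EuclideanSpace ℝ (Fin n) := mfderiv (𝓡 n) (𝓡 n) φ x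

/-- The derivative of the inverse of a chart, with values in the model space. -/
def chartSymmDeriv (φ : OpenPartialHomeomorph M (EuclideanSpace ℝ (Fin n)))
    (y : EuclideanSpace ℝ (Fin n)) :
    EuclideanSpace ℝ (Fin n) →L[ℝ] EuclideanSpace ℝ (Fin n) := mfderiv (𝓡 n) (𝓡 n) φ.symm y

/-- The coordinate differential `dxʲ` of the chart `φ`. -/
def coordForm (φ : OpenPartialHomeomorph M (EuclideanSpace ℝ (Fin n))) (j : Fin n) (x : M) :
    TangentSpace (𝓡 n) x →L[ℝ] ℝ :=
  (EuclideanSpace.proj j : EuclideanSpace ℝ (Fin n) →L[ℝ] ℝ).comp (chartDeriv φ x)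

variable {φ ψ : OpenPartialHomeomorph M (EuclideanSpace ℝ (Fin n))}

theorem contMDiffOn_chart (hφ : φ ∈ charts n M) : ContMDiffOn (𝓡 n) (𝓡 n) ∞ φ φ.source :=
  contMDiffOn_of_mem_maximalAtlas hφ

theorem contMDiffOn_chart_symm (hφ : φ ∈ charts n M) :
    ContMDiffOn (𝓡 n) (𝓡 n) ∞ φ.symm φ.target :=
  contMDiffOn_symm_of_mem_maximalAtlas hφ

theorem mdifferentiableAt_chart (hφ : φ ∈ charts n M) {x : M} (hx : x ∈ φ.source) :
    MDifferentiableAt (𝓡 n) (𝓡 n) φ x :=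
  (contMDiffAt_of_mem_maximalAtlas hφ hx).mdifferentiableAt (by simp)

theorem mdifferentiableAt_chart_symm (hφ : φ ∈ charts n M) {y : EuclideanSpace ℝ (Fin n)}
    (hy : y ∈ φ.target) : MDifferentiableAt (𝓡 n) (𝓡 n) φ.symm y :=
  (contMDiffAt_symm_of_mem_maximalAtlas hφ hy).mdifferentiableAt (by simp)

theorem mdifferentiable_chart (hφ : φ ∈ charts n M) : φ.MDifferentiable (𝓡 n) (𝓡 n) :=
  ⟨fun _ hx => (mdifferentiableAt_chart hφ hx).mdifferentiableWithinAt,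
    fun _ hy => (mdifferentiableAt_chart_symm hφ hy).mdifferentiableWithinAt⟩

theorem contDiffOn_transition (hφ : φ ∈ charts n M) (hψ : ψ ∈ charts n M) :
    ContDiffOn ℝ ∞ (ψ.symm.trans φ) (ψ.symm.trans φ).source := by
  rw [← contMDiffOn_iff_contDiffOn]
  refine (contMDiffOn_chart hφ).comp ((contMDiffOn_chart_symm hψ).mono ?_) ?_
  · exact fun z hz => hz.1
  · exact fun z hz => hz.2

theorem contDiffOn_transition_symm (hφ : φ ∈ charts n M) (hψ : ψ ∈ charts n M) :
    ContDiffOn ℝ ∞ (ψ.symm.trans φ).symm (ψ.symm.trans φ).target :=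
  contDiffOn_transition hψ hφ

theorem coordForm_coordVec (hφ : φ ∈ charts n M) (hψ : ψ ∈ charts n M) (i j : Fin n)
    {z : EuclideanSpace ℝ (Fin n)} (hz : z ∈ (ψ.symm.trans φ).source) :
    coordForm φ j (ψ.symm z) (coordVec n ψ i z) = pd i (fun z => (ψ.symm.trans φ) z j) z := by
  have hz1 : z ∈ ψ.target := hz.1
  have hz2 : ψ.symm z ∈ φ.source := hz.2
  have h1 : fderiv ℝ (φ ∘ ψ.symm) z =
      (chartDeriv φ (ψ.symm z)).comp (chartSymmDeriv ψ z) := by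
    rw [← mfderiv_eq_fderiv]
    exact mfderiv_comp z (mdifferentiableAt_chart hφ hz2) (mdifferentiableAt_chart_symm hψ hz1)
  have hd := OpenPartialHomeomorph.differentiableAt_of_contDiffOn (contDiffOn_transition hφ hψ) hz
  have := ((EuclideanSpace.proj j : EuclideanSpace ℝ (Fin n) →L[ℝ] ℝ).hasFDerivAt.comp z
      hd.hasFDerivAt).fderiv
  rw [pd, show (fun z => (ψ.symm.trans φ) z j) =
      (EuclideanSpace.proj j : EuclideanSpace ℝ (Fin n) →L[ℝ] ℝ) ∘ (ψ.symm.trans φ) from rfl, this,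
    show ((ψ.symm.trans φ : OpenPartialHomeomorph _ _) : EuclideanSpace ℝ (Fin n) →
      EuclideanSpace ℝ (Fin n)) = φ ∘ ψ.symm from rfl, h1]
  rfl

theorem sum_coordForm_smul_coordVec (hφ : φ ∈ charts n M) {x : M} (hx : x ∈ φ.source)
    (v : EuclideanSpace ℝ (Fin n)) :
    v = ∑ j, (chartDeriv φ x v) j • coordVecE φ j (φ x) := by
  have h1 : (chartSymmDeriv φ (φ x)).comp (chartDeriv φ x) = ContinuousLinearMap.id ℝ _ :=
    (mdifferentiable_chart hφ).symm_comp_deriv hx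
  have h2 : chartSymmDeriv φ (φ x) (chartDeriv φ x v) = v := congrArg (fun A => A v) h1
  have h3 := EuclideanSpace.eq_sum_single (chartDeriv φ x v)
  conv_lhs => rw [← h2, h3, map_sum]
  refine Finset.sum_congr rfl fun j _ => ?_
  rw [map_smul]
  rfl

theorem pd_coord (i j : Fin n) (z : EuclideanSpace ℝ (Fin n)) :
    pd i (fun z : EuclideanSpace ℝ (Fin n) => z j) z = if i = j then 1 else 0 := by
  have := (EuclideanSpace.proj j : EuclideanSpace ℝ (Fin n) →L[ℝ] ℝ).fderiv (x := z)
  rw [pd, show (fun z : EuclideanSpace ℝ (Fin n) => z j) =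
    (EuclideanSpace.proj j : EuclideanSpace ℝ (Fin n) →L[ℝ] ℝ) from rfl, this]
  simp [eq_comm]

theorem coordForm_coordVec_self (hφ : φ ∈ charts n M) (i j : Fin n)
    {y : EuclideanSpace ℝ (Fin n)} (hy : y ∈ φ.target) :
    coordForm φ j (φ.symm y) (coordVec n φ i y) = if i = j then 1 else 0 := by
  have hs : y ∈ (φ.symm.trans φ).source := ⟨hy, φ.map_target hy⟩
  rw [coordForm_coordVec hφ hφ i j hs, ← pd_coord i j y]
  refine pd_congr ?_
  filter_upwards [φ.open_target.mem_nhds hy] with z hz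
  simp [φ.right_inv hz]

theorem coordVecE_transition (hφ : φ ∈ charts n M) (hψ : ψ ∈ charts n M) (i : Fin n)
    {z : EuclideanSpace ℝ (Fin n)} (hz : z ∈ (ψ.symm.trans φ).source) :
    coordVecE ψ i z = ∑ j, pd i (fun z => (ψ.symm.trans φ) z j) z •
      coordVecE φ j ((ψ.symm.trans φ) z) := by
  have h := sum_coordForm_smul_coordVec hφ (x := ψ.symm z) hz.2 (coordVecE ψ i z)
  rw [h]
  refine Finset.sum_congr rfl fun j _ => ?_
  rw [← coordForm_coordVec hφ hψ i j hz]
  rfl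

theorem mfderiv_coordVec (hφ : φ ∈ charts n M) (i : Fin n) {f : M → ℝ}
    {y : EuclideanSpace ℝ (Fin n)} (hy : y ∈ φ.target)
    (hf : MDifferentiableAt (𝓡 n) 𝓘(ℝ, ℝ) f (φ.symm y)) :
    (mfderiv (𝓡 n) 𝓘(ℝ, ℝ) f (φ.symm y) (coordVec n φ i y) : ℝ) =
      pd i (fun y => f (φ.symm y)) y := by
  have h1 : mfderiv (𝓡 n) 𝓘(ℝ, ℝ) (f ∘ φ.symm) y =
      (mfderiv (𝓡 n) 𝓘(ℝ, ℝ) f (φ.symm y)).comp (mfderiv (𝓡 n) (𝓡 n) φ.symm y) :=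
    mfderiv_comp y hf (mdifferentiableAt_chart_symm hφ hy)
  have h2 : mfderiv (𝓡 n) 𝓘(ℝ, ℝ) f (φ.symm y) (coordVec n φ i y) =
      mfderiv (𝓡 n) 𝓘(ℝ, ℝ) (f ∘ φ.symm) y (EuclideanSpace.single i (1 : ℝ)) := by
    rw [h1]; rfl
  rw [h2, mfderiv_eq_fderiv]
  rfl

/-- The differential of a function, as a field of covectors. -/
def dform (f : M → ℝ) (x : M) : TangentSpace (𝓡 n) x →L[ℝ] ℝ := mfderiv (𝓡 n) 𝓘(ℝ, ℝ) f x

theorem contDiffOn_comp_chart_symm {k : WithTop ℕ∞} (hk : k ≤ (∞ : WithTop ℕ∞))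
    (hφ : φ ∈ charts n M) {f : M → ℝ}
    (hf : ContMDiff (𝓡 n) 𝓘(ℝ, ℝ) k f) : ContDiffOn ℝ k (fun y => f (φ.symm y)) φ.target := by
  rw [← contMDiffOn_iff_contDiffOn]
  exact hf.comp_contMDiffOn ((contMDiffOn_chart_symm hφ).of_le hk)

theorem hasWeakDifferential_dform {f : M → ℝ} (hf : ContMDiff (𝓡 n) 𝓘(ℝ, ℝ) 1 f) :
    HasWeakDifferential n f (dform f) := by
  intro φ hφ i
  have h1 := (contDiffOn_comp_chart_symm (by simp) hφ hf).locallyLipschitzOn_of_isOpen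
    φ.open_target
  refine (h1.hasWeakPartialDeriv φ.open_target i).congr φ.open_target
    (ae_of_all _ fun _ _ => rfl) (ae_of_all _ fun y hy => ?_)
  exact (mfderiv_coordVec hφ i hy (hf.mdifferentiable one_ne_zero _)).symm

theorem linearIndependent_coordVec (hφ : φ ∈ charts n M) {y : EuclideanSpace ℝ (Fin n)}
    (hy : y ∈ φ.target) : LinearIndependent ℝ (fun i => coordVec n φ i y) := by
  rw [Fintype.linearIndependent_iff]
  intro a ha j
  have h := congrArg (coordForm φ j (φ.symm y)) ha
  rw [map_sum, map_zero] at h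
  simp only [map_smul, coordForm_coordVec_self hφ _ _ hy] at h
  simpa using h

/-- The function on `M` that is `H` in the chart `φ`, and zero outside its domain. -/
def lift {R : Type*} [Zero R] (φ : OpenPartialHomeomorph M (EuclideanSpace ℝ (Fin n)))
    (H : EuclideanSpace ℝ (Fin n) → R) : M → R :=
  φ.source.indicator fun x => H (φ x)

theorem lift_of_mem {R : Type*} [Zero R] {H : EuclideanSpace ℝ (Fin n) → R} {x : M}
    (hx : x ∈ φ.source) : lift φ H x = H (φ x) := indicator_of_mem hx _

theorem lift_of_notMem {R : Type*} [Zero R] {H : EuclideanSpace ℝ (Fin n) → R} {x : M}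
    (hx : x ∉ φ.source) : lift φ H x = 0 := indicator_of_notMem hx _

theorem lift_symm {R : Type*} [Zero R] {H : EuclideanSpace ℝ (Fin n) → R}
    {y : EuclideanSpace ℝ (Fin n)} (hy : y ∈ φ.target) : lift φ H (φ.symm y) = H y := by
  rw [lift_of_mem (φ.map_target hy), φ.right_inv hy]

variable [MeasurableSpace M] [BorelSpace M]

theorem measurable_lift {R : Type*} [Zero R] [MeasurableSpace R]
    {H : EuclideanSpace ℝ (Fin n) → R} (hH : Measurable H) : Measurable (lift φ H) := by
  classical
  have h1 : Measurable (φ.source.piecewise φ fun _ => 0) :=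
    φ.continuousOn.measurable_piecewise continuousOn_const φ.open_source.measurableSet
  have h2 := (hH.comp h1).indicator φ.open_source.measurableSet
  convert h2 using 1
  ext x
  by_cases hx : x ∈ φ.source
  · simp [lift, hx]
  · simp [lift, hx]

theorem measurableSet_preimage_inter_target {A : Set M} (hA : MeasurableSet A) :
    MeasurableSet (φ.symm ⁻¹' A ∩ φ.target) := by
  have h := (continuousOn_iff_continuous_domRestrict.1 φ.continuousOn_symm).measurable hA
  have h2 := φ.open_target.measurableSet.subtype_image h
  convert h2 using 1
  ext y
  simp [and_comm]

end Charts

end LowReg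

/-! ### The metric in charts and the Riemannian volume -/

namespace LowReg

open EuclSobolev

section Metric

variable {n : ℕ} {M : Type*} [TopologicalSpace M] [ChartedSpace (EuclideanSpace ℝ (Fin n)) M]
  [RiemannianBundle (fun x : M => TangentSpace (𝓡 n) x)]

/-- The metric at `x`, as a bilinear form on the model space. -/
def metricAt (x : M) (u v : EuclideanSpace ℝ (Fin n)) : ℝ :=
  @inner ℝ (TangentSpace (𝓡 n) x) _ u v

theorem metricCoeff_eq (φ : OpenPartialHomeomorph M (EuclideanSpace ℝ (Fin n))) (i j : Fin n)
    (y : EuclideanSpace ℝ (Fin n)) :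
    metricCoeff n φ i j y = metricAt (φ.symm y) (coordVecE φ i y) (coordVecE φ j y) := rfl

theorem metricAt_comm (x : M) (u v : EuclideanSpace ℝ (Fin n)) :
    metricAt x u v = metricAt x v u :=
  (real_inner_comm (F := TangentSpace (𝓡 n) x) u v).symm

theorem metricAt_sum_left (x : M) (a : Fin n → ℝ) (u : Fin n → EuclideanSpace ℝ (Fin n))
    (v : EuclideanSpace ℝ (Fin n)) :
    metricAt x (∑ i, a i • u i) v = ∑ i, a i * metricAt x (u i) v := by
  have h : metricAt x (∑ i, a i • u i) v =
    ∑ i, @inner ℝ (TangentSpace (𝓡 n) x) _ (a i • (u i : TangentSpace (𝓡 n) x)) v :=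
    sum_inner (𝕜 := ℝ) (E := TangentSpace (𝓡 n) x) Finset.univ
      (fun i => a i • (u i : TangentSpace (𝓡 n) x)) v
  rw [h]
  exact Finset.sum_congr rfl fun i _ =>
    real_inner_smul_left (F := TangentSpace (𝓡 n) x) _ _ _

theorem metricAt_sum_right (x : M) (a : Fin n → ℝ) (u : Fin n → EuclideanSpace ℝ (Fin n))
    (v : EuclideanSpace ℝ (Fin n)) :
    metricAt x v (∑ i, a i • u i) = ∑ i, a i * metricAt x v (u i) := by
  rw [metricAt_comm, metricAt_sum_left]
  exact Finset.sum_congr rfl fun i _ => by rw [metricAt_comm]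

/-- The matrix `(g_{ij})` of the metric in the chart `φ`. -/
def gramMatrix (φ : OpenPartialHomeomorph M (EuclideanSpace ℝ (Fin n)))
    (y : EuclideanSpace ℝ (Fin n)) : Matrix (Fin n) (Fin n) ℝ :=
  Matrix.of fun i j => metricCoeff n φ i j y

/-- The density `√(det g)` in the chart `φ`. -/
def density (φ : OpenPartialHomeomorph M (EuclideanSpace ℝ (Fin n)))
    (y : EuclideanSpace ℝ (Fin n)) : ℝ := √(gramMatrix φ y).det

variable {φ ψ : OpenPartialHomeomorph M (EuclideanSpace ℝ (Fin n))}

theorem gramMatrix_posDef (hφ : φ ∈ charts n M) {y : EuclideanSpace ℝ (Fin n)}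
    (hy : y ∈ φ.target) : (gramMatrix φ y).PosDef :=
  Matrix.posDef_gram_of_linearIndependent (𝕜 := ℝ) (linearIndependent_coordVec hφ hy)

theorem det_gramMatrix_pos (hφ : φ ∈ charts n M) {y : EuclideanSpace ℝ (Fin n)}
    (hy : y ∈ φ.target) : 0 < (gramMatrix φ y).det := (gramMatrix_posDef hφ hy).det_pos

theorem density_pos (hφ : φ ∈ charts n M) {y : EuclideanSpace ℝ (Fin n)}
    (hy : y ∈ φ.target) : 0 < density φ y := Real.sqrt_pos.2 (det_gramMatrix_pos hφ hy)

theorem metricCoeff_transition (hφ : φ ∈ charts n M) (hψ : ψ ∈ charts n M) (i k : Fin n)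
    {z : EuclideanSpace ℝ (Fin n)} (hz : z ∈ (ψ.symm.trans φ).source) :
    metricCoeff n ψ i k z = ∑ a, ∑ b, pd i (fun z => (ψ.symm.trans φ) z a) z *
      (pd k (fun z => (ψ.symm.trans φ) z b) z *
        metricCoeff n φ a b ((ψ.symm.trans φ) z)) := by
  have hb : φ.symm ((ψ.symm.trans φ) z) = ψ.symm z := φ.left_inv hz.2
  rw [metricCoeff_eq, coordVecE_transition hφ hψ i hz, coordVecE_transition hφ hψ k hz,
    metricAt_sum_left]
  refine Finset.sum_congr rfl fun a _ => ?_
  rw [metricAt_sum_right, Finset.mul_sum]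
  refine Finset.sum_congr rfl fun b _ => ?_
  rw [metricCoeff_eq, hb]

/-- The Gram matrices are related by `Jᵀ G J`, so the determinant acquires the factor `(det J)²`. -/
theorem density_transition (hφ : φ ∈ charts n M) (hψ : ψ ∈ charts n M)
    {z : EuclideanSpace ℝ (Fin n)} (hz : z ∈ (ψ.symm.trans φ).source) :
    density ψ z = |(fderiv ℝ (ψ.symm.trans φ) z).det| * density φ ((ψ.symm.trans φ) z) := by
  have hd := OpenPartialHomeomorph.differentiableAt_of_contDiffOn (contDiffOn_transition hφ hψ) hz
  set J : Matrix (Fin n) (Fin n) ℝ :=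
    Matrix.of fun a i => pd i (fun z => (ψ.symm.trans φ) z a) z with hJ
  have h1 : gramMatrix ψ z = J.transpose * gramMatrix φ ((ψ.symm.trans φ) z) * J := by
    ext i k
    simp only [gramMatrix, Matrix.of_apply, Matrix.mul_apply, Matrix.transpose_apply, hJ,
      Finset.sum_mul]
    rw [metricCoeff_transition hφ hψ i k hz, Finset.sum_comm]
    refine Finset.sum_congr rfl fun b _ => Finset.sum_congr rfl fun a _ => ?_
    ring
  have h2 : (fderiv ℝ (ψ.symm.trans φ) z).det = J.det := by
    rw [EuclideanSpace.clm_det_eq]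
    congr 1
    ext a i
    have := ((EuclideanSpace.proj a : EuclideanSpace ℝ (Fin n) →L[ℝ] ℝ).hasFDerivAt.comp z
      hd.hasFDerivAt).fderiv
    simp only [hJ, Matrix.of_apply]
    rw [pd, show (fun z => (ψ.symm.trans φ) z a) =
      (EuclideanSpace.proj a : EuclideanSpace ℝ (Fin n) →L[ℝ] ℝ) ∘ (ψ.symm.trans φ) from rfl, this]
    simp
  rw [density, density, h1, Matrix.det_mul, Matrix.det_mul, Matrix.det_transpose, h2,
    ← Real.sqrt_sq_eq_abs, ← Real.sqrt_mul (sq_nonneg _)]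
  congr 1
  ring

theorem locallyLipschitzOn_gramMatrix (hC : IsMetricC01 n M) (hφ : φ ∈ charts n M) :
    LocallyLipschitzOn φ.target
      (fun y => fun p : Fin n × Fin n => metricCoeff n φ p.1 p.2 y) :=
  LocallyLipschitzOn.pi fun p => hC φ hφ p.1 p.2

theorem continuousOn_density (hC : IsMetricC01 n M) (hφ : φ ∈ charts n M) :
    ContinuousOn (density φ) φ.target := by
  refine ContinuousOn.sqrt ?_
  simp only [Matrix.det_apply]
  exact continuousOn_finsetSum _ fun σ _ =>
    (continuousOn_finsetProd _ fun i _ => (hC φ hφ _ _).continuousOn).const_smul _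

variable [MeasurableSpace M] [BorelSpace M]

theorem chartVolume_eq (φ : OpenPartialHomeomorph M (EuclideanSpace ℝ (Fin n))) :
    chartVolume n φ = ((volume.restrict φ.target).withDensity
      fun y => ENNReal.ofReal (density φ y)).map φ.symm := rfl

theorem aemeasurable_symm (φ : OpenPartialHomeomorph M (EuclideanSpace ℝ (Fin n))) :
    AEMeasurable φ.symm ((volume.restrict φ.target).withDensity
      fun y => ENNReal.ofReal (density φ y)) :=
  (φ.continuousOn_symm.aemeasurable φ.open_target.measurableSet).mono_ac
    (withDensity_absolutelyContinuous _ _)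

theorem chartVolume_apply {A : Set M} (hA : MeasurableSet A) :
    chartVolume n φ A =
      ∫⁻ y in φ.symm ⁻¹' A ∩ φ.target, ENNReal.ofReal (density φ y) := by
  rw [chartVolume_eq, Measure.map_apply_of_aemeasurable (aemeasurable_symm φ) hA,
    withDensity_apply', Measure.restrict_restrict' φ.open_target.measurableSet]

/-- The Jacobian in the change of variables is exactly the factor by which the two densities differ.
-/
theorem chartVolume_eq_of_subset (hφ : φ ∈ charts n M) (hψ : ψ ∈ charts n M) {A : Set M}
    (hA : MeasurableSet A) (hAφ : A ⊆ φ.source) (hAψ : A ⊆ ψ.source) :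
    chartVolume n ψ A = chartVolume n φ A := by
  rw [chartVolume_apply hA, chartVolume_apply hA]
  set τ := ψ.symm.trans φ with hτ
  have hsub : ψ.symm ⁻¹' A ∩ ψ.target ⊆ τ.source := fun z hz => ⟨hz.2, hAφ hz.1⟩
  have himg : τ '' (ψ.symm ⁻¹' A ∩ ψ.target) = φ.symm ⁻¹' A ∩ φ.target := by
    ext y
    constructor
    · rintro ⟨z, hz, rfl⟩
      refine ⟨?_, φ.map_source (hAφ hz.1)⟩
      change φ.symm (φ (ψ.symm z)) ∈ A
      rw [φ.left_inv (hAφ hz.1)]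
      exact hz.1
    · rintro ⟨h1, h2⟩
      refine ⟨ψ (φ.symm y), ⟨?_, ψ.map_source (hAψ h1)⟩, ?_⟩
      · change ψ.symm (ψ (φ.symm y)) ∈ A
        rw [ψ.left_inv (hAψ h1)]
        exact h1
      · change φ (ψ.symm (ψ (φ.symm y))) = y
        rw [ψ.left_inv (hAψ h1), φ.right_inv h2]
  rw [← himg, lintegral_image_eq_lintegral_abs_det_fderiv_mul volume
    (measurableSet_preimage_inter_target hA)
    (fun z hz => (OpenPartialHomeomorph.differentiableAt_of_contDiffOn
      (contDiffOn_transition hφ hψ) (hsub hz)).hasFDerivAt.hasFDerivWithinAt)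
    (τ.injOn.mono hsub)]
  refine setLIntegral_congr_fun (measurableSet_preimage_inter_target hA) fun z hz => ?_
  rw [density_transition hφ hψ (hsub hz), ENNReal.ofReal_mul (abs_nonneg _)]

theorem chartVolume_inter_source {A : Set M} (hA : MeasurableSet A) :
    chartVolume n φ (A ∩ φ.source) = chartVolume n φ A := by
  rw [chartVolume_apply hA, chartVolume_apply (hA.inter φ.open_source.measurableSet)]
  congr 2
  ext y
  constructor
  · exact fun h => ⟨h.1.1, h.2⟩
  · exact fun h => ⟨⟨h.1, φ.map_target h.2⟩, h.2⟩

theorem chartVolume_le_vol (hφ : φ ∈ charts n M) : chartVolume n φ ≤ vol n M :=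
  le_iSup₂ (f := fun φ (_ : φ ∈ charts n M) => chartVolume n φ) φ hφ

/-- The Riemannian volume restricts to the volume of each chart. -/
theorem vol_restrict_source (hφ : φ ∈ charts n M) :
    (vol n M).restrict φ.source = chartVolume n φ := by
  have hs := φ.open_source.measurableSet
  apply le_antisymm
  -- The right-hand side bounds every chart volume: split a set along `φ.source`, compare with `φ`
  -- inside and with `vol` outside. It therefore bounds their supremum.
  · have h1 : vol n M ≤ chartVolume n φ + (vol n M).restrict φ.sourceᶜ := by
      refine iSup₂_le fun ψ hψ => Measure.le_iff.2 fun A hA => ?_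
      rw [← measure_inter_add_sdiff A hs, Measure.add_apply, Measure.restrict_apply hA]
      refine add_le_add ?_ (chartVolume_le_vol hψ _)
      rw [← chartVolume_inter_source (hA.inter hs), chartVolume_eq_of_subset hφ hψ
        ((hA.inter hs).inter ψ.open_source.measurableSet)
        (fun x hx => hx.1.2) (fun x hx => hx.2)]
      exact measure_mono fun x hx => hx.1.1
    refine Measure.le_iff.2 fun A hA => ?_
    rw [Measure.restrict_apply hA]
    refine (h1 _).trans ?_
    rw [Measure.add_apply, Measure.restrict_apply (hA.inter hs)]
    have : A ∩ φ.source ∩ φ.sourceᶜ = ∅ := by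
      ext x; simp +contextual
    rw [this, measure_empty, add_zero]
    exact measure_mono inter_subset_left
  · refine Measure.le_iff.2 fun A hA => ?_
    rw [Measure.restrict_apply hA, ← chartVolume_inter_source hA]
    exact chartVolume_le_vol hφ _

theorem aemeasurable_density (hC : IsMetricC01 n M) (hφ : φ ∈ charts n M) :
    AEMeasurable (density φ) (volume.restrict φ.target) :=
  (continuousOn_density hC hφ).aemeasurable φ.open_target.measurableSet

theorem lintegral_lift (hC : IsMetricC01 n M) (hφ : φ ∈ charts n M)
    {H : EuclideanSpace ℝ (Fin n) → ℝ≥0∞} (hH : Measurable H) :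
    ∫⁻ x, lift φ H x ∂vol n M = ∫⁻ y in φ.target, ENNReal.ofReal (density φ y) * H y := by
  have hs := φ.open_source.measurableSet
  rw [← setLIntegral_eq_of_support_subset (s := φ.source)]
  · rw [vol_restrict_source hφ, chartVolume_eq,
      lintegral_map' (measurable_lift hH).aemeasurable (aemeasurable_symm φ),
      lintegral_withDensity_eq_lintegral_mul₀' (aemeasurable_density hC hφ).ennreal_ofReal]
    · refine setLIntegral_congr_fun φ.open_target.measurableSet fun y hy => ?_
      simp only [Pi.mul_apply, lift_symm hy]
    · exact (measurable_lift hH).comp_aemeasurable (aemeasurable_symm φ)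
  · exact support_indicator_subset

theorem integral_lift (hC : IsMetricC01 n M) (hφ : φ ∈ charts n M)
    {H : EuclideanSpace ℝ (Fin n) → ℝ} (hH : Measurable H) :
    ∫ x, lift φ H x ∂vol n M = ∫ y in φ.target, density φ y * H y := by
  rw [← setIntegral_eq_integral_of_forall_compl_eq_zero (s := φ.source)
    (fun x hx => lift_of_notMem hx), vol_restrict_source hφ, chartVolume_eq,
    integral_map (aemeasurable_symm φ) (measurable_lift hH).aestronglyMeasurable,
    integral_withDensity_eq_integral_toReal_smul₀ (aemeasurable_density hC hφ).ennreal_ofReal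
      (ae_of_all _ fun _ => ENNReal.ofReal_lt_top)]
  refine setIntegral_congr_fun φ.open_target.measurableSet fun y hy => ?_
  simp only [lift_symm hy, smul_eq_mul, ENNReal.toReal_ofReal (density_pos hφ hy).le]

end Metric

end LowReg

/-! ### Cutoff functions and extension of weak derivatives -/

theorem exists_contMDiff_cutoff {n : ℕ} {M : Type*} [TopologicalSpace M]
    [ChartedSpace (EuclideanSpace ℝ (Fin n)) M] [IsManifold (𝓡 n) ∞ M] [T2Space M] [NormalSpace M]
    [SigmaCompactSpace M] {K U : Set M} (hK : IsCompact K) (hU : IsOpen U) (hKU : K ⊆ U) :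
    ∃ χ : M → ℝ, ContMDiff (𝓡 n) 𝓘(ℝ, ℝ) ∞ χ ∧ HasCompactSupport χ ∧ tsupport χ ⊆ U ∧
      ∀ᶠ x in 𝓝ˢ K, χ x = 1 := by
  have : LocallyCompactSpace M := Manifold.locallyCompact_of_finiteDimensional (𝓡 n)
  obtain ⟨L, hL, hKL, hLU⟩ := exists_compact_between hK hU hKU
  obtain ⟨χ, h1, h0, -⟩ := exists_contMDiffMap_one_nhds_of_subset_interior (𝓡 n) (n := ⊤)
    hK.isClosed hKL
  refine ⟨χ, χ.contMDiff, HasCompactSupport.intro hL h0,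
    (closure_minimal ?_ hL.isClosed).trans hLU, h1⟩
  intro x hx
  by_contra h
  exact hx (h0 x h)

namespace EuclSobolev

variable {n : ℕ} {Ω : Set (EuclideanSpace ℝ (Fin n))} {i : Fin n}

theorem exists_contDiff_cutoff {K : Set (EuclideanSpace ℝ (Fin n))} (hK : IsCompact K)
    (hΩ : IsOpen Ω) (hKΩ : K ⊆ Ω) : ∃ χ : EuclideanSpace ℝ (Fin n) → ℝ, ContDiff ℝ ∞ χ ∧
      HasCompactSupport χ ∧ tsupport χ ⊆ Ω ∧ ∀ᶠ x in 𝓝ˢ K, χ x = 1 := by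
  obtain ⟨χ, h1, h2⟩ := exists_contMDiff_cutoff (n := n) hK hΩ hKΩ
  exact ⟨χ, contMDiff_iff_contDiff.1 h1, h2⟩

theorem _root_.MeasureTheory.MemLp.of_inter {K C : Set (EuclideanSpace ℝ (Fin n))}
    {p : ℝ≥0∞} {f : EuclideanSpace ℝ (Fin n) → ℝ} (hC : MeasurableSet (C ∩ K))
    (hK : MeasurableSet K)
    (hf : MemLp f p (volume.restrict (C ∩ K))) (h0 : ∀ y ∈ K, y ∉ C → f y = 0) :
    MemLp f p (volume.restrict K) := by
  have h1 : MemLp ((C ∩ K).indicator f) p volume := (memLp_indicator_iff_restrict hC).2 hf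
  refine (h1.restrict K).ae_eq ((ae_restrict_iff' hK).2 (ae_of_all _ fun y hy => ?_))
  by_cases h : y ∈ C
  · have hm : y ∈ C ∩ K := ⟨h, hy⟩
    simp only [indicator_of_mem hm]
  · have hm : y ∉ C ∩ K := fun h' => h h'.1
    simp only [indicator_of_notMem hm, h0 y hy h]

theorem MemL2Loc.extend {Ω₁ C : Set (EuclideanSpace ℝ (Fin n))}
    (hC : ∀ K ⊆ Ω, IsCompact K → IsCompact (C ∩ K)) (hCΩ : C ∩ Ω ⊆ Ω₁)
    {f : EuclideanSpace ℝ (Fin n) → ℝ} (hf : MemL2Loc Ω₁ f) (h0 : ∀ y ∈ Ω, y ∉ C → f y = 0) :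
    MemL2Loc Ω f := by
  intro K hKΩ hK
  have hsub : C ∩ K ⊆ Ω₁ := fun _ hy => hCΩ ⟨hy.1, hKΩ hy.2⟩
  exact MemLp.of_inter (hC K hKΩ hK).measurableSet hK.measurableSet (hf _ hsub (hC K hKΩ hK))
    fun y hy h => h0 y (hKΩ hy) h

theorem locallyIntegrableOn_extend (hΩ : IsOpen Ω) {Ω₁ C : Set (EuclideanSpace ℝ (Fin n))}
    (hC : ∀ K ⊆ Ω, IsCompact K → IsCompact (C ∩ K)) (hCΩ : C ∩ Ω ⊆ Ω₁)
    {f : EuclideanSpace ℝ (Fin n) → ℝ} (hf : LocallyIntegrableOn f Ω₁)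
    (h0 : ∀ y ∈ Ω, y ∉ C → f y = 0) : LocallyIntegrableOn f Ω := by
  rw [locallyIntegrableOn_iff hΩ.isLocallyClosed]
  intro K hKΩ hK
  rw [IntegrableOn, ← memLp_one_iff_integrable]
  refine MemLp.of_inter (C := C) (hC K hKΩ hK).measurableSet hK.measurableSet ?_
    fun y hy h => h0 y (hKΩ hy) h
  exact memLp_one_iff_integrable.2 (hf.integrableOn_compact_subset
    (fun _ hy => hCΩ ⟨hy.1, hKΩ hy.2⟩) (hC K hKΩ hK))

/-- Multiply the test function by a cutoff that is `1` near `C ∩ tsupport η` and supported in `Ω₁`.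
Away from `C` both functions vanish, so the integrals do not change. The set `C` is the support of a
lifted function seen in another chart. It need not be compact; it only has to meet compact subsets
of `Ω` in compact sets. -/
theorem HasWeakPartialDeriv.extend (hΩ : IsOpen Ω) {Ω₁ C : Set (EuclideanSpace ℝ (Fin n))}
    (hΩ₁ : IsOpen Ω₁) (hC : ∀ K ⊆ Ω, IsCompact K → IsCompact (C ∩ K)) (hCΩ : C ∩ Ω ⊆ Ω₁)
    {f h : EuclideanSpace ℝ (Fin n) → ℝ} (hf : HasWeakPartialDeriv Ω₁ i f h)
    (hf0 : ∀ y ∈ Ω, y ∉ C → f y = 0) (hh0 : ∀ y ∈ Ω, y ∉ C → h y = 0) :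
    HasWeakPartialDeriv Ω i f h := by
  refine ⟨locallyIntegrableOn_extend hΩ hC hCΩ hf.1 hf0,
    locallyIntegrableOn_extend hΩ hC hCΩ hf.2.1 hh0, fun η hη hc hs => ?_⟩
  obtain ⟨χ, hχ, hχc, hχs, hχ1⟩ := exists_contDiff_cutoff (hC _ hs hc.isCompact) hΩ₁
    (fun y hy => hCΩ ⟨hy.1, hs hy.2⟩)
  have hχ1' := eventually_nhdsSet_iff_forall.1 hχ1
  have key := hf.2.2 (fun y => χ y * η y) (hχ.mul hη) hχc.mul_right
    ((tsupport_mul_subset_left (f := χ) (g := η)).trans hχs)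
  have e1 : ∫ y, f y * pd i η y = ∫ y, f y * pd i (fun y => χ y * η y) y := by
    congr 1
    ext y
    by_cases hy : y ∈ tsupport η
    · by_cases hyC : y ∈ C
      · congr 1
        refine pd_congr ?_
        filter_upwards [hχ1' y ⟨hyC, hy⟩] with z hz
        rw [hz, one_mul]
      · rw [hf0 y (hs hy) hyC, zero_mul, zero_mul]
    · rw [pd_eq_zero_of_notMem hy, pd_eq_zero_of_notMem fun h' =>
        hy (tsupport_mul_subset_right (f := χ) (g := η) h')]
  have e2 : ∫ y, h y * η y = ∫ y, h y * (χ y * η y) := by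
    congr 1
    ext y
    by_cases hy : y ∈ tsupport η
    · by_cases hyC : y ∈ C
      · rw [(hχ1' y ⟨hyC, hy⟩).self_of_nhds, one_mul]
      · rw [hh0 y (hs hy) hyC, zero_mul, zero_mul]
    · simp only [image_eq_zero_of_notMem_tsupport hy, mul_zero]
  change ∫ y, f y * pd i η y = _
  rw [e1, e2]
  exact key

/-- The chain rule for a smooth function of locally Lipschitz functions in `W^{2,2}_loc`. -/
theorem memWLoc_pd_comp (hΩ : IsOpen Ω) {ι : Type*} [Fintype ι] [DecidableEq ι]
    {g : ι → EuclideanSpace ℝ (Fin n) → ℝ} (hg : ∀ p, LocallyLipschitzOn Ω (g p))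
    (hW : ∀ p, MemWLoc Ω 2 (g p)) {Φ : (ι → ℝ) → ℝ}
    (hΦ : ∀ y ∈ Ω, ContDiffAt ℝ 2 Φ (fun p => g p y)) (k : Fin n) :
    MemWLoc Ω 1 (pd k fun y => Φ fun p => g p y) := by
  have h1 : ∀ p, MemWLoc Ω 1 (pd k (g p)) := fun p => (hW p).pd hΩ (hg p) k
  have hG := LocallyLipschitzOn.pi hg
  -- Since `Φ` is `C²`, the factors `∂ₚΦ(g)` are locally Lipschitz, and the derivative of the
  -- composite becomes a sum of products of a Lipschitz with a `W^{1,2}_loc` function.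
  have h2 : ∀ p, LocallyLipschitzOn Ω
      (fun y => fderiv ℝ Φ (fun p => g p y) (Pi.single p 1)) := fun p =>
    hG.contDiffAt_comp (Φ := fun q => fderiv ℝ Φ q (Pi.single p 1)) fun y hy =>
      ((hΦ y hy).fderiv_right (m := 1) (by norm_num)).clm_apply contDiffAt_const
  refine (MemWLoc.sum (s := Finset.univ) fun p _ => (h1 p).lipschitz_mul hΩ (h2 p)).congr hΩ ?_
  filter_upwards [ae_all_iff.2 fun p => (hg p).ae_differentiableAt_of_isOpen (μ := volume) hΩ]
    with y hy hyΩ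
  have hd : HasFDerivAt (fun y p => g p y)
      (ContinuousLinearMap.pi fun p => fderiv ℝ (g p) y) y :=
    hasFDerivAt_pi.2 fun p => (hy p hyΩ).hasFDerivAt
  have hΦd : DifferentiableAt ℝ Φ (fun p => g p y) := (hΦ y hyΩ).differentiableAt (by simp)
  have h3 := (hΦd.hasFDerivAt.comp y hd).fderiv
  rw [pd, show (fun y => Φ fun p => g p y) = Φ ∘ (fun y p => g p y) from rfl, h3]
  rw [ContinuousLinearMap.comp_apply]
  have h4 : (ContinuousLinearMap.pi fun p => fderiv ℝ (g p) y) (EuclideanSpace.single k 1) =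
      ∑ p, pd k (g p) y • (Pi.single p (1 : ℝ) : ι → ℝ) := by
    ext q
    simp [pd, Finset.sum_apply, Pi.single_apply]
  rw [h4, map_sum]
  refine Finset.sum_congr rfl fun p _ => ?_
  rw [map_smul, smul_eq_mul, mul_comm]

end EuclSobolev

/-! ### The coefficients of the Laplacian -/

section MatrixCoeff

variable {n : ℕ}

/-- The entry `√(det A) (A⁻¹)ᵢⱼ` as a function of the entries of `A`. -/
def Matrix.sqrtDetInv (i j : Fin n) (p : Fin n × Fin n → ℝ) : ℝ :=
  √(Matrix.of fun a b => p (a, b)).det * (Matrix.of fun a b => p (a, b))⁻¹ i j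

/-- The square root of the determinant as a function of the entries. -/
def Matrix.sqrtDet (p : Fin n × Fin n → ℝ) : ℝ :=
  √(Matrix.of fun a b => p (a, b)).det

theorem Matrix.contDiff_det_of {k : WithTop ℕ∞} :
    ContDiff ℝ k fun p : Fin n × Fin n → ℝ => (Matrix.of fun a b => p (a, b)).det := by
  rw [← contDiffOn_univ]
  exact ContDiffOn.matrix_det fun i j => (contDiff_apply ℝ ℝ (i, j)).contDiffOn

theorem Matrix.contDiffAt_sqrtDet {k : WithTop ℕ∞} {p : Fin n × Fin n → ℝ}
    (hp : 0 < (Matrix.of fun a b => p (a, b)).det) : ContDiffAt ℝ k Matrix.sqrtDet p :=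
  Matrix.contDiff_det_of.contDiffAt.sqrt hp.ne'

theorem Matrix.contDiffAt_sqrtDetInv {k : WithTop ℕ∞} (i j : Fin n) {p : Fin n × Fin n → ℝ}
    (hp : 0 < (Matrix.of fun a b => p (a, b)).det) :
    ContDiffAt ℝ k (Matrix.sqrtDetInv i j) p := by
  have h1 : ContDiff ℝ k fun p : Fin n × Fin n → ℝ =>
      (Matrix.of fun a b => p (a, b)).adjugate i j := by
    simp only [Matrix.adjugate_apply]
    rw [← contDiffOn_univ]
    refine ContDiffOn.matrix_det fun a b => ?_
    rw [contDiffOn_univ]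
    by_cases h : a = j
    · subst h
      simpa using contDiff_const
    · simpa [Matrix.updateRow_ne h] using! contDiff_apply ℝ ℝ (a, b)
  -- By Cramer's rule the inverse is the adjugate, polynomial in the entries, divided by the
  -- determinant.
  have h2 : ∀ p : Fin n × Fin n → ℝ, Matrix.sqrtDetInv i j p =
      Matrix.sqrtDet p * ((Matrix.of fun a b => p (a, b)).det⁻¹ *
        (Matrix.of fun a b => p (a, b)).adjugate i j) := by
    intro p
    rw [Matrix.sqrtDetInv, Matrix.sqrtDet, Matrix.inv_def, Ring.inverse_eq_inv',
      Matrix.smul_apply, smul_eq_mul]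
  rw [show Matrix.sqrtDetInv i j = _ from funext h2]
  exact (Matrix.contDiffAt_sqrtDet hp).mul
    ((Matrix.contDiff_det_of.contDiffAt.inv hp.ne').mul h1.contDiffAt)

end MatrixCoeff

/-! ### Norms of differentials, and Lipschitz functions -/

namespace LowReg

open EuclSobolev

section Norm

variable {n : ℕ} {M : Type*} [TopologicalSpace M] [ChartedSpace (EuclideanSpace ℝ (Fin n)) M]
  [IsManifold (𝓡 n) ∞ M]
  [RiemannianBundle (fun x : M => TangentSpace (𝓡 n) x)]
  [IsContinuousRiemannianBundle (EuclideanSpace ℝ (Fin n)) (fun x : M => TangentSpace (𝓡 n) x)]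

theorem chartAt_mem_charts (c : M) : chartAt (EuclideanSpace ℝ (Fin n)) c ∈ charts n M :=
  IsManifold.chart_mem_maximalAtlas c

theorem eventually_norm_chartDeriv_le (x : M) : ∃ C, 0 ≤ C ∧ ∀ᶠ y in 𝓝 x,
    ∀ v : TangentSpace (𝓡 n) y,
      ‖chartDeriv (chartAt (EuclideanSpace ℝ (Fin n)) x) y v‖ ≤ C * ‖v‖ := by
  have : IsManifold (𝓡 n) 1 M := IsManifold.of_le (n := ∞) (by simp)
  -- These instances give the tangent spaces of the model their Euclidean norm. On `M` the norm is
  -- that of the metric, and the bound compares the two.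
  let (y : EuclideanSpace ℝ (Fin n)) :
    NormedAddCommGroup (TangentSpace 𝓘(ℝ, EuclideanSpace ℝ (Fin n)) y) :=
    normedAddCommGroupTangentSpaceVectorSpace y
  let (y : EuclideanSpace ℝ (Fin n)) :
    NormedSpace ℝ (TangentSpace 𝓘(ℝ, EuclideanSpace ℝ (Fin n)) y) :=
    normedSpaceTangentSpaceVectorSpace y
  obtain ⟨C, hC0, hC⟩ := eventually_norm_mfderiv_extChartAt_lt (𝓡 n) x
  refine ⟨C, hC0.le, ?_⟩
  filter_upwards [hC] with y hy v
  exact ((mfderiv (𝓡 n) 𝓘(ℝ, EuclideanSpace ℝ (Fin n)) (extChartAt (𝓡 n) x) y).le_opNorm v).trans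
    (mul_le_mul_of_nonneg_right hy.le (norm_nonneg _))

/-- Near `x` the differential is the derivative of the coordinate expression composed with the
derivative of the chart. The first factor is continuous and the second is locally bounded in the
norm of the metric. -/
theorem eventually_norm_dform_le {f : M → ℝ} {x : M} (hf : ContMDiffAt (𝓡 n) 𝓘(ℝ, ℝ) 1 f x) :
    ∃ C, ∀ᶠ y in 𝓝 x, ‖dform (n := n) f y‖ ≤ C := by
  set c := chartAt (EuclideanSpace ℝ (Fin n)) x with hc
  have hcm : c ∈ charts n M := chartAt_mem_charts x
  have hx : x ∈ c.source := mem_chart_source _ x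
  have hF : ContDiffAt ℝ 1 (f ∘ c.symm) (c x) := by
    rw [← contMDiffAt_iff_contDiffAt]
    refine ContMDiffAt.comp (I' := 𝓡 n) (c x) ?_
      ((contMDiffAt_symm_of_mem_maximalAtlas hcm (c.map_source hx)).of_le (by simp))
    rwa [c.left_inv hx]
  obtain ⟨C, hC0, hC⟩ := eventually_norm_chartDeriv_le (n := n) x
  have hcont : ContinuousAt (fun y => ‖fderiv ℝ (f ∘ c.symm) (c y)‖) x := by
    have h1 : ContinuousAt (fun z => ‖fderiv ℝ (f ∘ c.symm) z‖) (c x) :=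
      (hF.fderiv_right (m := 0) (by simp)).continuousAt.norm
    exact ContinuousAt.comp (f := c) h1 (c.continuousAt hx)
  have hdiff : ∀ᶠ y in 𝓝 x, DifferentiableAt ℝ (f ∘ c.symm) (c y) :=
    (c.continuousAt hx).eventually ((hF.eventually (by simp)).mono fun z hz =>
      hz.differentiableAt one_ne_zero)
  refine ⟨(‖fderiv ℝ (f ∘ c.symm) (c x)‖ + 1) * C, ?_⟩
  filter_upwards [hC, hdiff, c.open_source.mem_nhds hx,
    hcont.eventually (gt_mem_nhds (lt_add_one _))] with y hyC hyd hys hyb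
  have h1 : dform (n := n) f y = (fderiv ℝ (f ∘ c.symm) (c y)).comp (chartDeriv c y) := by
    have e1 : dform (n := n) f y = mfderiv (𝓡 n) 𝓘(ℝ, ℝ) ((f ∘ c.symm) ∘ c) y := by
      refine Filter.EventuallyEq.mfderiv_eq ?_
      filter_upwards [c.open_source.mem_nhds hys] with z hz
      simp [c.left_inv hz]
    rw [e1, mfderiv_comp (I' := 𝓡 n) y hyd.mdifferentiableAt (mdifferentiableAt_chart hcm hys),
      mfderiv_eq_fderiv]
    rfl
  refine ContinuousLinearMap.opNorm_le_bound _ (by positivity) fun v => ?_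
  rw [h1]
  have h2 := (fderiv ℝ (f ∘ c.symm) (c y)).le_opNorm (chartDeriv c y v)
  calc ‖fderiv ℝ (f ∘ c.symm) (c y) (chartDeriv c y v)‖
      ≤ ‖fderiv ℝ (f ∘ c.symm) (c y)‖ * ‖chartDeriv c y v‖ := h2
    _ ≤ (‖fderiv ℝ (f ∘ c.symm) (c x)‖ + 1) * (C * ‖v‖) :=
        mul_le_mul hyb.le (hyC v) (norm_nonneg _) (by positivity)
    _ = _ := by ring

theorem exists_bound_of_isCompact {p : M → ℝ} {K : Set M} (hK : IsCompact K)
    (h : ∀ x ∈ K, ∃ C, ∀ᶠ y in 𝓝 x, p y ≤ C) : ∃ C, ∀ y ∈ K, p y ≤ C := by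
  refine hK.induction_on (p := fun s => ∃ C, ∀ y ∈ s, p y ≤ C) ⟨0, by simp⟩ ?_ ?_ ?_
  · rintro s t hst ⟨C, hC⟩
    exact ⟨C, fun y hy => hC y (hst hy)⟩
  · rintro s t ⟨C, hC⟩ ⟨D, hD⟩
    refine ⟨max C D, fun y hy => ?_⟩
    rcases hy with hy | hy
    · exact (hC y hy).trans (le_max_left _ _)
    · exact (hD y hy).trans (le_max_right _ _)
  · intro x hx
    obtain ⟨C, hC⟩ := h x hx
    exact ⟨_, mem_nhdsWithin_of_mem_nhds hC, C, fun y hy => hy⟩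

theorem dform_eq_zero_of_notMem_tsupport {f : M → ℝ} {x : M} (hx : x ∉ tsupport f) :
    dform (n := n) f x = 0 := by
  have h : f =ᶠ[𝓝 x] fun _ => (0 : ℝ) := notMem_tsupport_iff_eventuallyEq.1 hx
  rw [dform, h.mfderiv_eq, mfderiv_const]
  rfl

theorem exists_norm_dform_le {f : M → ℝ} (hf : ContMDiff (𝓡 n) 𝓘(ℝ, ℝ) 1 f)
    (hc : HasCompactSupport f) : ∃ C, 0 ≤ C ∧ ∀ x, ‖dform (n := n) f x‖ ≤ C := by
  obtain ⟨C, hC⟩ := exists_bound_of_isCompact hc.isCompact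
    fun x _ => eventually_norm_dform_le hf.contMDiffAt
  refine ⟨max C 0, le_max_right _ _, fun x => ?_⟩
  by_cases hx : x ∈ tsupport f
  · exact (hC x hx).trans (le_max_left _ _)
  · rw [dform_eq_zero_of_notMem_tsupport hx]
    exact (norm_zero (E := TangentSpace (𝓡 n) x →L[ℝ] ℝ)).le.trans (le_max_right _ _)

theorem coordForm_eq_dform {φ : OpenPartialHomeomorph M (EuclideanSpace ℝ (Fin n))}
    (hφ : φ ∈ charts n M) (j : Fin n) {x : M} (hx : x ∈ φ.source) :
    coordForm φ j x = dform (n := n) (fun x => φ x j) x := by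
  have h1 := mfderiv_comp (I' := 𝓡 n) (I'' := 𝓘(ℝ, ℝ)) x
    (g := (EuclideanSpace.proj j : EuclideanSpace ℝ (Fin n) →L[ℝ] ℝ))
    (EuclideanSpace.proj j : EuclideanSpace ℝ (Fin n) →L[ℝ] ℝ).mdifferentiableAt
    (mdifferentiableAt_chart hφ hx)
  rw [mfderiv_eq_fderiv, ContinuousLinearMap.fderiv] at h1
  exact h1.symm

theorem contMDiffOn_coord {φ : OpenPartialHomeomorph M (EuclideanSpace ℝ (Fin n))}
    (hφ : φ ∈ charts n M) (j : Fin n) :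
    ContMDiffOn (𝓡 n) 𝓘(ℝ, ℝ) ∞ (fun x => φ x j) φ.source :=
  (EuclideanSpace.proj j : EuclideanSpace ℝ (Fin n) →L[ℝ] ℝ).contMDiff.comp_contMDiffOn
    (contMDiffOn_chart hφ)

theorem exists_norm_coordForm_le {φ : OpenPartialHomeomorph M (EuclideanSpace ℝ (Fin n))}
    (hφ : φ ∈ charts n M) {K : Set M} (hK : IsCompact K) (hKφ : K ⊆ φ.source) (j : Fin n) :
    ∃ C, ∀ x ∈ K, ‖coordForm φ j x‖ ≤ C := by
  refine exists_bound_of_isCompact hK fun x hx => ?_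
  have h1 : ContMDiffAt (𝓡 n) 𝓘(ℝ, ℝ) 1 (fun x => φ x j) x :=
    ((contMDiffOn_coord hφ j).contMDiffAt (φ.open_source.mem_nhds (hKφ hx))).of_le (by simp)
  obtain ⟨C, hC⟩ := eventually_norm_dform_le h1
  refine ⟨C, ?_⟩
  filter_upwards [hC, φ.open_source.mem_nhds (hKφ hx)] with y hy hys
  rwa [coordForm_eq_dform hφ j hys]

end Norm

section Lipschitz

variable {n : ℕ} {M : Type*} [MetricSpace M] [ChartedSpace (EuclideanSpace ℝ (Fin n)) M]
  [IsManifold (𝓡 n) ∞ M]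
  [RiemannianBundle (fun x : M => TangentSpace (𝓡 n) x)]
  [IsContinuousRiemannianBundle (EuclideanSpace ℝ (Fin n)) (fun x : M => TangentSpace (𝓡 n) x)]
  [IsRiemannianManifold (𝓡 n) M]

/-- Along a `C¹` curve the increment of `f` is at most the integral of `|df(γ')|`, hence at most `C`
times the length, and the distance is the infimum of lengths. -/
theorem lipschitzWith_of_norm_dform_le {f : M → ℝ} (hf : ContMDiff (𝓡 n) 𝓘(ℝ, ℝ) 1 f)
    {C : ℝ≥0} (hC : ∀ x, ‖dform (n := n) f x‖ ≤ C) : LipschitzWith C f := by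
  intro x y
  rw [IsRiemannianManifold.out (I := 𝓡 n) x y]
  have key : ∀ r : ℝ≥0∞, riemannianEDist (𝓡 n) x y < r → edist (f x) (f y) ≤ C * r := by
    intro r hr
    obtain ⟨γ, rfl, rfl, hγ, hlen⟩ := exists_lt_of_riemannianEDist_lt hr
    have hfγ : ContDiffOn ℝ 1 (f ∘ γ) (Icc 0 1) := by
      rw [← contMDiffOn_iff_contDiffOn]
      exact hf.comp_contMDiffOn hγ
    rw [edist_comm, edist_eq_enorm_sub]
    refine (enorm_sub_le_lintegral_derivWithin_Icc_of_contDiffOn_Icc hfγ zero_le_one).trans ?_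
    refine le_trans ?_ (mul_le_mul_right hlen.le _)
    rw [pathELength_eq_lintegral_mfderivWithin_Icc, ← lintegral_const_mul' _ _ ENNReal.coe_ne_top]
    refine setLIntegral_mono' measurableSet_Icc fun t ht => ?_
    have h1 : mfderivWithin 𝓘(ℝ, ℝ) 𝓘(ℝ, ℝ) (f ∘ γ) (Icc 0 1) t =
        (mfderiv (𝓡 n) 𝓘(ℝ, ℝ) f (γ t)).comp (mfderivWithin 𝓘(ℝ, ℝ) (𝓡 n) γ (Icc 0 1) t) :=
      mfderiv_comp_mfderivWithin t (hf.mdifferentiable one_ne_zero _)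
        (hγ.mdifferentiableOn one_ne_zero t ht)
        ((uniqueDiffOn_Icc zero_lt_one).uniqueMDiffOn t ht)
    have h2 : derivWithin (f ∘ γ) (Icc 0 1) t =
        dform (n := n) f (γ t) (mfderivWithin 𝓘(ℝ, ℝ) (𝓡 n) γ (Icc 0 1) t (1 : ℝ)) := by
      rw [← fderivWithin_derivWithin, ← mfderivWithin_eq_fderivWithin, h1]
      rfl
    rw [h2]
    refine ((dform (n := n) f (γ t)).le_opENorm _).trans ?_
    refine mul_le_mul_left ?_ _
    rw [← ofReal_norm, ← ENNReal.ofReal_coe_nnreal]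
    exact ENNReal.ofReal_le_ofReal (hC _)
  rcases eq_or_ne (riemannianEDist (𝓡 n) x y) ⊤ with h | h
  · exfalso
    rw [← IsRiemannianManifold.out (I := 𝓡 n) x y] at h
    exact edist_ne_top x y h
  -- Curves are available only for lengths `r` strictly above the distance, so the estimate is
  -- passed to the limit `r ↓ d(x, y)`; finiteness of the distance leaves room above it.
  · have hne : (𝓝[>] (riemannianEDist (𝓡 n) x y)).NeBot :=
      nhdsGT_neBot_of_exists_gt ⟨⊤, lt_top_iff_ne_top.2 h⟩
    have hlim : Tendsto (fun r : ℝ≥0∞ => (C : ℝ≥0∞) * r) (𝓝[>] (riemannianEDist (𝓡 n) x y))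
        (𝓝 (C * riemannianEDist (𝓡 n) x y)) :=
      tendsto_nhdsWithin_of_tendsto_nhds
        (ENNReal.Tendsto.const_mul tendsto_id (Or.inr ENNReal.coe_ne_top))
    exact ge_of_tendsto hlim (eventually_mem_nhdsWithin.mono fun r hr => key r hr)

theorem exists_lipschitzWith_of_hasCompactSupport {f : M → ℝ}
    (hf : ContMDiff (𝓡 n) 𝓘(ℝ, ℝ) 1 f) (hc : HasCompactSupport f) : ∃ C, LipschitzWith C f := by
  obtain ⟨C, hC0, hC⟩ := exists_norm_dform_le hf hc
  lift C to ℝ≥0 using hC0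
  exact ⟨C, lipschitzWith_of_norm_dform_le hf hC⟩

end Lipschitz

end LowReg

/-! ### Sobolev functions supported in a chart -/

theorem EuclSobolev.HasWeakPartialDeriv.mono {n : ℕ} {Ω Ω' : Set (EuclideanSpace ℝ (Fin n))}
    {i : Fin n} {f h : EuclideanSpace ℝ (Fin n) → ℝ} (hf : HasWeakPartialDeriv Ω i f h)
    (hs : Ω' ⊆ Ω) : HasWeakPartialDeriv Ω' i f h :=
  ⟨hf.1.mono_set hs, hf.2.1.mono_set hs, fun η hη hc hη' => hf.2.2 η hη hc (hη'.trans hs)⟩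

theorem EuclSobolev.MemL2Loc.mono {n : ℕ} {Ω Ω' : Set (EuclideanSpace ℝ (Fin n))}
    {f : EuclideanSpace ℝ (Fin n) → ℝ} (hf : MemL2Loc Ω f) (hs : Ω' ⊆ Ω) : MemL2Loc Ω' f :=
  fun K hK => hf K (hK.trans hs)

namespace LowReg

open EuclSobolev

section Lift

variable {n : ℕ} {M : Type*} [TopologicalSpace M] [T2Space M]
  [ChartedSpace (EuclideanSpace ℝ (Fin n)) M]
  {φ ψ : OpenPartialHomeomorph M (EuclideanSpace ℝ (Fin n))}
  {K : Set (EuclideanSpace ℝ (Fin n))}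

open Classical in
/-- The 1-form on `M` with components `w` in the chart `φ`, and zero outside its domain. -/
def liftForm (φ : OpenPartialHomeomorph M (EuclideanSpace ℝ (Fin n)))
    (w : Fin n → EuclideanSpace ℝ (Fin n) → ℝ) (x : M) : TangentSpace (𝓡 n) x →L[ℝ] ℝ :=
  if x ∈ φ.source then ∑ j, w j (φ x) • coordForm φ j x else 0

theorem isClosed_image_symm (hK : IsCompact K) (hKφ : K ⊆ φ.target) :
    IsClosed (φ.symm '' K) :=
  (hK.image_of_continuousOn (φ.continuousOn_symm.mono hKφ)).isClosed

theorem isCompact_inter_preimage (hK : IsCompact K) (hKφ : K ⊆ φ.target)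
    (K' : Set (EuclideanSpace ℝ (Fin n))) (hK'ψ : K' ⊆ ψ.target) (hK' : IsCompact K') :
    IsCompact (ψ.symm ⁻¹' (φ.symm '' K) ∩ K') := by
  refine hK'.of_isClosed_subset ?_ inter_subset_right
  rw [inter_comm]
  exact (ψ.continuousOn_symm.mono hK'ψ).preimage_isClosed_of_isClosed hK'.isClosed
    (isClosed_image_symm hK hKφ)

theorem preimage_inter_target_subset (hKφ : K ⊆ φ.target) :
    ψ.symm ⁻¹' (φ.symm '' K) ∩ ψ.target ⊆ (ψ.symm.trans φ).source := by
  rintro z ⟨⟨y, hy, hyz⟩, hz⟩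
  refine ⟨hz, ?_⟩
  change ψ.symm z ∈ φ.source
  rw [← hyz]
  exact φ.map_target (hKφ hy)

theorem transition_target_subset : (ψ.symm.trans φ).target ⊆ φ.target := fun _ hy => hy.1

theorem lift_eq_zero {R : Type*} [Zero R] {H : EuclideanSpace ℝ (Fin n) → R}
    (hH0 : ∀ y ∉ K, H y = 0) {x : M} (hx : x ∉ φ.symm '' K) : lift φ H x = 0 := by
  by_cases hs : x ∈ φ.source
  · rw [lift_of_mem hs, hH0 _ fun h => hx ⟨_, h, φ.left_inv hs⟩]
  · exact lift_of_notMem hs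

theorem liftForm_eq_zero {w : Fin n → EuclideanSpace ℝ (Fin n) → ℝ}
    (hw0 : ∀ j, ∀ y ∉ K, w j y = 0) {x : M} (hx : x ∉ φ.symm '' K) : liftForm φ w x = 0 := by
  by_cases hs : x ∈ φ.source
  · rw [liftForm, if_pos hs]
    refine Finset.sum_eq_zero fun j _ => ?_
    rw [hw0 _ _ fun h => hx ⟨_, h, φ.left_inv hs⟩]
    exact zero_smul ℝ (coordForm φ j x)
  · rw [liftForm, if_neg hs]

theorem liftForm_coordVec (hφ : φ ∈ charts n M) (hψ : ψ ∈ charts n M)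
    {w : Fin n → EuclideanSpace ℝ (Fin n) → ℝ} (i : Fin n) {z : EuclideanSpace ℝ (Fin n)}
    (hz : z ∈ (ψ.symm.trans φ).source) :
    liftForm φ w (ψ.symm z) (coordVec n ψ i z) =
      ∑ j, w j ((ψ.symm.trans φ) z) * pd i (fun z => (ψ.symm.trans φ) z j) z := by
  have hs : ψ.symm z ∈ φ.source := hz.2
  rw [liftForm, if_pos hs, _root_.sum_apply]
  refine Finset.sum_congr rfl fun j _ => ?_
  rw [← coordForm_coordVec hφ hψ i j hz]
  rfl

/-- A weak differential is tested in every chart `ψ`. On the overlap with `φ` the weak chain rule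
for the transition map applies. The image of `K` is closed because `M` is Hausdorff, so extension by
zero covers the rest of `ψ.target`. -/
theorem hasWeakDifferential_lift (hφ : φ ∈ charts n M) (hK : IsCompact K) (hKφ : K ⊆ φ.target)
    {H : EuclideanSpace ℝ (Fin n) → ℝ} {w : Fin n → EuclideanSpace ℝ (Fin n) → ℝ}
    (hH0 : ∀ y ∉ K, H y = 0) (hw0 : ∀ j, ∀ y ∉ K, w j y = 0)
    (hH : ∀ j, HasWeakPartialDeriv φ.target j H (w j)) (hHi : LocallyIntegrableOn H φ.target) :
    HasWeakDifferential n (lift φ H) (liftForm φ w) := by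
  intro ψ hψ i
  have h1 := OpenPartialHomeomorph.hasWeakPartialDeriv_comp (contDiffOn_transition hφ hψ)
    (contDiffOn_transition_symm hφ hψ) (fun j => (hH j).mono transition_target_subset)
    (hHi.mono_set transition_target_subset) i
  have h2 := h1.congr (ψ.symm.trans φ).open_source
    (f' := fun z => lift φ H (ψ.symm z))
    (h' := fun z => liftForm φ w (ψ.symm z) (coordVec n ψ i z))
    (ae_of_all _ fun z hz => by
      have hs : ψ.symm z ∈ φ.source := hz.2
      rw [lift_of_mem hs]
      rfl)
    (ae_of_all _ fun z hz => (liftForm_coordVec hφ hψ i hz).symm)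
  refine h2.extend ψ.open_target (ψ.symm.trans φ).open_source
    (C := ψ.symm ⁻¹' (φ.symm '' K)) (isCompact_inter_preimage hK hKφ)
    (preimage_inter_target_subset hKφ) (fun z _ hz => lift_eq_zero hH0 hz) fun z _ hz => ?_
  rw [liftForm_eq_zero hw0 hz]
  rfl

theorem memWLocM_lift (hφ : φ ∈ charts n M) (hK : IsCompact K) (hKφ : K ⊆ φ.target)
    {H : EuclideanSpace ℝ (Fin n) → ℝ} {w : Fin n → EuclideanSpace ℝ (Fin n) → ℝ}
    (hH0 : ∀ y ∉ K, H y = 0) (hw0 : ∀ j, ∀ y ∉ K, w j y = 0)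
    (hH : ∀ j, HasWeakPartialDeriv φ.target j H (w j)) (hH2 : MemL2Loc φ.target H)
    (hw2 : ∀ j, MemL2Loc φ.target (w j)) :
    MemWLocM n 1 (lift φ H) := by
  intro ψ hψ
  have t1 := contDiffOn_transition hφ hψ
  have t2 := contDiffOn_transition_symm hφ hψ
  have hext : ∀ {f g : EuclideanSpace ℝ (Fin n) → ℝ}, MemL2Loc (ψ.symm.trans φ).source f →
      (∀ z ∈ (ψ.symm.trans φ).source, f z = g z) →
      (∀ z ∈ ψ.target, z ∉ ψ.symm ⁻¹' (φ.symm '' K) → g z = 0) → MemL2Loc ψ.target g := by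
    intro f g hf hfg h0
    exact MemL2Loc.extend (isCompact_inter_preimage hK hKφ) (preimage_inter_target_subset hKφ)
      (memL2Loc_congr hf (ae_of_all _ hfg)) h0
  refine ⟨?_, fun i => ⟨_, hasWeakDifferential_lift hφ hK hKφ hH0 hw0 hH
    (hH2.locallyIntegrableOn φ.open_target) ψ hψ i, ?_⟩⟩
  · refine hext (OpenPartialHomeomorph.memL2Loc_comp t1 t2 (hH2.mono transition_target_subset))
      (fun z hz => ?_) fun z _ hz => lift_eq_zero hH0 hz
    have hs : ψ.symm z ∈ φ.source := hz.2
    rw [lift_of_mem hs]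
    rfl
  · refine hext (f := fun z => ∑ j, pd i (fun z => (ψ.symm.trans φ) z j) z *
        w j ((ψ.symm.trans φ) z)) ?_ (fun z hz => ?_) fun z _ hz => ?_
    · refine MemWLoc.sum (k := 0) fun j _ => ?_
      refine MemL2Loc.lipschitz_mul ?_
        (OpenPartialHomeomorph.memL2Loc_comp t1 t2 ((hw2 j).mono transition_target_subset))
      exact ((contDiffOn_pd (ψ.symm.trans φ).open_source ((EuclideanSpace.proj j :
        EuclideanSpace ℝ (Fin n) →L[ℝ] ℝ).contDiff.comp_contDiffOn t1) i).of_le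
        (by simp)).locallyLipschitzOn_of_isOpen (ψ.symm.trans φ).open_source
    · rw [liftForm_coordVec hφ hψ i hz]
      exact Finset.sum_congr rfl fun j _ => mul_comm _ _
    · rw [liftForm_eq_zero hw0 hz]
      rfl

/-- A weakly differentiable function supported in a compact subset of `Ω` has measurable weak
partial derivatives supported in a compact subset of `Ω`. -/
theorem _root_.EuclSobolev.MemWLoc.exists_compact_measurable {Ω : Set (EuclideanSpace ℝ (Fin n))}
    (hΩ : IsOpen Ω) {H : EuclideanSpace ℝ (Fin n) → ℝ} (hH : MemWLoc Ω 1 H) (hK : IsCompact K)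
    (hKΩ : K ⊆ Ω) (hH0 : ∀ y ∉ K, H y = 0) :
    ∃ (K' : Set (EuclideanSpace ℝ (Fin n))) (w : Fin n → EuclideanSpace ℝ (Fin n) → ℝ),
      IsCompact K' ∧ K ⊆ K' ∧ K' ⊆ Ω ∧ ∀ j, HasWeakPartialDeriv Ω j H (w j) ∧ Measurable (w j) ∧
        MemL2Loc Ω (w j) ∧ ∀ y ∉ K', w j y = 0 := by
  obtain ⟨χ, hχ, hχc, hχs, hχ1⟩ := exists_contDiff_cutoff hK hΩ hKΩ
  have hχ1' : ∀ y ∈ K, χ y = 1 := fun y hy => hχ1.self_of_nhdsSet y hy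
  have hKχ : K ⊆ tsupport χ := fun y hy => subset_tsupport _ (by simp [hχ1' y hy])
  have hχL : LocallyLipschitzOn Ω χ :=
    (hχ.of_le (by simp)).contDiffOn.locallyLipschitzOn_of_isOpen hΩ
  have hχH : (fun y => χ y * H y) = H := by
    ext y
    by_cases hy : y ∈ K
    · rw [hχ1' y hy, one_mul]
    · rw [hH0 y hy, mul_zero]
  have key : ∀ j, ∃ w, HasWeakPartialDeriv Ω j H w ∧ Measurable w ∧
      MemL2Loc Ω w ∧ ∀ y ∉ tsupport χ, w y = 0 := by
    intro j
    obtain ⟨v, hv, hv2⟩ := hH.2 j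
    -- The given weak derivative `v` need not vanish pointwise off the support of `H`.
    -- Differentiating `χ H = H` by the product rule produces one that vanishes outside `tsupport
    -- χ`.
    have h1 := hv.mul hΩ hχL
    rw [hχH] at h1
    set v' : EuclideanSpace ℝ (Fin n) → ℝ := fun y => pd j χ y * H y + χ y * v y with hv'
    have hv'0 : ∀ y ∉ tsupport χ, v' y = 0 := fun y hy => by
      rw [hv']
      simp only [pd_eq_zero_of_notMem hy, image_eq_zero_of_notMem_tsupport hy, zero_mul, add_zero]
    have hv'2 : MemL2Loc Ω v' :=
      MemL2Loc.add (hH.1.pd_mul hΩ hχL j) (MemL2Loc.lipschitz_mul hχL hv2)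
    have hm := (hv'2 _ hχs hχc.isCompact).aestronglyMeasurable
    have hms : MeasurableSet (tsupport χ) := (isClosed_tsupport χ).measurableSet
    -- Lifts to `M` are integrated through `measurable_lift`, which needs a Borel function rather
    -- than an almost everywhere class.
    set w := (tsupport χ).indicator (hm.mk v') with hw
    have hae : ∀ᵐ y, y ∈ Ω → v' y = w y := by
      filter_upwards [(ae_restrict_iff' hms).1 hm.ae_eq_mk] with y hy _
      by_cases h : y ∈ tsupport χ
      · rw [hw, indicator_of_mem h, hy h]
      · rw [hw, indicator_of_notMem h, hv'0 y h]
    exact ⟨w, h1.congr hΩ (ae_of_all _ fun _ _ => rfl) hae,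
      hm.stronglyMeasurable_mk.measurable.indicator hms, memL2Loc_congr hv'2 hae,
      fun y hy => indicator_of_notMem hy _⟩
  choose w hw using key
  exact ⟨tsupport χ, w, hχc.isCompact, hKχ, hχs, hw⟩

theorem HasWeakDifferential.add {f g : M → ℝ} {α β : ∀ x : M, TangentSpace (𝓡 n) x →L[ℝ] ℝ}
    (hf : HasWeakDifferential n f α) (hg : HasWeakDifferential n g β) :
    HasWeakDifferential n (fun x => f x + g x) (fun x => α x + β x) :=
  fun φ hφ i => (hf φ hφ i).add (hg φ hφ i)

theorem MemWLocM.add {k : ℕ} {f g : M → ℝ} (hf : MemWLocM n k f) (hg : MemWLocM n k g) :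
    MemWLocM n k (fun x => f x + g x) := fun φ hφ => (hf φ hφ).add (hg φ hφ)

end Lift

/-! ### Square integrable differentials and sums of `W^{1,2}` functions. -/

section Dominated

variable {n : ℕ} {M : Type*} [TopologicalSpace M] [T2Space M]
  [ChartedSpace (EuclideanSpace ℝ (Fin n)) M] [IsManifold (𝓡 n) ∞ M]
  [RiemannianBundle (fun x : M => TangentSpace (𝓡 n) x)]
  [IsContinuousRiemannianBundle (EuclideanSpace ℝ (Fin n)) (fun x : M => TangentSpace (𝓡 n) x)]
  [MeasurableSpace M] [BorelSpace M]
  {φ : OpenPartialHomeomorph M (EuclideanSpace ℝ (Fin n))}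
  {K : Set (EuclideanSpace ℝ (Fin n))}

variable (n) in
/-- `W^{1,2}` functions whose differential is dominated by a square integrable function. -/
def DominatedW12 (f : M → ℝ) : Prop :=
  MemWLocM n 1 f ∧ MemLp f 2 (vol n M) ∧
    ∃ α : ∀ x : M, TangentSpace (𝓡 n) x →L[ℝ] ℝ, HasWeakDifferential n f α ∧
      ∃ B : M → ℝ, MemLp B 2 (vol n M) ∧ ∀ x, ‖α x‖ ≤ B x

theorem _root_.MeasureTheory.MemLp.lintegral_enorm_sq_lt_top {X : Type*} [MeasurableSpace X]
    {μ : Measure X} {f : X → ℝ} (hf : MemLp f 2 μ) : ∫⁻ x, ‖f x‖ₑ ^ 2 ∂μ < ⊤ := by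
  have h := lintegral_rpow_enorm_lt_top_of_eLpNorm_lt_top (p := 2) (by simp) (by simp)
    hf.eLpNorm_lt_top
  simpa using h

theorem DominatedW12.memW12 {f : M → ℝ} (hf : DominatedW12 n f) : MemW12 n f := by
  obtain ⟨h1, h2, α, h3, B, hB, hαB⟩ := hf
  refine ⟨h1, α, h3, ?_⟩
  have h4 : ∫⁻ x, ‖f x‖ₑ ^ 2 + ‖α x‖ₑ ^ 2 ∂vol n M ≤
      ∫⁻ x, ‖f x‖ₑ ^ 2 + ‖B x‖ₑ ^ 2 ∂vol n M := by
    refine lintegral_mono fun x => ?_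
    refine add_le_add le_rfl ?_
    gcongr
    rw [← ofReal_norm, ← ofReal_norm]
    exact ENNReal.ofReal_le_ofReal ((hαB x).trans (Real.le_norm_self _))
  refine h4.trans_lt ?_
  rw [lintegral_add_left' (h2.aestronglyMeasurable.enorm.pow_const 2)]
  exact ENNReal.add_lt_top.2 ⟨h2.lintegral_enorm_sq_lt_top, hB.lintegral_enorm_sq_lt_top⟩

/-- The dominating functions add by the triangle inequality, so no measurability of `x ↦ ‖α x‖`
enters. -/
theorem DominatedW12.add {f g : M → ℝ} (hf : DominatedW12 n f) (hg : DominatedW12 n g) :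
    DominatedW12 n (fun x => f x + g x) := by
  obtain ⟨h1, h2, α, h3, B, hB, hαB⟩ := hf
  obtain ⟨h1', h2', α', h3', B', hB', hαB'⟩ := hg
  exact ⟨h1.add h1', h2.add h2', _, h3.add h3', _, hB.add hB', fun x =>
    (norm_add_le (α x) (α' x)).trans (add_le_add (hαB x) (hαB' x))⟩

theorem memLp_lift (hC : IsMetricC01 n M) (hφ : φ ∈ charts n M) (hK : IsCompact K)
    (hKφ : K ⊆ φ.target) {H : EuclideanSpace ℝ (Fin n) → ℝ} (hm : Measurable H)
    (hH0 : ∀ y ∉ K, H y = 0) (hH2 : MemL2Loc φ.target H) : MemLp (lift φ H) 2 (vol n M) := by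
  refine ⟨(measurable_lift hm).aestronglyMeasurable, ?_⟩
  rw [eLpNorm_lt_top_iff_lintegral_rpow_enorm_lt_top (by simp) (by simp)]
  have h1 : ∀ x : M, ‖lift φ H x‖ₑ ^ (2 : ℝ≥0∞).toReal = lift φ (fun y => ‖H y‖ₑ ^ 2) x := by
    intro x
    by_cases hx : x ∈ φ.source
    · simp [lift_of_mem hx]
    · simp [lift_of_notMem hx]
  simp only [h1]
  rw [lintegral_lift hC hφ (hm.enorm.pow_const 2)]
  obtain ⟨c, hc⟩ := hK.exists_bound_of_continuousOn ((continuousOn_density hC hφ).mono hKφ)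
  have h2 : ∫⁻ y in φ.target, ENNReal.ofReal (density φ y) * ‖H y‖ₑ ^ 2 ≤
      ∫⁻ y in K, ENNReal.ofReal c * ‖H y‖ₑ ^ 2 := by
    rw [← lintegral_indicator φ.open_target.measurableSet,
      ← lintegral_indicator hK.measurableSet]
    refine lintegral_mono fun y => ?_
    by_cases hy : y ∈ K
    · rw [indicator_of_mem (hKφ hy), indicator_of_mem hy]
      gcongr
      exact (Real.le_norm_self _).trans (hc y hy)
    · refine le_of_eq_of_le ?_ (zero_le)
      rw [indicator_apply_eq_zero]
      intro _
      simp [hH0 y hy]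
  refine h2.trans_lt ?_
  rw [lintegral_const_mul _ (hm.enorm.pow_const 2)]
  exact ENNReal.mul_lt_top ENNReal.ofReal_lt_top (hH2 K hKφ hK).lintegral_enorm_sq_lt_top

/-- On the compact support the covectors `dxʲ` are bounded by constants `c j`, so `∑ c j |w j|`
dominates the differential. It is in `L²(Vol)` because the density is bounded there. -/
theorem dominatedW12_lift (hC : IsMetricC01 n M) (hφ : φ ∈ charts n M) (hK : IsCompact K)
    (hKφ : K ⊆ φ.target) {H : EuclideanSpace ℝ (Fin n) → ℝ} (hm : Measurable H)
    (hH0 : ∀ y ∉ K, H y = 0) (hH : MemWLoc φ.target 1 H) : DominatedW12 n (lift φ H) := by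
  obtain ⟨K', w, hK', hKK', hK'φ, hw⟩ :=
    hH.exists_compact_measurable φ.open_target hK hKφ hH0
  have hH0' : ∀ y ∉ K', H y = 0 := fun y hy => hH0 y fun h => hy (hKK' h)
  refine ⟨memWLocM_lift hφ hK' hK'φ hH0' (fun j => (hw j).2.2.2) (fun j => (hw j).1) hH.1
    (fun j => (hw j).2.2.1), memLp_lift hC hφ hK hKφ hm hH0 hH.1, liftForm φ w,
    hasWeakDifferential_lift hφ hK' hK'φ hH0' (fun j => (hw j).2.2.2) (fun j => (hw j).1)
      (hH.1.locallyIntegrableOn φ.open_target), ?_⟩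
  have himg : φ.symm '' K' ⊆ φ.source := by
    rintro _ ⟨y, hy, rfl⟩
    exact φ.map_target (hK'φ hy)
  choose c hc using fun j => exists_norm_coordForm_le hφ
    (hK'.image_of_continuousOn (φ.continuousOn_symm.mono hK'φ)) himg j
  have hBj : ∀ j, MemLp (fun x => lift φ (w j) x) 2 (vol n M) := fun j =>
    memLp_lift hC hφ hK' hK'φ (hw j).2.1 (hw j).2.2.2 (hw j).2.2.1
  refine ⟨fun x => ∑ j, c j * ‖lift φ (w j) x‖,
    memLp_finsetSum _ fun j _ => (hBj j).norm.const_mul (c j), fun x => ?_⟩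
  by_cases hx : x ∈ φ.symm '' K'
  · rw [liftForm, if_pos (himg hx)]
    have h1 := norm_sum_le (E := TangentSpace (𝓡 n) x →L[ℝ] ℝ) Finset.univ
      (fun j => w j (φ x) • coordForm φ j x)
    refine h1.trans (Finset.sum_le_sum fun j _ => ?_)
    rw [lift_of_mem (himg hx), mul_comm]
    exact (ContinuousLinearMap.opNorm_smul_le (w j (φ x)) (coordForm φ j x)).trans
      (mul_le_mul_of_nonneg_left (hc j x hx) (norm_nonneg _))
  · rw [liftForm_eq_zero (fun j => (hw j).2.2.2) hx]
    refine (norm_zero (E := TangentSpace (𝓡 n) x →L[ℝ] ℝ)).le.trans ?_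
    refine le_of_eq (Finset.sum_eq_zero fun j _ => ?_).symm
    rw [lift_eq_zero (hw j).2.2.2 hx, norm_zero, mul_zero]

end Dominated

end LowReg

/-! ### The Laplacian of a function supported in a chart -/

namespace LowReg

open EuclSobolev

/-- Compactly supported functions on `Ω` with locally Lipschitz first derivatives and second
derivatives in `W^{1,2}_loc`. -/
structure IsChartTest {n : ℕ} (Ω : Set (EuclideanSpace ℝ (Fin n)))
    (F : EuclideanSpace ℝ (Fin n) → ℝ) : Prop where
  contDiff : ContDiff ℝ 1 F
  hasCompactSupport : HasCompactSupport F
  tsupport_subset : tsupport F ⊆ Ω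
  locallyLipschitzOn_pd : ∀ j, LocallyLipschitzOn Ω (pd j F)
  memWLoc_pd : ∀ i j, MemWLoc Ω 1 (pd i (pd j F))

section Flux

variable {n : ℕ} {M : Type*} [TopologicalSpace M] [ChartedSpace (EuclideanSpace ℝ (Fin n)) M]
  [IsManifold (𝓡 n) ∞ M]
  [RiemannianBundle (fun x : M => TangentSpace (𝓡 n) x)]
  {φ : OpenPartialHomeomorph M (EuclideanSpace ℝ (Fin n))}
  {F : EuclideanSpace ℝ (Fin n) → ℝ}

/-- The functions `√(det g) gⁱʲ`. -/
def fluxCoeff (φ : OpenPartialHomeomorph M (EuclideanSpace ℝ (Fin n))) (i j : Fin n)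
    (y : EuclideanSpace ℝ (Fin n)) : ℝ :=
  Matrix.sqrtDetInv i j fun p => metricCoeff n φ p.1 p.2 y

/-- The components of the vector density `√(det g) ∇F`. -/
def flux (φ : OpenPartialHomeomorph M (EuclideanSpace ℝ (Fin n)))
    (F : EuclideanSpace ℝ (Fin n) → ℝ) (i : Fin n) (y : EuclideanSpace ℝ (Fin n)) : ℝ :=
  ∑ j, fluxCoeff φ i j y * pd j F y

/-- The Laplacian of `F` in the chart `φ`. -/
def chartLaplacian (φ : OpenPartialHomeomorph M (EuclideanSpace ℝ (Fin n)))
    (F : EuclideanSpace ℝ (Fin n) → ℝ) (y : EuclideanSpace ℝ (Fin n)) : ℝ :=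
  -- The indicator makes this factor Borel measurable on the whole space; off the target its inverse
  -- is `0`.
  (φ.target.indicator (density φ) y)⁻¹ * ∑ i, pd i (flux φ F i) y

theorem fluxCoeff_eq (i j : Fin n) (y : EuclideanSpace ℝ (Fin n)) :
    fluxCoeff φ i j y = density φ y * (gramMatrix φ y)⁻¹ i j := rfl

theorem locallyLipschitzOn_fluxCoeff (hC : IsMetricC01 n M) (hφ : φ ∈ charts n M) (i j : Fin n) :
    LocallyLipschitzOn φ.target (fluxCoeff φ i j) :=
  (locallyLipschitzOn_gramMatrix hC hφ).contDiffAt_comp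
    fun _ hy => Matrix.contDiffAt_sqrtDetInv i j (det_gramMatrix_pos hφ hy)

theorem locallyLipschitzOn_inv_density (hC : IsMetricC01 n M) (hφ : φ ∈ charts n M) :
    LocallyLipschitzOn φ.target (fun y => (density φ y)⁻¹) :=
  (locallyLipschitzOn_gramMatrix hC hφ).contDiffAt_comp (Φ := fun p => (Matrix.sqrtDet p)⁻¹)
    fun y hy => (Matrix.contDiffAt_sqrtDet (p := fun p => metricCoeff n φ p.1 p.2 y)
      (det_gramMatrix_pos hφ hy)).inv (density_pos hφ hy).ne'

/-- Here the `W^{2,2}` regularity of `g` enters: differentiating the coefficients once leaves them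
in `W^{1,2}_loc`. -/
theorem memWLoc_pd_fluxCoeff (hC : IsMetricC01 n M) (hW : IsMetricW n M 2) (hφ : φ ∈ charts n M)
    (i j k : Fin n) : MemWLoc φ.target 1 (pd k (fluxCoeff φ i j)) :=
  memWLoc_pd_comp φ.open_target (g := fun p : Fin n × Fin n => metricCoeff n φ p.1 p.2)
    (fun p => hC φ hφ p.1 p.2)
    (fun p => hW φ hφ p.1 p.2)
    (fun _ hy => Matrix.contDiffAt_sqrtDetInv i j (det_gramMatrix_pos hφ hy)) k

theorem flux_eq_zero {i : Fin n} {y : EuclideanSpace ℝ (Fin n)} (hy : y ∉ tsupport F) :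
    flux φ F i y = 0 :=
  Finset.sum_eq_zero fun j _ => by rw [pd_eq_zero_of_notMem hy, mul_zero]

theorem tsupport_flux_subset {i : Fin n} : tsupport (flux φ F i) ⊆ tsupport F :=
  closure_minimal (fun _ hy => by_contra fun h => hy (flux_eq_zero h)) (isClosed_tsupport F)

theorem chartLaplacian_eq_zero {y : EuclideanSpace ℝ (Fin n)} (hy : y ∉ tsupport F) :
    chartLaplacian φ F y = 0 := by
  rw [chartLaplacian, Finset.sum_eq_zero fun i _ => ?_, mul_zero]
  exact pd_eq_zero_of_notMem fun h => hy (tsupport_flux_subset h)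

theorem IsChartTest.locallyLipschitzOn_flux (hF : IsChartTest φ.target F) (hC : IsMetricC01 n M)
    (hφ : φ ∈ charts n M) (i : Fin n) : LocallyLipschitzOn φ.target (flux φ F i) :=
  LocallyLipschitzOn.real_sum fun j _ =>
    (locallyLipschitzOn_fluxCoeff hC hφ i j).real_mul (hF.locallyLipschitzOn_pd j)

theorem IsChartTest.continuous_flux (hF : IsChartTest φ.target F) (hC : IsMetricC01 n M)
    (hφ : φ ∈ charts n M) (i : Fin n) : Continuous (flux φ F i) := by
  rw [← contDiff_zero (𝕜 := ℝ)]
  exact ContDiffOn.contDiff_of_forall_notMem_eq_zero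
    (contDiffOn_zero.2 (hF.locallyLipschitzOn_flux hC hφ i).continuousOn) φ.open_target
    (isClosed_tsupport F) hF.tsupport_subset fun _ hy => flux_eq_zero hy

theorem measurable_indicator_density (hC : IsMetricC01 n M) (hφ : φ ∈ charts n M) :
    Measurable (φ.target.indicator (density φ)) := by
  classical
  have h := (continuousOn_density hC hφ).measurable_piecewise (g := fun _ => (0 : ℝ))
    continuousOn_const φ.open_target.measurableSet
  rwa [← piecewise_eq_indicator]

theorem measurable_chartLaplacian (hC : IsMetricC01 n M) (hφ : φ ∈ charts n M) :
    Measurable (chartLaplacian φ F) :=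
  (measurable_indicator_density hC hφ).inv.mul
    (Finset.measurable_fun_sum _ fun i _ => measurable_pd i _)

/-- The flux is expanded by the Leibniz rule, valid almost everywhere. In `∂ⱼF · ∂ᵢaⁱʲ` and `aⁱʲ ·
∂ᵢ∂ⱼF` the first factor is locally Lipschitz and the second is in `W^{1,2}_loc`, and multiplying by
the Lipschitz function `(√det g)⁻¹` preserves the class. -/
theorem IsChartTest.memWLoc_chartLaplacian (hF : IsChartTest φ.target F) (hC : IsMetricC01 n M)
    (hW : IsMetricW n M 2) (hφ : φ ∈ charts n M) :
    MemWLoc φ.target 1 (chartLaplacian φ F) := by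
  have h1 : MemWLoc φ.target 1 (fun y => (density φ y)⁻¹ * ∑ i, ∑ j,
      (pd j F y * pd i (fluxCoeff φ i j) y + fluxCoeff φ i j y * pd i (pd j F) y)) :=
    MemWLoc.lipschitz_mul φ.open_target (locallyLipschitzOn_inv_density hC hφ)
      (MemWLoc.sum fun i _ => MemWLoc.sum fun j _ => MemWLoc.add
        (MemWLoc.lipschitz_mul φ.open_target (hF.locallyLipschitzOn_pd j)
          (memWLoc_pd_fluxCoeff hC hW hφ i j i))
        (MemWLoc.lipschitz_mul φ.open_target (locallyLipschitzOn_fluxCoeff hC hφ i j)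
          (hF.memWLoc_pd i j)))
  refine h1.congr φ.open_target ?_
  have hA : ∀ᵐ y, ∀ i j, y ∈ φ.target → DifferentiableAt ℝ (fluxCoeff φ i j) y :=
    ae_all_iff.2 fun i => ae_all_iff.2 fun j =>
      (locallyLipschitzOn_fluxCoeff hC hφ i j).ae_differentiableAt_of_isOpen φ.open_target
  have hP : ∀ᵐ y, ∀ j, y ∈ φ.target → DifferentiableAt ℝ (pd j F) y :=
    ae_all_iff.2 fun j => (hF.locallyLipschitzOn_pd j).ae_differentiableAt_of_isOpen φ.open_target
  filter_upwards [hA, hP] with y hAy hPy hy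
  rw [chartLaplacian, indicator_of_mem hy]
  congr 1
  refine Finset.sum_congr rfl fun i _ => ?_
  have h2 : pd i (flux φ F i) y = ∑ j, pd i (fun y => fluxCoeff φ i j y * pd j F y) y :=
    pd_sum fun j _ => (hAy i j hy).mul (hPy j hy)
  rw [h2]
  refine Finset.sum_congr rfl fun j _ => ?_
  rw [pd_mul (hAy i j hy) (hPy j hy), mul_comm (pd j F y)]

/-- The flux is locally Lipschitz, so its derivatives are bounded on the compact support of `F`,
where `√(det g)` is bounded away from zero. -/
theorem IsChartTest.exists_bound_chartLaplacian (hF : IsChartTest φ.target F)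
    (hC : IsMetricC01 n M) (hφ : φ ∈ charts n M) : ∃ c, ∀ y, ‖chartLaplacian φ F y‖ ≤ c := by
  have hK := hF.hasCompactSupport.isCompact
  obtain ⟨c, hc⟩ := hK.exists_bound_of_continuousOn
    ((locallyLipschitzOn_inv_density hC hφ).continuousOn.mono hF.tsupport_subset)
  choose d hd using fun i => (hF.locallyLipschitzOn_flux hC hφ i).exists_bound_pd φ.open_target
    hK hF.tsupport_subset i
  refine ⟨max (c * ∑ i, d i) 0, fun y => ?_⟩
  by_cases hy : y ∈ tsupport F
  · refine le_max_of_le_left ?_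
    rw [chartLaplacian, indicator_of_mem (hF.tsupport_subset hy), norm_mul]
    exact mul_le_mul (hc y hy) ((norm_sum_le _ _).trans (Finset.sum_le_sum fun i _ => hd i y hy))
      (norm_nonneg _) ((norm_nonneg _).trans (hc y hy))
  · rw [chartLaplacian_eq_zero hy, norm_zero]
    exact le_max_right _ _

end Flux

/-! ### Raising indices and the gradient in coordinates. -/

section Gradient

variable {n : ℕ} {M : Type*} [TopologicalSpace M] [ChartedSpace (EuclideanSpace ℝ (Fin n)) M]
  [IsManifold (𝓡 n) ∞ M]
  [RiemannianBundle (fun x : M => TangentSpace (𝓡 n) x)]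
  {φ : OpenPartialHomeomorph M (EuclideanSpace ℝ (Fin n))}

theorem completeSpace_tangentSpace (x : M) : CompleteSpace (TangentSpace (𝓡 n) x) :=
  haveI : FiniteDimensional ℝ (TangentSpace (𝓡 n) x) :=
    inferInstanceAs (FiniteDimensional ℝ (EuclideanSpace ℝ (Fin n)))
  FiniteDimensional.complete ℝ _

/-- The vector that represents a covector with respect to the metric. -/
def sharp {x : M} (α : TangentSpace (𝓡 n) x →L[ℝ] ℝ) : TangentSpace (𝓡 n) x :=
  haveI := completeSpace_tangentSpace (n := n) x
  (InnerProductSpace.toDual ℝ (TangentSpace (𝓡 n) x)).symm α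

theorem inner_sharp {x : M} (α : TangentSpace (𝓡 n) x →L[ℝ] ℝ) (v : TangentSpace (𝓡 n) x) :
    inner ℝ (sharp α) v = α v :=
  haveI := completeSpace_tangentSpace (n := n) x
  InnerProductSpace.toDual_symm_apply

theorem innerSL_sharp {x : M} (α : TangentSpace (𝓡 n) x →L[ℝ] ℝ) :
    innerSL ℝ (sharp α) = α := by
  ext v
  exact inner_sharp α v

theorem hasWeakGradient_sharp {f : M → ℝ} {α : ∀ x : M, TangentSpace (𝓡 n) x →L[ℝ] ℝ}
    (h : HasWeakDifferential n f α) : HasWeakGradient n f (fun x => sharp (α x)) := by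
  have h1 : (fun x => innerSL ℝ (sharp (α x))) = α := funext fun x => innerSL_sharp (α x)
  rw [HasWeakGradient, h1]
  exact h

/-- The coordinates of the gradient. -/
theorem coordForm_sharp_dform (hφ : φ ∈ charts n M) {f : M → ℝ} {x : M} (hx : x ∈ φ.source)
    (hf : MDifferentiableAt (𝓡 n) 𝓘(ℝ, ℝ) f x) (k : Fin n) :
    coordForm φ k x (sharp (dform f x)) =
      ∑ j, (gramMatrix φ (φ x))⁻¹ k j * pd j (fun y => f (φ.symm y)) (φ x) := by
  have hy := φ.map_source hx
  have hxy := φ.left_inv hx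
  set v := sharp (dform (n := n) f x) with hv
  set G := gramMatrix φ (φ x) with hG
  have h1 : ∀ j, pd j (fun y => f (φ.symm y)) (φ x) =
      ∑ k, coordForm φ k x v * G j k := by
    intro j
    rw [← mfderiv_coordVec hφ j hy (by rwa [hxy])]
    -- The point `φ.symm (φ x)` equals `x` only propositionally, and tangent spaces depend on the
    -- point. Generalising over `z` avoids transport between them.
    have h2 : ∀ z : M, z = x → (mfderiv (𝓡 n) 𝓘(ℝ, ℝ) f z (coordVecE φ j (φ x)) : ℝ) =
        metricAt z v (coordVecE φ j (φ x)) := by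
      rintro z rfl
      exact (inner_sharp (dform (n := n) f z) _).symm
    have h3 := h2 _ hxy
    have h4 : ∀ z : M, metricAt z v (coordVecE φ j (φ x)) =
        ∑ k, coordForm φ k x v * metricAt z (coordVecE φ k (φ x)) (coordVecE φ j (φ x)) := by
      intro z
      conv_lhs => rw [show (v : EuclideanSpace ℝ (Fin n)) = _ from
        sum_coordForm_smul_coordVec hφ hx v]
      rw [metricAt_sum_left]
      rfl
    rw [h4] at h3
    refine h3.trans (Finset.sum_congr rfl fun k _ => ?_)
    rw [metricAt_comm]
    rfl
  have h5 : (fun j => pd j (fun y => f (φ.symm y)) (φ x)) =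
      G.mulVec fun k => coordForm φ k x v := by
    ext j
    rw [h1 j]
    exact Finset.sum_congr rfl fun k _ => mul_comm _ _
  have h6 : G⁻¹.mulVec (fun j => pd j (fun y => f (φ.symm y)) (φ x)) =
      fun k => coordForm φ k x v := by
    rw [h5, Matrix.mulVec_mulVec, Matrix.nonsing_inv_mul _ (det_gramMatrix_pos hφ hy).ne'.isUnit,
      Matrix.one_mulVec]
  exact (congrFun h6 k).symm

end Gradient

end LowReg

/-! ### Test functions supported in a chart -/

namespace LowReg

open EuclSobolev

section ContMDiffLift

variable {n : ℕ} {M : Type*} [TopologicalSpace M] [T2Space M]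
  [ChartedSpace (EuclideanSpace ℝ (Fin n)) M] [IsManifold (𝓡 n) ∞ M]
  {φ : OpenPartialHomeomorph M (EuclideanSpace ℝ (Fin n))}
  {F : EuclideanSpace ℝ (Fin n) → ℝ}

theorem tsupport_lift_subset (hc : HasCompactSupport F) (hs : tsupport F ⊆ φ.target) :
    tsupport (lift φ F) ⊆ φ.symm '' tsupport F :=
  closure_minimal (fun _ hx => by_contra fun h =>
    hx (lift_eq_zero (fun _ hy => image_eq_zero_of_notMem_tsupport hy) h))
    (isClosed_image_symm hc.isCompact hs)

theorem hasCompactSupport_lift (hc : HasCompactSupport F) (hs : tsupport F ⊆ φ.target) :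
    HasCompactSupport (lift φ F) :=
  (hc.isCompact.image_of_continuousOn (φ.continuousOn_symm.mono hs)).of_isClosed_subset
    (isClosed_tsupport _) (tsupport_lift_subset hc hs)

theorem contMDiff_lift {k : WithTop ℕ∞} (hk : k ≤ (∞ : WithTop ℕ∞)) (hφ : φ ∈ charts n M)
    (hF : ContDiff ℝ k F) (hc : HasCompactSupport F) (hs : tsupport F ⊆ φ.target) :
    ContMDiff (𝓡 n) 𝓘(ℝ, ℝ) k (lift φ F) := by
  intro x
  by_cases hx : x ∈ φ.source
  · have h1 : ContMDiffAt (𝓡 n) 𝓘(ℝ, ℝ) k (fun x => F (φ x)) x :=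
      hF.contMDiff.contMDiffAt.comp x
        (((contMDiffOn_chart hφ).contMDiffAt (φ.open_source.mem_nhds hx)).of_le hk)
    refine h1.congr_of_eventuallyEq ?_
    filter_upwards [φ.open_source.mem_nhds hx] with z hz
    exact lift_of_mem hz
  · have h1 : x ∉ tsupport (lift φ F) := fun h => by
      obtain ⟨y, hy, rfl⟩ := tsupport_lift_subset hc hs h
      exact hx (φ.map_target (hs hy))
    exact contMDiffAt_const.congr_of_eventuallyEq (notMem_tsupport_iff_eventuallyEq.1 h1)

end ContMDiffLift

/-! ### Additivity of the distributional Laplacian. -/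

section Laplacian

variable {n : ℕ} {M : Type*} [TopologicalSpace M] [T2Space M]
  [ChartedSpace (EuclideanSpace ℝ (Fin n)) M]
  [RiemannianBundle (fun x : M => TangentSpace (𝓡 n) x)] [MeasurableSpace M]

variable (n) in
/-- `h = Δf` is integrable, and both sides of the integration by parts formula are integrals of
integrable functions. -/
def HasIntegrableLaplacian (f h : M → ℝ) : Prop :=
  Integrable h (vol n M) ∧
    ∃ V : ∀ x : M, TangentSpace (𝓡 n) x, HasWeakGradient n f V ∧
      ∀ η : M → ℝ, IsSmoothCompactFun n η →
        Integrable (fun x => (mfderiv (𝓡 n) 𝓘(ℝ, ℝ) η x (V x) : ℝ)) (vol n M) ∧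
        ∫ x, h x * η x ∂(vol n M) = - ∫ x, (mfderiv (𝓡 n) 𝓘(ℝ, ℝ) η x (V x) : ℝ) ∂(vol n M)

theorem HasIntegrableLaplacian.hasWeakLaplacian {f h : M → ℝ} (hf : HasIntegrableLaplacian n f h) :
    HasWeakLaplacian n f h := by
  obtain ⟨h1, V, h2, h3⟩ := hf
  exact ⟨h1.locallyIntegrable, V, h2, fun η hη => (h3 η hη).2⟩

theorem HasWeakGradient.add [IsManifold (𝓡 n) ∞ M] {f g : M → ℝ}
    {V W : ∀ x : M, TangentSpace (𝓡 n) x}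
    (hf : HasWeakGradient n f V) (hg : HasWeakGradient n g W) :
    HasWeakGradient n (fun x => f x + g x) (fun x => V x + W x) := by
  have h := HasWeakDifferential.add hf hg
  have h1 : (fun x => innerSL ℝ (V x + W x)) = fun x => innerSL ℝ (V x) + innerSL ℝ (W x) :=
    funext fun x => map_add _ _ _
  rw [HasWeakGradient, h1]
  exact h

/-- The Bochner integral is additive only on integrable functions. This is why the integrability of
`dη(V)` is kept as part of the data; that of `h η` follows since `h` is integrable and `η` bounded.
-/
theorem HasIntegrableLaplacian.add [IsManifold (𝓡 n) ∞ M] [OpensMeasurableSpace M]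
    {f g h k : M → ℝ} (hf : HasIntegrableLaplacian n f h)
    (hg : HasIntegrableLaplacian n g k) :
    HasIntegrableLaplacian n (fun x => f x + g x) (fun x => h x + k x) := by
  obtain ⟨h1, V, h2, h3⟩ := hf
  obtain ⟨k1, W, k2, k3⟩ := hg
  refine ⟨h1.add k1, _, h2.add k2, fun η hη => ?_⟩
  obtain ⟨a1, a2⟩ := h3 η hη
  obtain ⟨b1, b2⟩ := k3 η hη
  have e1 : (fun x => dform (n := n) η x (V x + W x)) = fun x =>
      dform (n := n) η x (V x) + dform (n := n) η x (W x) :=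
    funext fun x => map_add (dform (n := n) η x) (V x) (W x)
  change Integrable (fun x => dform (n := n) η x (V x)) (vol n M) at a1
  change Integrable (fun x => dform (n := n) η x (W x)) (vol n M) at b1
  change _ = -∫ x, dform (n := n) η x (V x) ∂(vol n M) at a2
  change _ = -∫ x, dform (n := n) η x (W x) ∂(vol n M) at b2
  change Integrable (fun x => dform (n := n) η x (V x + W x)) (vol n M) ∧
    ∫ x, (h x + k x) * η x ∂(vol n M) = -∫ x, dform (n := n) η x (V x + W x) ∂(vol n M)
  rw [e1]
  refine ⟨a1.add b1, ?_⟩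
  obtain ⟨c, hc⟩ := hη.2.exists_bound_of_continuous hη.1.continuous
  have hm : AEStronglyMeasurable η (vol n M) := hη.1.continuous.measurable.aestronglyMeasurable
  have i1 : Integrable (fun x => h x * η x) (vol n M) :=
    h1.mul_bdd (c := c) hm (ae_of_all _ hc)
  have i2 : Integrable (fun x => k x * η x) (vol n M) :=
    k1.mul_bdd (c := c) hm (ae_of_all _ hc)
  rw [integral_add a1 b1, neg_add, ← a2, ← b2, ← integral_add i1 i2]
  exact integral_congr_ae (ae_of_all _ fun x => add_mul _ _ _)

end Laplacian

/-! ### Integration by parts for functions supported in a chart. -/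

section ChartTest

variable {n : ℕ} {M : Type*} [TopologicalSpace M] [T2Space M]
  [ChartedSpace (EuclideanSpace ℝ (Fin n)) M] [IsManifold (𝓡 n) ∞ M]
  [RiemannianBundle (fun x : M => TangentSpace (𝓡 n) x)]
  [IsContinuousRiemannianBundle (EuclideanSpace ℝ (Fin n)) (fun x : M => TangentSpace (𝓡 n) x)]
  [MeasurableSpace M] [BorelSpace M]
  {φ : OpenPartialHomeomorph M (EuclideanSpace ℝ (Fin n))}
  {K : Set (EuclideanSpace ℝ (Fin n))} {H F : EuclideanSpace ℝ (Fin n) → ℝ}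

/-- The lift is the product of itself with the lift of the indicator of `K`, and both are in `L²`.
-/
theorem integrable_lift (hC : IsMetricC01 n M) (hφ : φ ∈ charts n M) (hK : IsCompact K)
    (hKφ : K ⊆ φ.target) (hm : Measurable H) (hH0 : ∀ y ∉ K, H y = 0)
    (hb : ∃ c, ∀ y, ‖H y‖ ≤ c) : Integrable (lift φ H) (vol n M) := by
  obtain ⟨c, hc⟩ := hb
  have h1 : MemLp (lift φ H) 2 (vol n M) := memLp_lift hC hφ hK hKφ hm hH0
    (memL2Loc_of_bound (fun _ _ _ => hm.aestronglyMeasurable) fun _ _ _ => ⟨c, fun y _ => hc y⟩)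
  have h2 : MemLp (lift φ (K.indicator fun _ => (1 : ℝ))) 2 (vol n M) :=
    memLp_lift hC hφ hK hKφ (measurable_const.indicator hK.measurableSet)
      (fun y hy => indicator_of_notMem hy _)
      (memL2Loc_of_bound (fun _ _ _ =>
        (measurable_const.indicator hK.measurableSet).aestronglyMeasurable)
        fun _ _ _ => ⟨1, fun y _ => by
          by_cases hy : y ∈ K
          · simp [hy]
          · simp [hy]⟩)
  have h3 := h1.integrable_mul h2
  refine h3.congr (ae_of_all _ fun x => ?_)
  by_cases hx : x ∈ φ.source
  · by_cases hy : φ x ∈ K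
    · simp [lift_of_mem hx, hy]
    · simp [lift_of_mem hx, hH0 _ hy]
  · simp [lift_of_notMem hx]

theorem memLp_top_lift (hm : Measurable H) (hb : ∃ c, ∀ y, ‖H y‖ ≤ c) :
    MemLp (lift φ H) ⊤ (vol n M) := by
  obtain ⟨c, hc⟩ := hb
  refine memLp_top_of_bound (measurable_lift hm).aestronglyMeasurable c (ae_of_all _ fun x => ?_)
  by_cases hx : x ∈ φ.source
  · rw [lift_of_mem hx]
    exact hc _
  · rw [lift_of_notMem hx, norm_zero]
    exact (norm_nonneg _).trans (hc 0)

/-- Each component of the flux is locally Lipschitz, so its almost everywhere derivative is a weak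
derivative and may be tested with `η`. -/
theorem IsChartTest.sum_integral_flux (hF : IsChartTest φ.target F) (hC : IsMetricC01 n M)
    (hφ : φ ∈ charts n M) {η : EuclideanSpace ℝ (Fin n) → ℝ} (hη : ContDiff ℝ ∞ η)
    (hc : HasCompactSupport η) (hs : tsupport η ⊆ φ.target) :
    ∫ y, (∑ i, pd i (flux φ F i) y) * η y = - ∫ y, ∑ i, flux φ F i y * pd i η y := by
  have h1 := fun i => (hF.locallyLipschitzOn_flux hC hφ i).hasWeakPartialDeriv φ.open_target i
  have hpd : ∀ i, Continuous (pd i η) := fun i =>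
    (hη.continuous_fderiv (by simp)).clm_apply continuous_const
  simp only [Finset.sum_mul]
  rw [integral_finsetSum _ fun i _ => integrable_mul_of_continuous (h1 i).2.1 hη.continuous hc hs,
    integral_finsetSum _ fun i _ => ?_, ← Finset.sum_neg_distrib]
  · refine Finset.sum_congr rfl fun i _ => ?_
    rw [← (neg_eq_iff_eq_neg.2 ((h1 i).2.2 η hη hc hs))]
    rfl
  · exact ((hF.continuous_flux hC hφ i).mul (hpd i)).integrable_of_hasCompactSupport
      (hF.hasCompactSupport.mono' fun y hy => tsupport_flux_subset (subset_tsupport _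
        (left_ne_zero_of_mul hy)))

/-- In coordinates `⟨∇η, ∇F⟩ = gⁱʲ ∂ⱼF ∂ᵢη`, which is the flux paired with `∂η` and divided by the
density. Replacing `η` by a global function `η'` that agrees with it near the support of `F` changes
nothing, as the flux vanishes elsewhere. -/
theorem dform_sharp_dform_lift (hF : IsChartTest φ.target F) (hφ : φ ∈ charts n M)
    {η : M → ℝ} (hη : IsSmoothCompactFun n η) {η' : EuclideanSpace ℝ (Fin n) → ℝ}
    (hηη' : ∀ y ∈ tsupport F, (fun y => η (φ.symm y)) =ᶠ[𝓝 y] η') (x : M) :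
    dform (n := n) η x (sharp (dform (lift φ F) x)) =
      lift φ (fun y => (φ.target.indicator (density φ) y)⁻¹ *
        ∑ i, flux φ F i y * pd i η' y) x := by
  have hf : ContMDiff (𝓡 n) 𝓘(ℝ, ℝ) 1 (lift φ F) :=
    contMDiff_lift (by simp) hφ hF.contDiff hF.hasCompactSupport hF.tsupport_subset
  by_cases hx : x ∈ φ.symm '' tsupport F
  · obtain ⟨y, hy, rfl⟩ := hx
    have hyt := hF.tsupport_subset hy
    have hxs := φ.map_target hyt
    rw [lift_of_mem hxs, φ.right_inv hyt, indicator_of_mem hyt]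
    set v := sharp (dform (n := n) (lift φ F) (φ.symm y)) with hv
    have e1 : dform (n := n) η (φ.symm y) v =
        ∑ i, coordForm φ i (φ.symm y) v * pd i η' y := by
      have e2 := congrArg (dform (n := n) η (φ.symm y)) (sum_coordForm_smul_coordVec hφ hxs v)
      refine e2.trans ((map_sum (dform (n := n) η (φ.symm y)) _ _).trans
        (Finset.sum_congr rfl fun i _ => ?_))
      refine ((dform (n := n) η (φ.symm y)).map_smul _ _).trans ?_
      rw [φ.right_inv hyt, ← pd_congr (hηη' y hy), ← mfderiv_coordVec hφ i hyt
        (hη.1.mdifferentiable (by simp) _)]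
      rfl
    rw [e1, Finset.mul_sum]
    refine Finset.sum_congr rfl fun i _ => ?_
    rw [hv, coordForm_sharp_dform hφ hxs (hf.mdifferentiable one_ne_zero _), φ.right_inv hyt,
      ← mul_assoc, flux, Finset.mul_sum]
    congr 1
    refine Finset.sum_congr rfl fun j _ => ?_
    have e3 : (fun y => lift φ F (φ.symm y)) =ᶠ[𝓝 y] F := by
      filter_upwards [φ.open_target.mem_nhds hyt] with z hz
      exact lift_symm hz
    rw [pd_congr e3, fluxCoeff_eq, ← mul_assoc, inv_mul_cancel_left₀ (density_pos hφ hyt).ne']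
  · rw [lift_eq_zero (K := tsupport F) (fun y hy => ?_) hx,
      dform_eq_zero_of_notMem_tsupport fun h => hx
        (tsupport_lift_subset hF.hasCompactSupport hF.tsupport_subset h)]
    · have e1 : sharp (0 : TangentSpace (𝓡 n) x →L[ℝ] ℝ) = 0 := by
        rw [sharp]
        exact map_zero _
      rw [e1]
      exact map_zero _
    · rw [Finset.sum_eq_zero fun i _ => ?_, mul_zero]
      rw [flux_eq_zero hy, zero_mul]

/-- A test function `η` on `M` need not be supported in the chart, so it is multiplied by a cutoff
equal to `1` near the support of `F`, outside which both integrands vanish. In the chart the density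
of `Vol` cancels the factor `(√det g)⁻¹`, and what remains is integration by parts for the flux. -/
theorem IsChartTest.hasIntegrableLaplacian (hF : IsChartTest φ.target F) (hC : IsMetricC01 n M)
    (hφ : φ ∈ charts n M) :
    HasIntegrableLaplacian n (lift φ F) (lift φ (chartLaplacian φ F)) := by
  have hf : ContMDiff (𝓡 n) 𝓘(ℝ, ℝ) 1 (lift φ F) :=
    contMDiff_lift (by simp) hφ hF.contDiff hF.hasCompactSupport hF.tsupport_subset
  have hK := hF.hasCompactSupport.isCompact
  refine ⟨integrable_lift hC hφ hK hF.tsupport_subset (measurable_chartLaplacian hC hφ)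
    (fun y hy => chartLaplacian_eq_zero hy) (hF.exists_bound_chartLaplacian hC hφ), _,
    hasWeakGradient_sharp (hasWeakDifferential_dform hf), fun η hη => ?_⟩
  obtain ⟨χ, hχ, hχc, hχs, hχ1⟩ := exists_contDiff_cutoff hK φ.open_target hF.tsupport_subset
  set η' : EuclideanSpace ℝ (Fin n) → ℝ := fun y => χ y * η (φ.symm y) with hη'
  have hη's : tsupport η' ⊆ tsupport χ := closure_mono fun y hy => left_ne_zero_of_mul hy
  have hη'c : HasCompactSupport η' := hχc.mul_right
  have hη'd : ContDiff ℝ ∞ η' :=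
    (hχ.contDiffOn.mul (contDiffOn_comp_chart_symm le_rfl hφ hη.1)
      ).contDiff_of_forall_notMem_eq_zero φ.open_target (isClosed_tsupport χ) hχs
      fun y hy => by rw [image_eq_zero_of_notMem_tsupport hy, zero_mul]
  have hηη' : ∀ y ∈ tsupport F, (fun y => η (φ.symm y)) =ᶠ[𝓝 y] η' := fun y hy => by
    filter_upwards [hχ1.filter_mono (nhds_le_nhdsSet hy)] with z hz
    have hz1 : χ z = 1 := hz
    simp only [hη', hz1, one_mul]
  set W : EuclideanSpace ℝ (Fin n) → ℝ := fun y => (φ.target.indicator (density φ) y)⁻¹ *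
        ∑ i, flux φ F i y * pd i η' y with hW
  have hW0 : ∀ y ∉ tsupport F, W y = 0 := fun y hy => by
    rw [hW]
    simp only [flux_eq_zero hy, zero_mul, Finset.sum_const_zero, mul_zero]
  have hWm : Measurable W :=
    (measurable_indicator_density hC hφ).inv.mul (Finset.measurable_fun_sum _ fun i _ =>
      (hF.continuous_flux hC hφ i).measurable.mul (measurable_pd i η'))
  have hpd : ∀ i, Continuous (pd i η') := fun i =>
    (hη'd.continuous_fderiv (by simp)).clm_apply continuous_const
  have hWb : ∃ c, ∀ y, ‖W y‖ ≤ c := by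
    have h1 : ContinuousOn W (tsupport F) := by
      have h2 : ContinuousOn (fun y => (density φ y)⁻¹ *
          ∑ i, flux φ F i y * pd i η' y) (tsupport F) :=
        ((locallyLipschitzOn_inv_density hC hφ).continuousOn.mono hF.tsupport_subset).mul
          (continuous_finsetSum _ fun i _ =>
            (hF.continuous_flux hC hφ i).mul (hpd i)).continuousOn
      refine h2.congr fun y hy => ?_
      rw [hW]
      simp only [indicator_of_mem (hF.tsupport_subset hy)]
    obtain ⟨c, hc⟩ := hK.exists_bound_of_continuousOn h1
    refine ⟨max c 0, fun y => ?_⟩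
    by_cases hy : y ∈ tsupport F
    · exact (hc y hy).trans (le_max_left _ _)
    · rw [hW0 y hy, norm_zero]
      exact le_max_right _ _
  have hWeq : (fun x => (mfderiv (𝓡 n) 𝓘(ℝ, ℝ) η x (sharp (dform (lift φ F) x)) : ℝ)) =
      lift φ W := funext fun x => dform_sharp_dform_lift hF hφ hη hηη' x
  rw [hWeq]
  refine ⟨integrable_lift hC hφ hK hF.tsupport_subset hWm hW0 hWb, ?_⟩
  have hLeq : (fun x => lift φ (chartLaplacian φ F) x * η x) =
      lift φ (fun y => chartLaplacian φ F y * η' y) := by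
    ext x
    by_cases hx : x ∈ φ.source
    · rw [lift_of_mem hx, lift_of_mem hx]
      by_cases hy : φ x ∈ tsupport F
      · rw [← (hηη' _ hy).eq_of_nhds, φ.left_inv hx]
      · rw [chartLaplacian_eq_zero hy, zero_mul, zero_mul]
    · rw [lift_of_notMem hx, lift_of_notMem hx, zero_mul]
  rw [hLeq, integral_lift hC hφ hWm, integral_lift hC hφ
    (H := fun y => chartLaplacian φ F y * η' y)
    ((measurable_chartLaplacian hC hφ).mul hη'd.continuous.measurable)]
  have e1 : ∫ y in φ.target, density φ y * (chartLaplacian φ F y * η' y) =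
      ∫ y, (∑ i, pd i (flux φ F i) y) * η' y := by
    refine (setIntegral_congr_fun (g := fun y => (∑ i, pd i (flux φ F i) y) * η' y) ?_
      fun y hy => ?_).trans
      (setIntegral_eq_integral_of_forall_compl_eq_zero (s := φ.target) fun y hy => ?_)
    · exact φ.open_target.measurableSet
    · simp only [chartLaplacian, indicator_of_mem hy]
      rw [← mul_assoc, mul_inv_cancel_left₀ (density_pos hφ hy).ne']
    · rw [image_eq_zero_of_notMem_tsupport fun h => hy (hχs (hη's h)), mul_zero]
  have e2 : ∫ y in φ.target, density φ y * W y = ∫ y, ∑ i, flux φ F i y * pd i η' y := by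
    refine (setIntegral_congr_fun (g := fun y => ∑ i, flux φ F i y * pd i η' y) ?_
      fun y hy => ?_).trans
      (setIntegral_eq_integral_of_forall_compl_eq_zero (s := φ.target) fun y hy => ?_)
    · exact φ.open_target.measurableSet
    · simp only [hW, indicator_of_mem hy]
      rw [mul_inv_cancel_left₀ (density_pos hφ hy).ne']
    · exact Finset.sum_eq_zero fun i _ => by
        rw [flux_eq_zero fun h => hy (hF.tsupport_subset h), zero_mul]
  rw [e1, e2]
  exact hF.sum_integral_flux hC hφ hη'd hη'c (hη's.trans hχs)

end ChartTest

/-! ### Test functions in a form closed under addition. -/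

section StrongTest

variable {n : ℕ} {M : Type*} [MetricSpace M]
  [ChartedSpace (EuclideanSpace ℝ (Fin n)) M] [IsManifold (𝓡 n) ∞ M]
  [RiemannianBundle (fun x : M => TangentSpace (𝓡 n) x)]
  [IsContinuousRiemannianBundle (EuclideanSpace ℝ (Fin n)) (fun x : M => TangentSpace (𝓡 n) x)]
  [MeasurableSpace M] [BorelSpace M]

variable (n) in
/-- A class of test functions that is visibly closed under addition. -/
def IsStrongTest (f : M → ℝ) : Prop :=
  (∃ C, LipschitzWith C f) ∧ MemLp f ⊤ (vol n M) ∧ DominatedW12 n f ∧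
    ∃ h : M → ℝ, HasIntegrableLaplacian n f h ∧ MemLp h ⊤ (vol n M) ∧ DominatedW12 n h

theorem IsStrongTest.mem_test {f : M → ℝ} (hf : IsStrongTest n f) : f ∈ Test n M := by
  obtain ⟨h1, h2, h3, h, h4, h5, h6⟩ := hf
  exact ⟨h1, h2, h3.memW12, h, h4.hasWeakLaplacian, h5, h6.memW12⟩

theorem IsStrongTest.add {f g : M → ℝ} (hf : IsStrongTest n f) (hg : IsStrongTest n g) :
    IsStrongTest n (fun x => f x + g x) := by
  obtain ⟨⟨c, h1⟩, h2, h3, h, h4, h5, h6⟩ := hf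
  obtain ⟨⟨d, k1⟩, k2, k3, k, k4, k5, k6⟩ := hg
  exact ⟨⟨_, h1.add k1⟩, h2.add k2, h3.add k3, _, h4.add k4, h5.add k5, h6.add k6⟩

variable [IsRiemannianManifold (𝓡 n) M]
  {φ : OpenPartialHomeomorph M (EuclideanSpace ℝ (Fin n))} {F : EuclideanSpace ℝ (Fin n) → ℝ}

theorem IsChartTest.isStrongTest_lift (hF : IsChartTest φ.target F) (hC : IsMetricC01 n M)
    (hW : IsMetricW n M 2) (hφ : φ ∈ charts n M) : IsStrongTest n (lift φ F) := by
  have hf : ContMDiff (𝓡 n) 𝓘(ℝ, ℝ) 1 (lift φ F) :=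
    contMDiff_lift (by simp) hφ hF.contDiff hF.hasCompactSupport hF.tsupport_subset
  have hK := hF.hasCompactSupport.isCompact
  have hm := hF.contDiff.continuous.measurable
  have hm' := measurable_chartLaplacian (F := F) hC hφ
  refine ⟨exists_lipschitzWith_of_hasCompactSupport hf
    (hasCompactSupport_lift hF.hasCompactSupport hF.tsupport_subset),
    memLp_top_lift hm (hF.hasCompactSupport.exists_bound_of_continuous hF.contDiff.continuous),
    dominatedW12_lift hC hφ hK hF.tsupport_subset hm
      (fun y hy => image_eq_zero_of_notMem_tsupport hy)
      ((hF.contDiff.contDiffOn.locallyLipschitzOn_of_isOpen φ.open_target).memWLoc_one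
        φ.open_target), _, hF.hasIntegrableLaplacian hC hφ,
    memLp_top_lift hm' (hF.exists_bound_chartLaplacian hC hφ),
    dominatedW12_lift hC hφ hK hF.tsupport_subset hm' (fun y hy => chartLaplacian_eq_zero hy)
      (hF.memWLoc_chartLaplacian hC hW hφ)⟩

end StrongTest

end LowReg

/-! ### Smooth functions, forms and vector fields -/

namespace LowReg

open EuclSobolev

section Smooth

variable {n : ℕ} {M : Type*} [TopologicalSpace M] [ChartedSpace (EuclideanSpace ℝ (Fin n)) M]
  [IsManifold (𝓡 n) ∞ M]
  {φ : OpenPartialHomeomorph M (EuclideanSpace ℝ (Fin n))}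

/-- The coordinate field is the tangent map of `φ.symm` applied to a constant field on the model. -/
theorem contMDiffOn_coordVec (hφ : φ ∈ charts n M) (i : Fin n) :
    ContMDiffOn (𝓡 n) (𝓡 n).tangent ∞
      (fun y => (⟨φ.symm y, coordVec n φ i y⟩ : TangentBundle (𝓡 n) M)) φ.target := by
  have : IsManifold (𝓡 n) 1 M := IsManifold.of_le (n := ∞) (by simp)
  have h1 := (contMDiffOn_chart_symm hφ).contMDiffOn_tangentMapWithin (m := ∞) (by simp)
    φ.open_target.uniqueMDiffOn
  have h2 : ContMDiff (𝓡 n) (𝓡 n).tangent ∞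
      (fun y : EuclideanSpace ℝ (Fin n) => (⟨y, EuclideanSpace.single i (1 : ℝ)⟩ :
        TangentBundle (𝓡 n) (EuclideanSpace ℝ (Fin n)))) := by
    intro y
    exact contMDiffAt_vectorSpace_iff_contDiffAt.2 contDiffAt_const
  refine (h1.comp h2.contMDiffOn fun y hy => hy).congr fun y hy => ?_
  simp only [Function.comp_def, tangentMapWithin, mfderivWithin_of_isOpen φ.open_target hy]
  rfl

theorem contDiffOn_form_coordVec (hφ : φ ∈ charts n M)
    {α : ∀ x : M, TangentSpace (𝓡 n) x →L[ℝ] ℝ} (hα : IsSmoothCompactForm n α) (i : Fin n) :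
    ContDiffOn ℝ ∞ (fun y => α (φ.symm y) (coordVec n φ i y)) φ.target := by
  have h1 := ContMDiffOn.clm_bundle_apply (s := φ.target) (n := ∞) (IM := 𝓡 n) (IB := 𝓡 n)
    (F₁ := EuclideanSpace ℝ (Fin n)) (F₂ := ℝ)
    (E₁ := fun x : M => TangentSpace (𝓡 n) x) (E₂ := Bundle.Trivial M ℝ)
    (b := fun y => φ.symm y) (ϕ := fun y => α (φ.symm y)) (v := fun y => coordVec n φ i y)
    (hα.1.comp_contMDiffOn (contMDiffOn_chart_symm hφ)) (contMDiffOn_coordVec hφ i)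
  rw [← contMDiffOn_iff_contDiffOn]
  intro y hy
  have h2 := h1 y hy
  simp only [contMDiffWithinAt_totalSpace] at h2
  exact h2.2

/-- The components of `V` in the chart are read off from the fibre part of the tangent map of `φ`
composed with the section `V`. -/
theorem contDiffOn_coordForm_field (hφ : φ ∈ charts n M) {V : ∀ x : M, TangentSpace (𝓡 n) x}
    (hV : IsSmoothCompactField n V) (j : Fin n) :
    ContDiffOn ℝ ∞ (fun y => coordForm φ j (φ.symm y) (V (φ.symm y))) φ.target := by
  have : IsManifold (𝓡 n) 1 M := IsManifold.of_le (n := ∞) (by simp)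
  have h1 := (contMDiffOn_chart hφ).contMDiffOn_tangentMapWithin (m := ∞) (by simp)
    φ.open_source.uniqueMDiffOn
  have h2 := h1.comp (hV.1.comp_contMDiffOn (contMDiffOn_chart_symm hφ))
    fun y hy => φ.map_target hy
  have h3 := (contMDiff_snd_tangentBundle_modelSpace (EuclideanSpace ℝ (Fin n)) (𝓡 n)
    (n := ∞)).comp_contMDiffOn h2
  have h4 := (EuclideanSpace.proj j : EuclideanSpace ℝ (Fin n) →L[ℝ] ℝ).contMDiff.comp_contMDiffOn
    h3
  rw [← contMDiffOn_iff_contDiffOn]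
  refine h4.congr fun y hy => ?_
  have h5 : mfderivWithin (𝓡 n) (𝓡 n) φ φ.source (φ.symm y) = mfderiv (𝓡 n) (𝓡 n) φ (φ.symm y) :=
    mfderivWithin_of_isOpen φ.open_source (φ.map_target hy)
  change _ = (EuclideanSpace.proj j : EuclideanSpace ℝ (Fin n) →L[ℝ] ℝ)
    (mfderivWithin (𝓡 n) (𝓡 n) φ φ.source (φ.symm y) (V (φ.symm y)))
  rw [h5]
  rfl

end Smooth

/-! ### Smooth functions, and smooth multiples of functions of limited regularity, as chart test
functions. -/

section ChartTest

variable {n : ℕ} {Ω : Set (EuclideanSpace ℝ (Fin n))} {F b g : EuclideanSpace ℝ (Fin n) → ℝ}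

theorem isChartTest_of_contDiff (hΩ : IsOpen Ω) (hF : ContDiff ℝ ∞ F) (hc : HasCompactSupport F)
    (hs : tsupport F ⊆ Ω) : IsChartTest Ω F where
  contDiff := hF.of_le (by simp)
  hasCompactSupport := hc
  tsupport_subset := hs
  locallyLipschitzOn_pd j :=
    ((contDiffOn_pd hΩ hF.contDiffOn j).of_le (by simp)).locallyLipschitzOn_of_isOpen hΩ
  memWLoc_pd i j :=
    (((contDiffOn_pd hΩ (contDiffOn_pd hΩ hF.contDiffOn j) i).of_le
      (by simp)).locallyLipschitzOn_of_isOpen hΩ).memWLoc_one hΩ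

/-- Of the four terms in `∂ᵢ∂ⱼ(b g)`, those with at most one derivative on `g` are locally Lipschitz
because `g` is `C^{1,1}`. The term `b ∂ᵢ∂ⱼg` is a smooth function times a `W^{1,2}_loc` function
because `g` is in `W^{3,2}_loc`. In the application `g` is an entry of the metric. -/
theorem isChartTest_mul (hΩ : IsOpen Ω) (hb : ContDiff ℝ ∞ b) (hc : HasCompactSupport b)
    (hs : tsupport b ⊆ Ω) (hg : ContDiffOn ℝ 1 g Ω) (hg' : LocallyLipschitzOn Ω (fderiv ℝ g))
    (hg3 : MemWLoc Ω 3 g) : IsChartTest Ω (fun y => b y * g y) := by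
  have hsub : tsupport (fun y => b y * g y) ⊆ tsupport b :=
    closure_mono fun y hy => left_ne_zero_of_mul hy
  have hgL : LocallyLipschitzOn Ω g := hg.locallyLipschitzOn_of_isOpen hΩ
  have hgd : ∀ j, LocallyLipschitzOn Ω (pd j g) := fun j =>
    hg'.contDiffAt_comp (Φ := fun A : EuclideanSpace ℝ (Fin n) →L[ℝ] ℝ =>
      A (EuclideanSpace.single j 1)) fun _ _ => (contDiff_id.clm_apply contDiff_const).contDiffAt
  have hbL : LocallyLipschitzOn Ω b :=
    (hb.of_le (by simp)).contDiffOn.locallyLipschitzOn_of_isOpen hΩ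
  have hb1 := fun j => contDiffOn_pd hΩ hb.contDiffOn j
  have hbd : ∀ j, LocallyLipschitzOn Ω (pd j b) := fun j =>
    ((hb1 j).of_le (by simp)).locallyLipschitzOn_of_isOpen hΩ
  have hbdd : ∀ i j, LocallyLipschitzOn Ω (pd i (pd j b)) := fun i j =>
    ((contDiffOn_pd hΩ (hb1 j) i).of_le (by simp)).locallyLipschitzOn_of_isOpen hΩ
  have hbdiff : ∀ y, DifferentiableAt ℝ b y := fun y => hb.differentiable (by simp) y
  have hgdiff : ∀ y ∈ Ω, DifferentiableAt ℝ g y := fun y hy =>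
    (hg.differentiableOn one_ne_zero y hy).differentiableAt (hΩ.mem_nhds hy)
  have hpd : ∀ j, EqOn (fun y => pd j b y * g y + b y * pd j g y)
      (pd j fun y => b y * g y) Ω := fun j y hy => (pd_mul (hbdiff y) (hgdiff y hy)).symm
  refine ⟨?_, hc.mul_right, hsub.trans hs, fun j => ?_, fun i j => ?_⟩
  · exact ((hb.of_le (by simp)).contDiffOn.mul hg).contDiff_of_forall_notMem_eq_zero hΩ
      (isClosed_tsupport b) hs
      fun y hy => by rw [image_eq_zero_of_notMem_tsupport hy, zero_mul]
  · exact (((hbd j).real_mul hgL).real_add (hbL.real_mul (hgd j))).congr_eqOn (hpd j)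
  · have hg2 : MemWLoc Ω 1 (pd i (pd j g)) := (hg3.pd hΩ hgL j).pd hΩ (hgd j) i
    have h1 : MemWLoc Ω 1 (fun y => (pd i (pd j b) y * g y + pd j b y * pd i g y +
        pd i b y * pd j g y) + b y * pd i (pd j g) y) :=
      MemWLoc.add (((((hbdd i j).real_mul hgL).real_add ((hbd j).real_mul (hgd i))).real_add
        ((hbd i).real_mul (hgd j))).memWLoc_one hΩ) (MemWLoc.lipschitz_mul hΩ hbL hg2)
    refine h1.congr hΩ ?_
    -- The second Leibniz rule holds only where `∂ⱼg`, which is merely Lipschitz, is differentiable;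
    -- by Rademacher this is almost everywhere.
    filter_upwards [(hgd j).ae_differentiableAt_of_isOpen (μ := volume) hΩ] with y hy hyΩ
    have e1 : (pd j fun y => b y * g y) =ᶠ[𝓝 y] fun y => pd j b y * g y + b y * pd j g y := by
      filter_upwards [hΩ.mem_nhds hyΩ] with z hz
      exact (hpd j hz).symm
    have d1 : DifferentiableAt ℝ (pd j b) y :=
      ((hb1 j).differentiableOn (by simp) y hyΩ).differentiableAt (hΩ.mem_nhds hyΩ)
    rw [pd_congr e1, pd_add (u := fun y => pd j b y * g y) (v := fun y => b y * pd j g y)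
      (d1.mul (hgdiff y hyΩ)) ((hbdiff y).mul (hy hyΩ)),
      pd_mul d1 (hgdiff y hyΩ), pd_mul (hbdiff y) (hy hyΩ)]
    ring

end ChartTest

/-! ### Partitions of unity and globalisation. -/

section Partition

variable {n : ℕ} {M : Type*} [TopologicalSpace M] [ChartedSpace (EuclideanSpace ℝ (Fin n)) M]
  [IsManifold (𝓡 n) ∞ M] [T2Space M] [SigmaCompactSpace M]

/-- A finite smooth partition of unity near a compact set, subordinate to charts. -/
theorem exists_finite_partition {K : Set M} (hK : IsCompact K) :
    ∃ (s : Finset M) (ρ : M → M → ℝ), (∀ c, ContMDiff (𝓡 n) 𝓘(ℝ, ℝ) ∞ (ρ c) ∧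
      tsupport (ρ c) ⊆ (chartAt (EuclideanSpace ℝ (Fin n)) c).source) ∧
      ∀ x ∈ K, ∑ c ∈ s, ρ c x = 1 := by
  obtain ⟨f, hf⟩ := SmoothPartitionOfUnity.exists_isSubordinate_chartAt_source (𝓡 n) M
  have hfin := f.locallyFinite.finite_nonempty_inter_compact hK
  refine ⟨hfin.toFinset, fun c => f c, fun c => ⟨(f c).contMDiff, hf c⟩, fun x hx => ?_⟩
  rw [← f.sum_eq_one (mem_univ x), finsum_eq_sum_of_support_subset]
  intro c hc
  exact hfin.mem_toFinset.2 ⟨x, hc, hx⟩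

end Partition

section StrongTest

variable {n : ℕ} {M : Type*} [MetricSpace M]
  [ChartedSpace (EuclideanSpace ℝ (Fin n)) M] [IsManifold (𝓡 n) ∞ M]
  [RiemannianBundle (fun x : M => TangentSpace (𝓡 n) x)]
  [IsContinuousRiemannianBundle (EuclideanSpace ℝ (Fin n)) (fun x : M => TangentSpace (𝓡 n) x)]
  [MeasurableSpace M] [BorelSpace M] [IsRiemannianManifold (𝓡 n) M]
  {φ : OpenPartialHomeomorph M (EuclideanSpace ℝ (Fin n))} {F : EuclideanSpace ℝ (Fin n) → ℝ}

theorem lift_congr {H : EuclideanSpace ℝ (Fin n) → ℝ} (h : EqOn F H φ.target) :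
    lift φ F = lift φ H := by
  ext x
  by_cases hx : x ∈ φ.source
  · rw [lift_of_mem hx, lift_of_mem hx, h (φ.map_source hx)]
  · rw [lift_of_notMem hx, lift_of_notMem hx]

/-- A function that is smooth on the target of a chart and vanishes outside a compact subset can be
replaced by a globally smooth one. -/
theorem contDiff_indicator {K : Set (EuclideanSpace ℝ (Fin n))} (hK : IsCompact K)
    (hKφ : K ⊆ φ.target) (hF : ContDiffOn ℝ ∞ F φ.target) (h0 : ∀ y ∈ φ.target, y ∉ K → F y = 0) :
    ContDiff ℝ ∞ (φ.target.indicator F) ∧ HasCompactSupport (φ.target.indicator F) ∧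
      tsupport (φ.target.indicator F) ⊆ φ.target := by
  have h1 : ∀ y ∉ K, φ.target.indicator F y = 0 := fun y hy => by
    by_cases hyt : y ∈ φ.target
    · rw [indicator_of_mem hyt, h0 y hyt hy]
    · exact indicator_of_notMem hyt _
  refine ⟨?_, HasCompactSupport.intro hK h1, (closure_minimal
    (fun y (hy : φ.target.indicator F y ≠ 0) => by_contra fun h => hy (h1 y h))
    hK.isClosed).trans hKφ⟩
  exact (hF.congr fun y hy => indicator_of_mem hy F).contDiff_of_forall_notMem_eq_zero
    φ.open_target hK.isClosed hKφ h1

theorem isStrongTest_lift_of_contDiffOn (hC : IsMetricC01 n M) (hW : IsMetricW n M 2)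
    (hφ : φ ∈ charts n M) {K : Set (EuclideanSpace ℝ (Fin n))} (hK : IsCompact K)
    (hKφ : K ⊆ φ.target) (hF : ContDiffOn ℝ ∞ F φ.target) (h0 : ∀ y ∈ φ.target, y ∉ K → F y = 0) :
    IsStrongTest n (lift φ F) := by
  obtain ⟨h1, h2, h3⟩ := contDiff_indicator hK hKφ hF h0
  rw [lift_congr fun y hy => (indicator_of_mem hy F).symm]
  exact (isChartTest_of_contDiff φ.open_target h1 h2 h3).isStrongTest_lift hC hW hφ

theorem isStrongTest_zero [Nonempty M] (hC : IsMetricC01 n M) (hW : IsMetricW n M 2) :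
    IsStrongTest n (fun _ : M => 0) := by
  obtain ⟨c⟩ := ‹Nonempty M›
  have h := isStrongTest_lift_of_contDiffOn (F := fun _ => 0) hC hW (chartAt_mem_charts c)
    isCompact_empty (empty_subset _) contDiffOn_const fun _ _ _ => rfl
  convert h using 1
  ext x
  exact (lift_eq_zero (K := ∅) (fun _ _ => rfl) (by simp)).symm

theorem IsStrongTest.sum [Nonempty M] (hC : IsMetricC01 n M) (hW : IsMetricW n M 2) {ι : Type*}
    {s : Finset ι} {f : ι → M → ℝ} (hf : ∀ i ∈ s, IsStrongTest n (f i)) :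
    IsStrongTest n (fun x => ∑ i ∈ s, f i x) := by
  classical
  induction s using Finset.induction_on with
  | empty => simpa using isStrongTest_zero hC hW
  | insert a s ha ih =>
    simp only [Finset.sum_insert ha]
    exact (hf a (Finset.mem_insert_self a s)).add
      (ih fun i hi => hf i (Finset.mem_insert_of_mem hi))

/-- On `M` one has `f = ∑ ρ_c f`. Each summand is the lift of a smooth function whose support in the
chart is the image of the compact set `tsupport f ∩ tsupport (ρ c)`. -/
theorem isStrongTest_of_isSmoothCompactFun [Nonempty M] [SigmaCompactSpace M]
    (hC : IsMetricC01 n M) (hW : IsMetricW n M 2) {f : M → ℝ} (hf : IsSmoothCompactFun n f) :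
    IsStrongTest n f := by
  obtain ⟨s, ρ, hρ, hρ1⟩ := exists_finite_partition (n := n) hf.2.isCompact
  have h1 : f = fun x => ∑ c ∈ s, lift (chartAt (EuclideanSpace ℝ (Fin n)) c)
      (fun y => ρ c ((chartAt (EuclideanSpace ℝ (Fin n)) c).symm y) *
        f ((chartAt (EuclideanSpace ℝ (Fin n)) c).symm y)) x := by
    ext x
    have h2 : f x = ∑ c ∈ s, ρ c x * f x := by
      rw [← Finset.sum_mul]
      by_cases hx : x ∈ tsupport f
      · rw [hρ1 x hx, one_mul]
      · rw [image_eq_zero_of_notMem_tsupport hx, mul_zero]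
    refine h2.trans (Finset.sum_congr rfl fun c _ => ?_)
    by_cases hx : x ∈ (chartAt (EuclideanSpace ℝ (Fin n)) c).source
    · rw [lift_of_mem hx, (chartAt _ c).left_inv hx]
    · rw [lift_of_notMem hx, image_eq_zero_of_notMem_tsupport fun h => hx ((hρ c).2 h), zero_mul]
  rw [h1]
  refine IsStrongTest.sum hC hW fun c _ => ?_
  set φ := chartAt (EuclideanSpace ℝ (Fin n)) c with hφdef
  have hφ : φ ∈ charts n M := chartAt_mem_charts c
  have hKc : IsCompact (tsupport f ∩ tsupport (ρ c)) := hf.2.isCompact.inter_right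
    (isClosed_tsupport _)
  have hKs : tsupport f ∩ tsupport (ρ c) ⊆ φ.source := fun x hx => (hρ c).2 hx.2
  refine isStrongTest_lift_of_contDiffOn hC hW hφ
    (hKc.image_of_continuousOn (φ.continuousOn.mono hKs)) ?_
    ((contDiffOn_comp_chart_symm le_rfl hφ (hρ c).1).mul
      (contDiffOn_comp_chart_symm le_rfl hφ hf.1)) fun y hy hyK => ?_
  · rintro _ ⟨x, hx, rfl⟩
    exact φ.map_source (hKs hx)
  · by_cases h2 : φ.symm y ∈ tsupport f
    · rw [image_eq_zero_of_notMem_tsupport fun h3 => hyK ⟨_, ⟨h2, h3⟩, φ.right_inv hy⟩, zero_mul]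
    · rw [image_eq_zero_of_notMem_tsupport h2, mul_zero]

end StrongTest

end LowReg

/-! ### Test forms and test vector fields -/

namespace LowReg

open EuclSobolev

theorem sharp_sum_smul {n : ℕ} {M : Type*} [TopologicalSpace M]
    [ChartedSpace (EuclideanSpace ℝ (Fin n)) M]
    [IsManifold (𝓡 n) ∞ M]
    [RiemannianBundle (fun x : M => TangentSpace (𝓡 n) x)] {x : M} {k : ℕ} (a : Fin k → ℝ)
    (α : Fin k → TangentSpace (𝓡 n) x →L[ℝ] ℝ) :
    sharp (∑ i, a i • α i) = ∑ i, a i • sharp (α i) := by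
  refine ext_inner_right (E := TangentSpace (𝓡 n) _) ℝ fun v => ?_
  rw [inner_sharp, sum_inner, _root_.sum_apply]
  refine Finset.sum_congr rfl fun i _ => ?_
  rw [real_inner_smul_left, inner_sharp]
  rfl

section TestSum

variable {n : ℕ} {M : Type*} [MetricSpace M]
  [ChartedSpace (EuclideanSpace ℝ (Fin n)) M] [IsManifold (𝓡 n) ∞ M]
  [RiemannianBundle (fun x : M => TangentSpace (𝓡 n) x)]
  [IsContinuousRiemannianBundle (EuclideanSpace ℝ (Fin n)) (fun x : M => TangentSpace (𝓡 n) x)]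
  [MeasurableSpace M] [BorelSpace M] [IsRiemannianManifold (𝓡 n) M]

theorem norm_smul_covector_le {x : M} {A : TangentSpace (𝓡 n) x →L[ℝ] ℝ} {C : ℝ} (a : ℝ)
    (hA : ‖A‖ ≤ C) : ‖a • A‖ ≤ C * ‖a‖ := by
  have h1 : ‖a • A‖ ≤ ‖a‖ * ‖A‖ := ContinuousLinearMap.opNorm_smul_le a A
  rw [mul_comm]
  exact h1.trans (mul_le_mul_of_nonneg_left hA (norm_nonneg a))

variable (n) in
/-- Sums `∑ fᵢ dhᵢ` of differentials of smooth compactly supported functions. -/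
def IsTestSum (β : ∀ x : M, TangentSpace (𝓡 n) x →L[ℝ] ℝ) : Prop :=
  ∃ (k : ℕ) (f h : Fin k → M → ℝ), (∀ i, IsStrongTest n (f i) ∧ IsSmoothCompactFun n (h i)) ∧
    ∀ x, β x = ∑ i, f i x • dform (h i) x

theorem IsStrongTest.memLp_two {f : M → ℝ} (hf : IsStrongTest n f) : MemLp f 2 (vol n M) :=
  hf.2.2.1.2.1

theorem IsTestSum.exists_bound {β : ∀ x : M, TangentSpace (𝓡 n) x →L[ℝ] ℝ}
    (hβ : IsTestSum n β) : ∃ B : M → ℝ, MemLp B 2 (vol n M) ∧ ∀ x, ‖β x‖ ≤ B x := by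
  obtain ⟨k, f, h, hfh, hsum⟩ := hβ
  have hc : ∀ i, ∃ C, ∀ x, ‖dform (n := n) (h i) x‖ ≤ C := fun i =>
    let ⟨C, hC⟩ := exists_norm_dform_le ((hfh i).2.1.of_le (by simp)) (hfh i).2.2
    ⟨C, hC.2⟩
  choose c hc using hc
  have hB : MemLp (fun x => ∑ i, c i * ‖f i x‖) 2 (vol n M) := by
    refine memLp_finsetSum _ fun i _ => ?_
    exact (hfh i).1.memLp_two.norm.const_mul (c i)
  refine ⟨_, hB, fun x => ?_⟩
  have h1 := norm_sum_le (E := TangentSpace (𝓡 n) x →L[ℝ] ℝ) Finset.univ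
    (fun i => f i x • dform (h i) x)
  rw [← hsum x] at h1
  exact h1.trans (Finset.sum_le_sum fun i _ => norm_smul_covector_le (f i x) (hc i x))

theorem IsTestSum.lintegral_lt_top {β : ∀ x : M, TangentSpace (𝓡 n) x →L[ℝ] ℝ}
    (hβ : IsTestSum n β) : ∫⁻ x, ‖β x‖ₑ ^ 2 ∂(vol n M) < ⊤ := by
  obtain ⟨B, hB, hle⟩ := hβ.exists_bound
  have h1 : ∫⁻ x, ‖β x‖ₑ ^ 2 ∂(vol n M) ≤ ∫⁻ x, ‖B x‖ₑ ^ 2 ∂(vol n M) := by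
    refine lintegral_mono fun x => ?_
    gcongr
    rw [← ofReal_norm, ← ofReal_norm]
    exact ENNReal.ofReal_le_ofReal ((hle x).trans (Real.le_norm_self _))
  exact h1.trans_lt hB.lintegral_enorm_sq_lt_top

theorem IsTestSum.mem_testF [Nonempty M] [SigmaCompactSpace M]
    (hC : IsMetricC01 n M) (hW : IsMetricW n M 2)
    {β : ∀ x : M, TangentSpace (𝓡 n) x →L[ℝ] ℝ} (hβ : IsTestSum n β) : β ∈ TestF n M := by
  refine ⟨hβ.lintegral_lt_top, ?_⟩
  obtain ⟨k, f, h, hfh, hsum⟩ := hβ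
  exact ⟨k, f, h, fun i => dform (h i), fun i => ⟨(hfh i).1.mem_test,
    (isStrongTest_of_isSmoothCompactFun hC hW (hfh i).2).mem_test,
    hasWeakDifferential_dform ((hfh i).2.1.of_le (by simp))⟩, ae_of_all _ hsum⟩

/-- The metric identifies `V` with `⟨V, ·⟩` isometrically, and `sharp` inverts this linearly, so
that `∑ f dh` becomes `∑ f ∇h` with the same `f` and `h`. -/
theorem IsTestSum.mem_testV [Nonempty M] [SigmaCompactSpace M]
    (hC : IsMetricC01 n M) (hW : IsMetricW n M 2)
    {V : ∀ x : M, TangentSpace (𝓡 n) x} (hV : IsTestSum n fun x => innerSL ℝ (V x)) :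
    V ∈ TestV n M := by
  have h1 : ∀ x, ‖innerSL ℝ (V x)‖ₑ = ‖V x‖ₑ := fun x => by
    rw [← ofReal_norm, ← ofReal_norm, innerSL_apply_norm]
  have h2 := hV.lintegral_lt_top
  simp only [h1] at h2
  refine ⟨h2, ?_⟩
  obtain ⟨k, f, h, hfh, hsum⟩ := hV
  refine ⟨k, f, h, fun i x => sharp (dform (h i) x), fun i => ⟨(hfh i).1.mem_test,
    (isStrongTest_of_isSmoothCompactFun hC hW (hfh i).2).mem_test,
    hasWeakGradient_sharp (hasWeakDifferential_dform ((hfh i).2.1.of_le (by simp)))⟩,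
    ae_of_all _ fun x => ?_⟩
  rw [← sharp_sum_smul, ← hsum x]
  exact ext_inner_right (E := TangentSpace (𝓡 n) _) ℝ fun v => (inner_sharp _ _).symm

/-- The coordinate functions of a chart, cut off outside a compact set. -/
theorem exists_cutoff_coord {φ : OpenPartialHomeomorph M (EuclideanSpace ℝ (Fin n))}
    (hφ : φ ∈ charts n M) {K : Set M} (hK : IsCompact K) (hKφ : K ⊆ φ.source) (i : Fin n) :
    ∃ h : M → ℝ, IsSmoothCompactFun n h ∧ ∀ x ∈ K, dform (n := n) h x = coordForm φ i x := by
  have hK' : IsCompact (φ '' K) := hK.image_of_continuousOn (φ.continuousOn.mono hKφ)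
  have hK't : φ '' K ⊆ φ.target := by
    rintro _ ⟨x, hx, rfl⟩
    exact φ.map_source (hKφ hx)
  obtain ⟨χ, hχ, hχc, hχs, hχ1⟩ := exists_contDiff_cutoff hK' φ.open_target hK't
  have h1 : ContDiff ℝ ∞ fun y : EuclideanSpace ℝ (Fin n) => χ y * y i :=
    hχ.mul (EuclideanSpace.proj i : EuclideanSpace ℝ (Fin n) →L[ℝ] ℝ).contDiff
  have h2 : HasCompactSupport fun y : EuclideanSpace ℝ (Fin n) => χ y * y i := hχc.mul_right
  have h3 : tsupport (fun y : EuclideanSpace ℝ (Fin n) => χ y * y i) ⊆ φ.target :=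
    (closure_mono fun y hy => left_ne_zero_of_mul hy).trans hχs
  refine ⟨lift φ fun y => χ y * y i, ⟨contMDiff_lift le_rfl hφ h1 h2 h3,
    hasCompactSupport_lift h2 h3⟩, fun x hx => ?_⟩
  rw [coordForm_eq_dform hφ i (hKφ hx), dform, dform]
  refine Filter.EventuallyEq.mfderiv_eq ?_
  have h4 : ∀ᶠ y in 𝓝 (φ x), χ y = 1 := hχ1.filter_mono (nhds_le_nhdsSet (mem_image_of_mem φ hx))
  filter_upwards [φ.open_source.mem_nhds (hKφ hx), (φ.continuousAt (hKφ hx)).eventually h4]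
    with z hz hz1
  rw [lift_of_mem hz, hz1, one_mul]

/-- One writes `β = ∑ ρ_c β` and expands each summand as `ρ_c β(∂ᵢ) dxⁱ`. On `K ∩ tsupport (ρ c)`
the form `dxⁱ` equals `dhᵢ` for a cut-off coordinate function `hᵢ` in `C^∞_c`; elsewhere the
coefficient vanishes and the values of `dhᵢ` are irrelevant. Only the regularity of the coefficients
is left to be checked, as hypothesis `hF`. -/
theorem isTestSum_of_forall_chart [SigmaCompactSpace M]
    {β : ∀ x : M, TangentSpace (𝓡 n) x →L[ℝ] ℝ} {K : Set M} (hK : IsCompact K)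
    (hβ : ∀ x ∉ K, β x = 0)
    (hF : ∀ φ ∈ charts n M, ∀ ρ : M → ℝ, ContMDiff (𝓡 n) 𝓘(ℝ, ℝ) ∞ ρ → tsupport ρ ⊆ φ.source →
      ∀ i, IsStrongTest n (lift φ fun y => ρ (φ.symm y) * β (φ.symm y) (coordVec n φ i y))) :
    IsTestSum n β := by
  obtain ⟨s, ρ, hρ, hρ1⟩ := exists_finite_partition (n := n) hK
  let φ : M → OpenPartialHomeomorph M (EuclideanSpace ℝ (Fin n)) := fun c => chartAt _ c
  have hφ : ∀ c, φ c ∈ charts n M := fun c => chartAt_mem_charts c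
  choose h hh hhd using fun (c : M) (i : Fin n) => exists_cutoff_coord (hφ c)
    (hK.inter_right (isClosed_tsupport (ρ c))) (fun x hx => (hρ c).2 hx.2) i
  let f : M → Fin n → M → ℝ := fun c i =>
    lift (φ c) fun y => ρ c ((φ c).symm y) * β ((φ c).symm y) (coordVec n (φ c) i y)
  have key : ∀ x, β x = ∑ p : s × Fin n, f p.1 p.2 x • dform (n := n) (h p.1 p.2) x := by
    intro x
    have h1 : β x = ∑ c ∈ s, ρ c x • β x := by
      rw [← Finset.sum_smul]
      by_cases hx : x ∈ K
      · rw [hρ1 x hx, one_smul]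
      · rw [hβ x hx, smul_zero]
    rw [Fintype.sum_prod_type]
    refine h1.trans ((Finset.sum_coe_sort s fun c => ρ c x • β x).symm.trans
      (Finset.sum_congr rfl fun c _ => ?_))
    have h0 : x ∉ K ∩ tsupport (ρ c) → ρ c x • β x = 0 := fun hx => by
      by_cases hxK : x ∈ K
      · rw [image_eq_zero_of_notMem_tsupport fun h => hx ⟨hxK, h⟩, zero_smul]
      · rw [hβ x hxK, smul_zero]
    have h2 : ∀ i, f c i x = ρ c x * β x (coordVecE (φ c) i (φ c x)) := by
      intro i
      by_cases hx : x ∈ (φ c).source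
      · have h3 : ∀ z : M, z = x → ρ c z * β z (coordVecE (φ c) i (φ c x)) =
            ρ c x * β x (coordVecE (φ c) i (φ c x)) := by
          rintro z rfl
          rfl
        exact (lift_of_mem hx).trans (h3 _ ((φ c).left_inv hx))
      · refine (lift_of_notMem hx).trans ?_
        rw [image_eq_zero_of_notMem_tsupport fun h => hx ((hρ c).2 h), zero_mul]
    by_cases hx : x ∈ K ∩ tsupport (ρ c)
    · have hxs : x ∈ (φ c).source := (hρ c).2 hx.2
      ext v
      have e1 := congrArg (β x) (sum_coordForm_smul_coordVec (hφ c) hxs v)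
      have e2 : β x v = ∑ i, coordForm (φ c) i x v * β x (coordVecE (φ c) i (φ c x)) :=
        e1.trans ((map_sum (β x) _ _).trans
          (Finset.sum_congr rfl fun i _ => (β x).map_smul _ _))
      rw [_root_.sum_apply]
      change ρ c x * β x v = ∑ i, f c i x * dform (n := n) (h c i) x v
      rw [e2, Finset.mul_sum]
      refine Finset.sum_congr rfl fun i _ => ?_
      rw [h2, hhd c i x hx]
      ring
    · rw [h0 hx]
      refine (Finset.sum_eq_zero fun i _ => ?_).symm
      have e3 : f c i x = 0 := by
        rw [h2]
        exact congrArg (fun A : TangentSpace (𝓡 n) x →L[ℝ] ℝ =>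
          A (coordVecE (φ c) i (φ c x))) (h0 hx)
      rw [e3]
      exact zero_smul ℝ (dform (n := n) (h c i) x)
  -- The double sum over charts and coordinates is reindexed by `Fin k`, as the definition of test
  -- forms demands.
  let e := Fintype.equivFin (s × Fin n)
  refine ⟨_, fun j => f (e.symm j).1 (e.symm j).2, fun j => h (e.symm j).1 (e.symm j).2,
    fun j => ⟨hF _ (hφ _) _ (hρ _).1 (hρ _).2 _, hh _ _⟩, fun x => ?_⟩
  rw [key x]
  exact (Equiv.sum_comp e.symm fun p : s × Fin n =>
    f p.1 p.2 x • dform (n := n) (h p.1 p.2) x).symm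

variable [Nonempty M] [SigmaCompactSpace M]

theorem IsSmoothCompactForm.isTestSum (hC : IsMetricC01 n M) (hW : IsMetricW n M 2)
    {α : ∀ x : M, TangentSpace (𝓡 n) x →L[ℝ] ℝ} (hα : IsSmoothCompactForm n α) :
    IsTestSum n α := by
  have h0 : ∀ x ∉ closure {x | α x ≠ 0}, α x = 0 := fun x hx =>
    by_contra fun h => hx (subset_closure h)
  refine isTestSum_of_forall_chart hα.2 h0 fun φ hφ ρ hρ hρs i => ?_
  have hKs : closure {x | α x ≠ 0} ∩ tsupport ρ ⊆ φ.source := fun x hx => hρs hx.2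
  refine isStrongTest_lift_of_contDiffOn hC hW hφ
    ((hα.2.inter_right (isClosed_tsupport ρ)).image_of_continuousOn (φ.continuousOn.mono hKs)) ?_
    ((contDiffOn_comp_chart_symm le_rfl hφ hρ).mul (contDiffOn_form_coordVec hφ hα i))
    fun y hy hyK => ?_
  · rintro _ ⟨x, hx, rfl⟩
    exact φ.map_source (hKs hx)
  · by_cases h2 : φ.symm y ∈ closure {x | α x ≠ 0}
    · rw [image_eq_zero_of_notMem_tsupport fun h3 => hyK ⟨_, ⟨h2, h3⟩, φ.right_inv hy⟩, zero_mul]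
    · rw [h0 _ h2]
      exact mul_zero _

/-- Lowering the index gives the coefficients `ρ ⟨V, ∂ᵢ⟩ = ∑ⱼ (ρ Vʲ) g_{ji}`, smooth compactly
supported functions times entries of the metric. They are not smooth in general, and the stronger
regularity of `g` makes each product a chart test function. -/
theorem IsSmoothCompactField.isTestSum (hC : IsMetricC01 n M) (hW : IsMetricW n M 2)
    (hC1 : IsMetricC11 n M) (hW3 : IsMetricW n M 3)
    {V : ∀ x : M, TangentSpace (𝓡 n) x} (hV : IsSmoothCompactField n V) :
    IsTestSum n fun x => innerSL ℝ (V x) := by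
  have h0 : ∀ x ∉ closure {x | V x ≠ 0}, V x = 0 := fun x hx =>
    by_contra fun h => hx (subset_closure h)
  refine isTestSum_of_forall_chart hV.2 (fun x hx => by rw [h0 x hx, map_zero])
    fun φ hφ ρ hρ hρs i => ?_
  have hKs : closure {x | V x ≠ 0} ∩ tsupport ρ ⊆ φ.source := fun x hx => hρs hx.2
  let b : Fin n → EuclideanSpace ℝ (Fin n) → ℝ := fun j => φ.target.indicator fun y =>
    ρ (φ.symm y) * coordForm φ j (φ.symm y) (V (φ.symm y))
  have hb : ∀ j, ContDiff ℝ ∞ (b j) ∧ HasCompactSupport (b j) ∧ tsupport (b j) ⊆ φ.target := by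
    intro j
    refine contDiff_indicator
      ((hV.2.inter_right (isClosed_tsupport ρ)).image_of_continuousOn (φ.continuousOn.mono hKs)) ?_
      ((contDiffOn_comp_chart_symm le_rfl hφ hρ).mul (contDiffOn_coordForm_field hφ hV j))
      fun y hy hyK => ?_
    · rintro _ ⟨x, hx, rfl⟩
      exact φ.map_source (hKs hx)
    · by_cases h2 : φ.symm y ∈ closure {x | V x ≠ 0}
      · rw [image_eq_zero_of_notMem_tsupport fun h3 => hyK ⟨_, ⟨h2, h3⟩, φ.right_inv hy⟩,
          zero_mul]
      · rw [h0 _ h2, map_zero, mul_zero]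
  have h1 : ∀ j, IsStrongTest n (lift φ fun y => b j y * metricCoeff n φ j i y) := fun j =>
    (isChartTest_mul φ.open_target (hb j).1 (hb j).2.1 (hb j).2.2 (hC1 φ hφ j i).1
      (hC1 φ hφ j i).2 (hW3 φ hφ j i)).isStrongTest_lift hC hW hφ
  have h2 : (lift φ fun y => ρ (φ.symm y) *
      (innerSL ℝ (V (φ.symm y)) : TangentSpace (𝓡 n) (φ.symm y) →L[ℝ] ℝ) (coordVec n φ i y)) =
      fun x => ∑ j, lift φ (fun y => b j y * metricCoeff n φ j i y) x := by
    ext x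
    by_cases hx : x ∈ φ.source
    · simp only [lift_of_mem hx]
      have hy := φ.map_source hx
      set y := φ x
      have hz := φ.map_target hy
      have e1 : metricAt (φ.symm y) (V (φ.symm y)) (coordVecE φ i y) =
          ∑ j, coordForm φ j (φ.symm y) (V (φ.symm y)) * metricCoeff n φ j i y := by
        conv_lhs => rw [show (V (φ.symm y) : EuclideanSpace ℝ (Fin n)) = _ from
          sum_coordForm_smul_coordVec hφ hz (V (φ.symm y))]
        rw [metricAt_sum_left, φ.right_inv hy]
        rfl
      change ρ (φ.symm y) * metricAt (φ.symm y) (V (φ.symm y)) (coordVecE φ i y) = _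
      rw [e1, Finset.mul_sum]
      refine Finset.sum_congr rfl fun j _ => ?_
      simp only [b, indicator_of_mem hy, mul_assoc]
    · simp only [lift_of_notMem hx, Finset.sum_const_zero]
  rw [h2]
  exact IsStrongTest.sum hC hW fun j _ => h1 j

end TestSum

end LowReg

end

theorem mainTheorem9 (n : ℕ) (M : Type*) [MetricSpace M]
    [ChartedSpace (EuclideanSpace ℝ (Fin n)) M] [IsManifold (𝓡 n) ∞ M]
    [SecondCountableTopology M] [ConnectedSpace M] [CompleteSpace M]
    [RiemannianBundle (fun x : M => TangentSpace (𝓡 n) x)]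
    [IsContinuousRiemannianBundle (EuclideanSpace ℝ (Fin n)) (fun x : M => TangentSpace (𝓡 n) x)]
    [IsRiemannianManifold (𝓡 n) M] [MeasurableSpace M] [BorelSpace M]
    (hC : LowReg.IsMetricC01 n M) (hW : LowReg.IsMetricW n M 2)
    (K : ℝ) (hRCD : MetricMeasure.IsRCD K (LowReg.vol n M)) :
    (∀ f : M → ℝ, LowReg.IsSmoothCompactFun n f → f ∈ LowReg.Test n M) ∧
    (∀ α : ∀ x : M, TangentSpace (𝓡 n) x →L[ℝ] ℝ,
      LowReg.IsSmoothCompactForm n α → α ∈ LowReg.TestF n M) ∧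
    (LowReg.IsMetricC11 n M → LowReg.IsMetricW n M 3 →
      ∀ V : ∀ x : M, TangentSpace (𝓡 n) x,
        LowReg.IsSmoothCompactField n V → V ∈ LowReg.TestV n M) := by
  have : SigmaCompactSpace M :=
    have : LocallyCompactSpace M := Manifold.locallyCompact_of_finiteDimensional (𝓡 n)
    inferInstance
  refine ⟨fun f hf => (LowReg.isStrongTest_of_isSmoothCompactFun hC hW hf).mem_test,
    fun α hα => (LowReg.IsSmoothCompactForm.isTestSum hC hW hα).mem_testF hC hW,
    fun hC1 hW3 V hV => (LowReg.IsSmoothCompactField.isTestSum hC hW hC1 hW3 hV).mem_testV hC hW⟩
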